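/- **Setting.** There are $N\ge 1$ agents, states $s\in\mathcal S$ and a common action set $\mathcal A$ with a $\sigma$-finite reference measure. A Markov game has rewards $r_i(s,a)$, transition probabilities $\mathcal P(\cdot\mid s,a)$, a discount rate $\gamma\in(0,1)$ and an initial distribution $\rho$ (a point mass for a fixed initial state). Agent $n$ has parameters $\theta_n\in\mathbb R^{M_n}$; put $\theta=(\theta_1,\dots,\theta_N)$. Its policy $\pi_{n,\theta}(\cdot\mid s)$ may depend on all of $\theta$ and has a positive density that is differentiable in $\theta$. The joint policy $\Pi_\theta$ is the product of the individual ones. Put $u_i(\theta)=\mathbb E\big[\sum_{t\ge0}\gamma^t r_i(s_t,a_t)\big]$ under $\Pi_\theta$ with $s_0\sim\rho$. The function $u$ is a potential: $\nabla_i u_i(\theta)=\nabla_i u(\theta)$ for all $i$ and $\theta$. Write $\nabla u=(\nabla_1u,\dots,\nabla_Nu)$ and $u_{\max}=\sup u$. **Assumptions.** 1. *Network.* At time $t$ agent $i$ receives information from its neighbours $\mathcal N_{i,t}=\{l:(i,l)\in\mathcal E_t\}$. The graph of the edges that occur infinitely often is (strongly) connected, and there is $T>0$ such that each of these edges occurs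 in every time window $\{t,\dots,t+T-1\}$, $t\ge1$. 2. *Weights.* For $t\ge 1$, $w^i_{jl,t}\ge0$, $\sum_l w^i_{jl,t}=1$, $w^j_{jj,t}=1$ and $w^i_{jl,t}=0$ for $l\notin\mathcal N_{i,t}\cup\{i\}$. For some $h\in(0,1)$, $w^i_{jl,t}\ge h$ whenever $i\neq j$ and $l\in\mathcal N_{i,t}\cup\{i\}$. 3. *Initial beliefs.* $\mathbb E|\hat\theta^i_{j,0}(m)-\theta_{j,0}(m)|\le\kappa$ for all $i\ne j$ and every coordinate $m$, and $\hat\theta^j_{j,0}=\theta_{j,0}$. 4. *Steps.* $\alpha_t>0$ and $\alpha_t=O(t^{-\beta})$ with $\beta\in(1/2,1)$. 5. *Rewards.* $|r_i|\le R$ with $R>0$. 6. *Scores.* For all $i,n,\theta,s$ and $a\sim\pi_{n,\theta}(\cdot\mid s)$: $\mathbb E\|\nabla_i\log\pi_{n,\theta}(a\mid s)\|\le B$ and $\mathbb E\|\nabla_i\log\pi_{n,\theta}(a\mid s)\|^2\le V^2$. The map $\theta\mapsto\nabla_i\log\pi_{n,\theta}(a\mid s)$ is $\Lambda$-Lipschitz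 for all $i,n,s,a$. Here $B,V,\Lambda\ge0$. **Algorithm (networked policy gradient play).** Agent $i$ holds beliefs $\hat\theta^i_t$ about all parameters. At iteration $t=0,1,2,\dots$ an episode is generated which, conditionally on the past $\mathcal F_t$, has the following law. Independent horizons $\mathcal T_1\sim\mathrm{Geom}(1-\gamma)$ and $\mathcal T_2\sim\mathrm{Geom}(1-\sqrt\gamma)$ on $\{0,1,\dots\}$ are drawn, and the game is played from $s_0\sim\rho$. Either all agents share one episode, in which each agent acts with its own beliefs, or every agent $i$ uses an episode of its own, in which all actions are drawn from the policies at $\hat\theta^i_t$. Let $$\hat\nabla_i u_i=\frac{1}{1-\gamma}\,\hat R_i\sum_{n}\nabla_i\log\pi_{n,\hat\theta^i_t}(a_{n,\mathcal T_1}\mid s_{\mathcal T_1}),$$ where $\hat R_i$ is one of the three estimators $$\hat Q_i,\qquad \hat Q_i-\hat V_i(s_{\mathcal T_1}),\qquad r_i(s_{\mathcal T_1},a_{\mathcal T_1})+\gamma\hat V_i(s_{\mathcal T_1+1})-\hat V_i(s_{\mathcal T_1}).$$ Here $\hat Q_i=\sum_{k=0}^{\mathcal T_2}\gamma^{k/2}r_i(s_{\mathcal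 T_1+k},a_{\mathcal T_1+k})$ and $\hat V_i(s_{\mathcal T_1+1})=\sum_{k=0}^{\mathcal T_2}\gamma^{k/2}r_i(s_{\mathcal T_1+1+k},a_{\mathcal T_1+1+k})$. The estimate $\hat V_i(s_{\mathcal T_1})$ is the analogous sum over an additional rollout from $s_{\mathcal T_1}$ with its own $\mathrm{Geom}(1-\sqrt\gamma)$ horizon, conditionally independent of the rest. The updates are $$\theta_{i,t+1}=\theta_{i,t}+\alpha_t\hat\nabla_iu_i,\qquad \hat\theta^i_{j,t+1}=\sum_{l\ne j}w^i_{jl,t+1}\hat\theta^l_{j,t}+w^i_{jj,t+1}\theta_{j,t+1}.$$ $\mathcal F_t$ is the $\sigma$-algebra generated by the parameters and beliefs up to time $t$ and by the horizons $\mathcal T_1,\mathcal T_2$ and the states and actions up to $\mathcal T_1+\mathcal T_2+1$ of the episodes before iteration $t$. **Claim.** There is a constant $L>0$, depending only on $N,\gamma,R,B,V,\Lambda$, such that in every such game $u$ is bounded above, each policy gradient satisfies $\|\nabla_iu_i(\theta^1)-\nabla_iu_i(\theta^2)\|\le L\|\theta^1-\theta^2\|$, each $u_{\max}-u(\theta_t)$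 is integrable, and for every $t\ge0$, almost surely, $$\mathbb E[u_{\max}-u(\theta_{t+1})\mid\mathcal F_t]-(u_{\max}-u(\theta_t))\le-\alpha_t\|\nabla u(\theta_t)\|^2+\alpha_tL\sum_i\sum_{j\ne i}\|\theta_{j,t}-\hat\theta^i_{j,t}\|+\frac{1}{2(1-\sqrt\gamma)}LN^3RV^2\alpha_t^2 .$$ Consequently $\sum_{t=0}^\infty\alpha_t\|\nabla u(\theta_t)\|^2<\infty$ almost surely. -/

import Mathlib

open MeasureTheory ProbabilityTheory Filter Topology
open scoped ENNReal

noncomputable section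

namespace MarkovPG

/-! ### Parameters and block gradients -/

/-- Joint policy parameters `θ = (θ_1, …, θ_N)`, `θ_i ∈ ℝ^{M_i}`, with the Euclidean norm. -/
abbrev Params {N : ℕ} (M : Fin N → ℕ) : Type :=
  PiLp 2 (fun i : Fin N => EuclideanSpace ℝ (Fin (M i)))

/-- The parameter vector `(x, θ_{-i})`. -/
def Params.update {N : ℕ} {M : Fin N → ℕ} (θ : Params M) (i : Fin N)
    (x : EuclideanSpace ℝ (Fin (M i))) : Params M :=
  WithLp.toLp 2 (Function.update (WithLp.ofLp θ) i x)

/-- `∇_i f(θ) = ∂f/∂θ_i (θ)`. -/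
def blockGrad {N : ℕ} {M : Fin N → ℕ} (i : Fin N) (f : Params M → ℝ) (θ : Params M) :
    EuclideanSpace ℝ (Fin (M i)) :=
  gradient (fun x => f (θ.update i x)) (θ i)

/-- `∇f(θ) = (∇_1 f(θ), …, ∇_N f(θ))`. -/
def fullGrad {N : ℕ} {M : Fin N → ℕ} (f : Params M → ℝ) (θ : Params M) : Params M :=
  WithLp.toLp 2 (fun i => blockGrad i f θ)

/-! ### Markov games and parametrized policies -/

/-- A Markov game among `N` agents with state space `S`, common action space `A`, rewards `r_i`,
transition probabilities `P`, discount rate `γ` and initial state distribution `ρ`. -/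
structure MarkovGame (N : ℕ) (S A : Type*) [MeasurableSpace S] [MeasurableSpace A] where
  r : Fin N → S × (Fin N → A) → ℝ
  measurable_r : ∀ i, Measurable (r i)
  P : Kernel (S × (Fin N → A)) S
  markov_P : IsMarkovKernel P
  γ : ℝ
  γ_pos : 0 < γ
  γ_lt_one : γ < 1
  ρ : Measure S
  prob_ρ : IsProbabilityMeasure ρ

attribute [instance] MarkovGame.markov_P MarkovGame.prob_ρ

/-- Differentiable parametrized policies `π_{n,θ}(· | s)`, given by positive probability densities
`dens n θ s` with respect to a reference measure `ν` on the action space (counting measure for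
finitely many actions, Lebesgue measure for Gaussian policies). The policy of agent `n` may depend
on the parameters of all the agents. -/
structure PolicyFamily {N : ℕ} (M : Fin N → ℕ) (S A : Type*) [MeasurableSpace S]
    [MeasurableSpace A] (ν : Measure A) where
  dens : Fin N → Params M → S → A → ℝ
  dens_pos : ∀ n θ s a, 0 < dens n θ s a
  measurable_dens : ∀ n θ, Measurable (fun x : S × A => dens n θ x.1 x.2)
  integral_dens : ∀ n θ s, ∫ a, dens n θ s a ∂ν = 1
  differentiable_dens : ∀ n s a, Differentiable ℝ (fun θ => dens n θ s a)

section Play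

variable {N : ℕ} {M : Fin N → ℕ} {S A : Type*} [MeasurableSpace S] [MeasurableSpace A]
  {ν : Measure A}

/-- `∇_i log π_{n,θ}(a_n | s)`. -/
def PolicyFamily.score (π : PolicyFamily M S A ν) (i n : Fin N) (θ : Params M) (s : S) (a : A) :
    EuclideanSpace ℝ (Fin (M i)) :=
  blockGrad i (fun ϑ => Real.log (π.dens n ϑ s a)) θ

/-- The density of the joint action when agent `n` acts with the parameters `b n`,
independently of the others given the state. -/
def PolicyFamily.jointDens (π : PolicyFamily M S A ν) (b : Fin N → Params M) (s : S)
    (a : Fin N → A) : ℝ≥0∞ :=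
  ENNReal.ofReal (∏ n, π.dens n (b n) s (a n))

lemma PolicyFamily.measurable_jointDens (π : PolicyFamily M S A ν) (b : Fin N → Params M) :
    Measurable (Function.uncurry (π.jointDens b)) := by
  unfold PolicyFamily.jointDens Function.uncurry
  refine ENNReal.measurable_ofReal.comp (Finset.measurable_prod _ fun n _ => ?_)
  exact (π.measurable_dens n (b n)).comp
    (measurable_fst.prodMk ((measurable_pi_apply n).comp measurable_snd))

variable [SigmaFinite ν]

/-- The joint policy when agent `n` acts with the parameters `b n`: a product of conditionally
independent individual policies. The joint policy `Π_θ` is the case `b n = θ` for all `n`. -/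
def PolicyFamily.joint (π : PolicyFamily M S A ν) (b : Fin N → Params M) :
    Kernel S (Fin N → A) :=
  Kernel.withDensity (Kernel.const S (Measure.pi fun _ : Fin N => ν)) (π.jointDens b)

instance PolicyFamily.isMarkovKernel_joint (π : PolicyFamily M S A ν) (b : Fin N → Params M) :
    IsMarkovKernel (π.joint b) := by
  refine ⟨fun s => ⟨?_⟩⟩
  unfold PolicyFamily.joint
  rw [Kernel.withDensity_apply' _ (π.measurable_jointDens b)]
  simp only [Measure.restrict_univ, Kernel.const_apply]
  have h1 : ∫ a : Fin N → A, ∏ n, π.dens n (b n) s (a n) ∂(Measure.pi fun _ : Fin N => ν) = 1 := by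
    rw [integral_fintype_prod_eq_prod (f := fun n a => π.dens n (b n) s a)]
    exact Finset.prod_eq_one fun n _ => π.integral_dens n (b n) s
  have hint : Integrable (fun a : Fin N → A => ∏ n, π.dens n (b n) s (a n))
      (Measure.pi fun _ : Fin N => ν) := by
    by_contra h
    rw [integral_undef h] at h1
    exact zero_ne_one h1
  unfold PolicyFamily.jointDens
  rw [← ofReal_integral_eq_lintegral_ofReal hint
    (Eventually.of_forall fun a => Finset.prod_nonneg fun n _ => (π.dens_pos n _ s _).le), h1]
  simp

/-- One step `(s, a) ↦ (s', a')` of the state-action chain: `s' ∼ P(· | s, a)` and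
`a'` drawn from the joint policy at `s'`. -/
def stepKernel (G : MarkovGame N S A) (π : PolicyFamily M S A ν) (b : Fin N → Params M) :
    Kernel (S × (Fin N → A)) (S × (Fin N → A)) :=
  G.P ⊗ₖ Kernel.prodMkLeft (S × (Fin N → A)) (π.joint b)

instance isMarkovKernel_stepKernel (G : MarkovGame N S A) (π : PolicyFamily M S A ν)
    (b : Fin N → Params M) : IsMarkovKernel (stepKernel G π b) := by
  unfold stepKernel
  infer_instance

variable (N S A) in
/-- State-action trajectories `(s_k, a_k)_{k ≥ 0}`. -/
abbrev Path : Type _ := ℕ → S × (Fin N → A)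

/-- `stepKernel` as a transition from the trajectory up to time `k` to time `k + 1`. -/
def historyKernel (G : MarkovGame N S A) (π : PolicyFamily M S A ν) (b : Fin N → Params M)
    (k : ℕ) : Kernel ((j : Finset.Iic k) → (fun _ : ℕ => S × (Fin N → A)) j)
      (S × (Fin N → A)) :=
  (stepKernel G π b).comap (fun x => x ⟨k, Finset.mem_Iic.2 le_rfl⟩) (measurable_pi_apply _)

instance isMarkovKernel_historyKernel (G : MarkovGame N S A) (π : PolicyFamily M S A ν)
    (b : Fin N → Params M) (k : ℕ) : IsMarkovKernel (historyKernel G π b k) := by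
  unfold historyKernel
  infer_instance

/-- The law of the trajectory with `s_0 = s`, `a_k` drawn from the joint policy at `s_k`, and
`s_{k+1} ∼ P(· | s_k, a_k)`, as a function of `s`. -/
def pathKernel (G : MarkovGame N S A) (π : PolicyFamily M S A ν) (b : Fin N → Params M) :
    Kernel S (Path N S A) :=
  Kernel.traj (X := fun _ : ℕ => S × (Fin N → A)) (historyKernel G π b) 0 ∘ₖ
    ((Kernel.id ×ₖ π.joint b).map
      (MeasurableEquiv.piUnique (fun _ : Finset.Iic 0 => S × (Fin N → A))).symm)

instance isMarkovKernel_pathKernel (G : MarkovGame N S A) (π : PolicyFamily M S A ν)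
    (b : Fin N → Params M) : IsMarkovKernel (pathKernel G π b) := by
  unfold pathKernel
  have := Kernel.IsMarkovKernel.map (Kernel.id ×ₖ π.joint b)
    (MeasurableEquiv.piUnique (fun _ : Finset.Iic 0 => S × (Fin N → A))).symm.measurable
  infer_instance

/-- The value function `V_i^{Π_θ}(s)`. -/
def valueFn (G : MarkovGame N S A) (π : PolicyFamily M S A ν) (i : Fin N) (θ : Params M)
    (s : S) : ℝ :=
  ∫ x, ∑' k : ℕ, G.γ ^ k * G.r i (x k) ∂(pathKernel G π (fun _ => θ) s)

/-- The utility `u_i(θ)`: the value of `Π_θ` when the initial state is drawn from `ρ`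
(a point mass for a fixed initial state). -/
def utility (G : MarkovGame N S A) (π : PolicyFamily M S A ν) (i : Fin N) (θ : Params M) : ℝ :=
  ∫ s, valueFn G π i θ s ∂G.ρ

/-- `u` is a potential of the game: `∇_i u_i = ∇_i u` on the whole parameter space. -/
def IsPotential (G : MarkovGame N S A) (π : PolicyFamily M S A ν) (u : Params M → ℝ) : Prop :=
  ∀ (i : Fin N) (θ : Params M),
    DifferentiableAt ℝ (fun x => u (θ.update i x)) (θ i) ∧
      blockGrad i (utility G π i) θ = blockGrad i u θ

/-! ### Episodic gradient estimation -/

variable (N S A) in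
/-- The data of one episode: the horizons `T₁`, `T₂`, an additional horizon `T₃`,
the trajectory `x`, and an additional rollout `y` from the state reached at time `T₁`
(`T₃` and `y` are only used for estimating the value function). The algorithm only looks at finitely
many terms of the trajectories. -/
abbrev Episode : Type _ := (ℕ × ℕ × ℕ × Path N S A) × Path N S A

def Episode.T₁ (e : Episode N S A) : ℕ := e.1.1
def Episode.T₂ (e : Episode N S A) : ℕ := e.1.2.1
def Episode.T₃ (e : Episode N S A) : ℕ := e.1.2.2.1
def Episode.main (e : Episode N S A) : Path N S A := e.1.2.2.2
def Episode.extra (e : Episode N S A) : Path N S A := e.2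

/-- The trajectory of the episode frozen at time `T₁ + T₂ + 1`. -/
def Episode.stopped (e : Episode N S A) : Path N S A :=
  fun k => e.main (min k (e.T₁ + e.T₂ + 1))

/-- `Geom(1 - γ)` on `{0, 1, …}`. -/
def horizonLaw₁ (G : MarkovGame N S A) : Measure ℕ :=
  geometricMeasure ⟨1 - G.γ, by linarith [G.γ_lt_one], by linarith [G.γ_pos]⟩

/-- `Geom(1 - γ^{1/2})` on `{0, 1, …}`. -/
def horizonLaw₂ (G : MarkovGame N S A) : Measure ℕ :=
  geometricMeasure ⟨1 - Real.sqrt G.γ,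
    by linarith [Real.sqrt_le_one.2 G.γ_lt_one.le], by linarith [Real.sqrt_nonneg G.γ]⟩

/-- The law of an episode in which agent `n` acts with the parameters `b n`: `s_0 ∼ ρ`,
independent horizons `T₁ ∼ Geom(1 - γ)` and `T₂, T₃ ∼ Geom(1 - γ^{1/2})`, and, given all of these
and the trajectory, a fresh rollout that starts from the state `s_{T₁}`. -/
def episodeLaw (G : MarkovGame N S A) (π : PolicyFamily M S A ν) (b : Fin N → Params M) :
    Measure (Episode N S A) :=
  ((horizonLaw₁ G).prod ((horizonLaw₂ G).prod ((horizonLaw₂ G).prod (pathKernel G π b ∘ₘ G.ρ)))) ⊗ₘ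
    ((pathKernel G π b).comap (fun e : ℕ × ℕ × ℕ × Path N S A => (e.2.2.2 e.1).1)
      (measurable_from_prod_countable_right fun k =>
        measurable_fst.comp ((measurable_pi_apply k).comp (measurable_snd.comp measurable_snd))))

/-- The three admissible estimators: `Q`-function, advantage, temporal difference. -/
inductive GainEstimator
  | qFunction
  | advantage
  | temporalDifference

/-- The discounted sum `∑_{k ≤ T} γ^{k/2} r_i(s_{m+k}, a_{m+k})`. -/
def rolloutSum (G : MarkovGame N S A) (i : Fin N) (x : Path N S A) (m T : ℕ) : ℝ :=
  ∑ k ∈ Finset.range (T + 1), Real.sqrt G.γ ^ k * G.r i (x (m + k))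

/-- The estimate `R̂_i`, i.e. `Q̂_i(s_{T₁}, a_{T₁})`, or `Q̂_i(s_{T₁}, a_{T₁}) - V̂_i(s_{T₁})`, or
`r_i(s_{T₁}, a_{T₁}) + γ V̂_i(s_{T₁+1}) - V̂_i(s_{T₁})`. -/
def gain (G : MarkovGame N S A) (est : GainEstimator) (i : Fin N) (e : Episode N S A) : ℝ :=
  match est with
  | .qFunction => rolloutSum G i e.main e.T₁ e.T₂
  | .advantage => rolloutSum G i e.main e.T₁ e.T₂ - rolloutSum G i e.extra 0 e.T₃
  | .temporalDifference =>
      G.r i (e.main e.T₁) + G.γ * rolloutSum G i e.main (e.T₁ + 1) e.T₂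
        - rolloutSum G i e.extra 0 e.T₃

/-- Agent `i`'s stochastic gradient, with score functions evaluated at the parameters `θ`:
`(1 - γ)⁻¹ R̂_i ∑_n ∇_i log π_{n,θ}(a_{n,T₁} | s_{T₁})`. -/
def stochGrad (G : MarkovGame N S A) (π : PolicyFamily M S A ν) (est : GainEstimator) (i : Fin N)
    (θ : Params M) (e : Episode N S A) : EuclideanSpace ℝ (Fin (M i)) :=
  ((1 - G.γ)⁻¹ * gain G est i e) •
    ∑ n, π.score i n θ (e.main e.T₁).1 ((e.main e.T₁).2 n)

/-! ### Standing assumptions -/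

/-- Bounded rewards. -/
def BoundedRewards (G : MarkovGame N S A) (R : ℝ) : Prop :=
  ∀ i x, |G.r i x| ≤ R

/-- Score functions with conditional first moments at most `B` and second moments at most `V²`,
and `Λ`-Lipschitz in the parameters. -/
structure ScoreBounds (π : PolicyFamily M S A ν) (B V Λ : ℝ) : Prop where
  first_moment : ∀ i n θ s,
    ∫⁻ a, ‖π.score i n θ s a‖ₑ * ENNReal.ofReal (π.dens n θ s a) ∂ν ≤ ENNReal.ofReal B
  second_moment : ∀ i n θ s,
    ∫⁻ a, ‖π.score i n θ s a‖ₑ ^ 2 * ENNReal.ofReal (π.dens n θ s a) ∂ν ≤ ENNReal.ofReal (V ^ 2)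
  lipschitz : ∀ i n θ₁ θ₂ s a,
    ‖π.score i n θ₁ s a - π.score i n θ₂ s a‖ ≤ Λ * ‖θ₁ - θ₂‖

/-- The edge `(i, j)` is active infinitely often. -/
def PersistentEdge (E : ℕ → Fin N → Fin N → Prop) (i j : Fin N) : Prop :=
  ∃ᶠ t in atTop, E t i j

/-- Connectivity of the time-varying network: `E t i j` says that agent `i` receives information
from agent `j` at time `t`. The persistent edges form a (strongly) connected graph and each of
them appears in every time window of some fixed length. -/
def ConnectedNetwork (E : ℕ → Fin N → Fin N → Prop) : Prop :=
  (∀ i j, Relation.ReflTransGen (PersistentEdge E) i j) ∧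
    ∃ T : ℕ, 0 < T ∧ ∀ i j, PersistentEdge E i j → ∀ t, 1 ≤ t → ∃ τ < T, E (t + τ) i j

/-- Belief weights: `w t i j l` is the weight that agent `i` puts at time `t` on agent `l`'s estimate
of agent `j`'s parameters. -/
structure BeliefWeights (E : ℕ → Fin N → Fin N → Prop) (w : ℕ → Fin N → Fin N → Fin N → ℝ)
    (h : ℝ) : Prop where
  nonneg : ∀ t, 1 ≤ t → ∀ i j l, 0 ≤ w t i j l
  lower_bound : ∀ t, 1 ≤ t → ∀ i j, i ≠ j → ∀ l, (E t i l ∨ l = i) → h ≤ w t i j l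
  eq_zero : ∀ t, 1 ≤ t → ∀ i j l, ¬ (E t i l ∨ l = i) → w t i j l = 0
  self : ∀ t, 1 ≤ t → ∀ j, w t j j j = 1
  sum_eq_one : ∀ t, 1 ≤ t → ∀ i j, ∑ l, w t i j l = 1

/-! ### Networked policy gradient play -/

/-- How the episodes at an iteration are generated: either the agents play one common episode in
which agent `n` acts with its own beliefs, or every agent `i` runs its own episode, in
which all the actions are drawn from the policies evaluated at the beliefs of agent `i`. -/
inductive EpisodeMode
  | common
  | individual

/-- The agent whose beliefs determine the actions of agent `n` in the episode used by agent `i`. -/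
def EpisodeMode.believer (mode : EpisodeMode) (i n : Fin N) : Fin N :=
  match mode with
  | .common => n
  | .individual => i

variable {Ω : Type*}

/-- The information `F_t`: parameters and beliefs up to time `t`, and the horizons, states and
actions of the episodes at the iterations before `t`. -/
@[reducible] def pastSigma (θ : ℕ → Ω → Params M) (θhat : ℕ → Fin N → Ω → Params M)
    (ξ : ℕ → Fin N → Ω → Episode N S A) (t : ℕ) : MeasurableSpace Ω :=
  (⨆ τ ∈ Set.Iic t, MeasurableSpace.comap (θ τ) inferInstance) ⊔
  (⨆ τ ∈ Set.Iic t, ⨆ i, MeasurableSpace.comap (θhat τ i) inferInstance) ⊔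
  (⨆ τ ∈ Set.Iio t, ⨆ i, MeasurableSpace.comap
    (fun ω => ((ξ τ i ω).T₁, (ξ τ i ω).T₂, (ξ τ i ω).stopped)) inferInstance)

/-- The processes `θ t` (joint parameters), `θhat t i` (agent `i`'s belief about all the
parameters, its own ones being known exactly) and `ξ t i` (the episode used by agent `i` at
iteration `t`) follow networked policy gradient play. -/
structure IsNetworkedPlay [MeasurableSpace Ω] (μ : Measure Ω) (G : MarkovGame N S A)
    (π : PolicyFamily M S A ν) (est : GainEstimator) (mode : EpisodeMode) (α : ℕ → ℝ)
    (w : ℕ → Fin N → Fin N → Fin N → ℝ) (θ : ℕ → Ω → Params M)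
    (θhat : ℕ → Fin N → Ω → Params M) (ξ : ℕ → Fin N → Ω → Episode N S A) : Prop where
  measurable_params : ∀ t, Measurable (θ t)
  measurable_beliefs : ∀ t i, Measurable (θhat t i)
  measurable_episodes : ∀ t i, Measurable (ξ t i)
  init_own : ∀ i ω, θhat 0 i ω i = θ 0 ω i
  common_episode : mode = .common → ∀ t i j ω, ξ t i ω = ξ t j ω
  /-- Given the past, the episode used by agent `i` follows the law of an episode
  played with the current beliefs. -/
  episode_law : ∀ t i (D : Set (Episode N S A)), MeasurableSet D →
    (μ[(ξ t i ⁻¹' D).indicator (fun _ => (1 : ℝ)) | pastSigma θ θhat ξ t]) =ᵐ[μ]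
      fun ω => (episodeLaw G π (fun n => θhat t (mode.believer i n) ω)).real D
  /-- Stochastic gradient step. -/
  params_step : ∀ t i ω,
    θ (t + 1) ω i = θ t ω i + α t • stochGrad G π est i (θhat t i ω) (ξ t i ω)
  /-- Consensus step; agent `j` is the source of its own, already updated, parameters. -/
  beliefs_step : ∀ t i j ω,
    θhat (t + 1) i ω j =
      ∑ l, w (t + 1) i j l • (if l = j then θ (t + 1) ω j else θhat t l ω j)

/-- The first moments of the initial belief errors are at most `κ`, coordinate by coordinate. -/
def InitialBeliefErrors [MeasurableSpace Ω] (μ : Measure Ω) (θ : ℕ → Ω → Params M)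
    (θhat : ℕ → Fin N → Ω → Params M) (κ : ℝ) : Prop :=
  ∀ i j, i ≠ j → ∀ m : Fin (M j),
    ∫⁻ ω, ‖θhat 0 i ω j m - θ 0 ω j m‖ₑ ∂μ ≤ ENNReal.ofReal κ

/-- The gap `u_max - u(θ)`, where `u_max` is the supremum of `u`. -/
def potentialGap (u : Params M → ℝ) (θ : Params M) : ℝ :=
  (⨆ ϑ, u ϑ) - u θ

end Play

end MarkovPG

end

open MeasureTheory ProbabilityTheory Filter Topology
open scoped ENNReal

noncomputable section

namespace MarkovPG

/-! The argument is a stochastic descent estimate for the gap of the potential, in which the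
disagreement between beliefs and true parameters enters linearly, together with a consensus estimate
showing that this disagreement is summable against the step sizes.

Smoothness. Along a segment of parameters the joint action density has derivative density times
score. The moment bounds and the Lipschitz property of the scores therefore make the density
Lipschitz in L¹, also with the score as a weight, and give a quadratic Taylor remainder
(`ScoreBounds.lintegral_jointReal_sub_mul_scoreSum_le`,
`ScoreBounds.lintegral_jointReal_taylor_le`). Through the performance difference lemma
`BddMeas.discVal_sub` these estimates pass to discounted values. This yields the policy gradient
theorem `ScoreBounds.hasFDerivAt_discVal` and Lipschitz policy gradients. A potential has the same
block gradients, so it is `BlockSmooth`. Along the block of agent i it differs from the i-th utility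
by a constant, so its total oscillation is finite.

Bias. The horizon T₁ is geometric, so the state at T₁ follows the normalized discounted occupancy.
The weight `√γ ^ k` and the survival probability `√γ ^ k` of the second horizon multiply to `γ ^ k`,
so the rollout has the conditional mean of the Q-function of the policy that is actually played. A
baseline depending on the state only has no effect when scores and actions use the same parameters.
What remains is the mismatch between beliefs and parameters, hence a bias linear in the belief
errors (`ScoreBounds.abs_integral_inner_stochGrad_sub_le`).

Descent. Scores may be evaluated at parameters other than those generating the actions, and belief
errors have only first moments. The step is therefore bounded by X + Y, where X is a multiple of the
score norms at the acting parameters (second moment controlled) and Y is a multiple of the belief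
mismatch. `BlockSmooth.sub_le_neg_inner_add` pays quadratically for X and linearly for Y.
Conditioning on the past, with the episode law written as a kernel in the beliefs, gives
`IsNetworkedPlay.condExp_potentialGap_le`; the constant L dominates all the constants that occur.

Consensus. The source knows its own parameter exactly, and its information reaches every agent along
persistent edges in bounded time. Expected errors thus contract over a fixed window, up to a
perturbation of size O(α_t) times one plus the total expected error. As α_t is square summable up to
domination, the expected errors weighted by the steps are summable
(`BeliefWeights.summable_errors`). Integrating the descent inequality and telescoping the
nonnegative gap bounds the expected sum of `α t * ‖fullGrad u (θ t ω)‖ ^ 2`, which is therefore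
finite almost surely. -/

/-! ### Analytic preliminaries -/

/-- An `L¹` mean value inequality: if `D t x` is continuously differentiable in `t` then the
weighted `L¹` norm of `D 1 - D 0` is at most the largest weighted `L¹` norm of the derivative. -/
lemma lintegral_sub_le_of_deriv {X : Type*} [MeasurableSpace X] (m : Measure X) [SigmaFinite m]
    (D D' : ℝ → X → ℝ) (g : X → ℝ≥0∞) (C : ℝ≥0∞)
    (hD : ∀ t x, HasDerivAt (fun t => D t x) (D' t x) t)
    (hc : ∀ x, Continuous fun t => D' t x) (hm : ∀ t, Measurable (D' t)) (hg : Measurable g)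
    (hC : ∀ t ∈ Set.Icc (0 : ℝ) 1, ∫⁻ x, ‖D' t x‖ₑ * g x ∂m ≤ C) :
    ∫⁻ x, ‖D 1 x - D 0 x‖ₑ * g x ∂m ≤ C := by
  -- A Carathéodory function (continuous in `t`, measurable in `x`) is jointly measurable, which
  -- Tonelli needs below. No integrability of `D` is used.
  have hjm : Measurable (Function.uncurry D') :=
    measurable_uncurry_of_continuous_of_measurable hc hm
  have hpt : ∀ x, ‖D 1 x - D 0 x‖ₑ * g x ≤
      ∫⁻ t in Set.Ioc (0 : ℝ) 1, ‖D' t x‖ₑ * g x := by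
    intro x
    have h1 : D 1 x - D 0 x = ∫ t in (0 : ℝ)..1, D' t x :=
      (intervalIntegral.integral_eq_sub_of_hasDerivAt (fun t _ => hD t x)
        ((hc x).intervalIntegrable _ _)).symm
    rw [h1, intervalIntegral.integral_of_le zero_le_one, lintegral_mul_const _
      ((hc x).measurable.enorm)]
    gcongr
    exact enorm_integral_le_lintegral_enorm _
  calc ∫⁻ x, ‖D 1 x - D 0 x‖ₑ * g x ∂m
      ≤ ∫⁻ x, (∫⁻ t in Set.Ioc (0 : ℝ) 1, ‖D' t x‖ₑ * g x) ∂m := lintegral_mono hpt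
    _ = ∫⁻ t in Set.Ioc (0 : ℝ) 1, (∫⁻ x, ‖D' t x‖ₑ * g x ∂m) := by
        rw [lintegral_lintegral_swap]
        refine Measurable.aemeasurable ?_
        exact ((hjm.comp measurable_swap).enorm).mul (hg.comp measurable_fst)
    _ ≤ ∫⁻ _ in Set.Ioc (0 : ℝ) 1, C := by
        refine setLIntegral_mono measurable_const fun t ht => hC t ⟨ht.1.le, ht.2⟩
    _ = C := by simp

/-- Conditioning on a `σ`-algebra `F`: if `ξ` has conditional law `κ (Z ω)` with `Z` measurable
with respect to `F`, then on every `A ∈ F` the joint law of `(Z, ξ)` is a composition-product. -/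
lemma map_prodMk_restrict_eq_compProd {Ω Y X : Type*} {F m0 : MeasurableSpace Ω}
    [MeasurableSpace Y] [MeasurableSpace X] {μ : Measure Ω} [IsProbabilityMeasure μ]
    (hF : F ≤ m0) {Z : Ω → Y} (hZ : Measurable[F] Z) {ξ : Ω → X}
    (hξ : Measurable ξ) (κ : Kernel Y X) [IsMarkovKernel κ]
    (hlaw : ∀ D, MeasurableSet D →
      (μ[(ξ ⁻¹' D).indicator (fun _ => (1 : ℝ)) | F]) =ᵐ[μ] fun ω => (κ (Z ω)).real D)
    {A : Set Ω} (hA : MeasurableSet[F] A) :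
    (μ.restrict A).map (fun ω => (Z ω, ξ ω)) = ((μ.restrict A).map Z) ⊗ₘ κ := by
  have hZ0 : Measurable Z := hZ.mono hF le_rfl
  have hpair : Measurable (fun ω => (Z ω, ξ ω)) := hZ0.prodMk hξ
  have hkr : ∀ D, MeasurableSet D → Measurable fun ω => (κ (Z ω)).real D := fun D hD =>
    ((κ.measurable_coe hD).comp hZ0).ennreal_toReal
  refine Measure.ext_prod fun {C D} hC hD => ?_
  -- Rectangles determine a finite measure on the product. The event `Z ∈ C` intersected with `A`
  -- lies in `F`, so the defining property of the conditional expectation can be applied to it.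
  have hAC : MeasurableSet[F] (Z ⁻¹' C ∩ A) := (hZ hC).inter hA
  have hAC0 : MeasurableSet (Z ⁻¹' C ∩ A) := hF _ hAC
  rw [Measure.map_apply hpair (hC.prod hD), Measure.compProd_apply_prod hC hD,
    Measure.restrict_map hZ0 hC, lintegral_map (κ.measurable_coe hD) hZ0,
    Measure.restrict_restrict (hZ0 hC),
    Measure.restrict_apply (hpair (hC.prod hD))]
  have hset : (fun ω => (Z ω, ξ ω)) ⁻¹' C ×ˢ D ∩ A = ξ ⁻¹' D ∩ (Z ⁻¹' C ∩ A) := by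
    ext ω; simp only [Set.mem_inter_iff, Set.mem_preimage, Set.mem_prod]; tauto
  rw [hset]
  have hint : Integrable ((ξ ⁻¹' D).indicator (fun _ => (1 : ℝ))) μ :=
    (integrable_const 1).indicator (hξ hD)
  have h1 := setIntegral_condExp hF hint hAC
  rw [setIntegral_congr_ae hAC0 ((hlaw D hD).mono fun ω h _ => h), integral_indicator (hξ hD),
    Measure.restrict_restrict (hξ hD), setIntegral_const] at h1
  simp only [smul_eq_mul, mul_one] at h1
  have h2 : ∫⁻ ω in Z ⁻¹' C ∩ A, κ (Z ω) D ∂μ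
      = ENNReal.ofReal (∫ ω in Z ⁻¹' C ∩ A, (κ (Z ω)).real D ∂μ) := by
    rw [ofReal_integral_eq_lintegral_ofReal]
    · refine lintegral_congr fun ω => ?_
      rw [ofReal_measureReal]
    · refine Integrable.of_bound (C := 1) (hkr D hD).aestronglyMeasurable ?_
      refine Eventually.of_forall fun ω => ?_
      rw [Real.norm_of_nonneg measureReal_nonneg]
      exact measureReal_le_one
    · exact Eventually.of_forall fun ω => measureReal_nonneg
  rw [h2, h1, ofReal_measureReal]

/-- Conditional expectations of functions of an `F`-measurable variable and a variable with a
regular conditional law. -/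
lemma condExp_eq_integral_kernel {Ω Y X : Type*} {F m0 : MeasurableSpace Ω}
    [MeasurableSpace Y] [MeasurableSpace X] {μ : Measure Ω} [IsProbabilityMeasure μ]
    (hF : F ≤ m0) {Z : Ω → Y} (hZ : Measurable[F] Z) {ξ : Ω → X}
    (hξ : Measurable ξ) (κ : Kernel Y X) [IsMarkovKernel κ]
    (hlaw : ∀ D, MeasurableSet D →
      (μ[(ξ ⁻¹' D).indicator (fun _ => (1 : ℝ)) | F]) =ᵐ[μ] fun ω => (κ (Z ω)).real D)
    {h : Y × X → ℝ} (hh : Measurable h) (hint : Integrable (fun ω => h (Z ω, ξ ω)) μ) :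
    μ[fun ω => h (Z ω, ξ ω) | F] =ᵐ[μ] fun ω => ∫ x, h (Z ω, x) ∂κ (Z ω) := by
  have hZ0 : Measurable Z := hZ.mono hF le_rfl
  have hpair : Measurable (fun ω => (Z ω, ξ ω)) := hZ0.prodMk hξ
  have hlawA := fun {A : Set Ω} (hA : MeasurableSet[F] A) =>
    map_prodMk_restrict_eq_compProd hF hZ hξ κ hlaw hA
  have hsm : StronglyMeasurable fun y => ∫ x, h (y, x) ∂κ y :=
    StronglyMeasurable.integral_kernel_prod_right' (κ := κ) hh.stronglyMeasurable
  have hintA : ∀ {A : Set Ω}, MeasurableSet[F] A →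
      Integrable h (((μ.restrict A).map Z) ⊗ₘ κ) := by
    intro A hA
    rw [← hlawA hA, integrable_map_measure hh.aestronglyMeasurable hpair.aemeasurable]
    exact hint.integrableOn
  have hi2 : ∀ {A : Set Ω}, MeasurableSet[F] A →
      Integrable (fun ω => ∫ x, h (Z ω, x) ∂κ (Z ω)) (μ.restrict A) := by
    intro A hA
    have : Integrable (fun y => ∫ x, h (y, x) ∂κ y) ((μ.restrict A).map Z) := by
      simpa using Integrable.integral_compProd (hintA hA)
    rwa [integrable_map_measure hsm.aestronglyMeasurable hZ0.aemeasurable] at this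
  refine (ae_eq_condExp_of_forall_setIntegral_eq hF hint (fun s hs _ => hi2 hs) ?_ ?_).symm
  · intro A hA _
    have h1 := Measure.integral_compProd (hintA hA)
    rw [← hlawA hA, integral_map hpair.aemeasurable hh.aestronglyMeasurable,
      integral_map hZ0.aemeasurable hsm.aestronglyMeasurable] at h1
    exact h1.symm
  · have : StronglyMeasurable[F] fun ω => ∫ x, h (Z ω, x) ∂κ (Z ω) := hsm.comp_measurable hZ
    exact this.aestronglyMeasurable

/-- Laws of trajectories depend measurably on a parameter if the initial law and the transitions
do. -/
lemma measurable_trajMeasure {T E : Type*} [MeasurableSpace T] [MeasurableSpace E]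
    (μ₀ : T → Measure E) [∀ t, IsProbabilityMeasure (μ₀ t)] (hμ₀ : Measurable μ₀)
    (K : T → ∀ n : ℕ, Kernel ((j : Finset.Iic n) → (fun _ : ℕ => E) j) E)
    [∀ t n, IsMarkovKernel (K t n)]
    (hK : ∀ n, Measurable fun p : T × ((j : Finset.Iic n) → (fun _ : ℕ => E) j) =>
      K p.1 n p.2) :
    Measurable fun t => Kernel.trajMeasure (X := fun _ : ℕ => E) (μ₀ t) (K t) := by
  set η := fun t => Kernel.trajMeasure (X := fun _ : ℕ => E) (μ₀ t) (K t) with hη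
  have hprob : ∀ t, IsProbabilityMeasure (η t) := fun t => by rw [hη]; infer_instance
  -- The marginals on initial segments are treated by induction on their length; cylinder sets then
  -- extend the conclusion to the whole trajectory space.
  have hfin : ∀ n, Measurable fun t => (η t).map (Preorder.frestrictLe (π := fun _ : ℕ => E) n) := by
    intro n
    induction n with
    | zero =>
      have : ∀ t, (η t).map (Preorder.frestrictLe (π := fun _ : ℕ => E) 0) =
          (μ₀ t).map (MeasurableEquiv.piUnique (fun _ : Finset.Iic 0 => E)).symm := by
        intro t
        rw [hη]
        simp only [Kernel.trajMeasure]
        rw [Measure.map_comp _ _ (by fun_prop), Kernel.traj_map_frestrictLe,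
          Kernel.partialTraj_self, Measure.id_comp]
      simp_rw [this]
      exact (Measure.measurable_map _ (by fun_prop)).comp hμ₀
    | succ n ih =>
      set glue : ((j : Finset.Iic n) → (fun _ : ℕ => E) j) × E →
          ((j : Finset.Iic (n + 1)) → (fun _ : ℕ => E) j) :=
        fun p j => if hj : j.1 ≤ n then p.1 ⟨j.1, Finset.mem_Iic.2 hj⟩ else p.2 with hglue
      have hgm : Measurable glue := by
        refine measurable_pi_lambda _ fun j => ?_
        by_cases hj : j.1 ≤ n
        · simp only [hglue, hj, dif_pos]
          exact (measurable_pi_apply _).comp measurable_fst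
        · simp only [hglue, hj, dif_neg, not_false_eq_true]
          exact measurable_snd
      have hrec : ∀ t, (η t).map (Preorder.frestrictLe (π := fun _ : ℕ => E) (n + 1)) =
          (((η t).map (Preorder.frestrictLe (π := fun _ : ℕ => E) n)) ⊗ₘ K t n).map glue := by
        intro t
        rw [hη]
        rw [Kernel.map_frestrictLe_trajMeasure_compProd_eq_map_trajMeasure (a := n),
          Measure.map_map hgm (by fun_prop)]
        congr 1
        ext x j
        by_cases hj : j.1 ≤ n
        · simp [hglue, hj]
        · have : j.1 = n + 1 := le_antisymm (Finset.mem_Iic.1 j.2) (by omega)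
          simp [hglue, this]
      have hP : ∀ t, IsProbabilityMeasure
          ((η t).map (Preorder.frestrictLe (π := fun _ : ℕ => E) n)) := fun t =>
        Measure.isProbabilityMeasure_map (by fun_prop)
      -- Both factors of the composition-product depend on `t`. Moving `t` into the source of the
      -- kernels turns the family into a single kernel on `T`, which is measurable in `t` by
      -- construction.
      let κ₁ : Kernel T ((j : Finset.Iic n) → (fun _ : ℕ => E) j) := ⟨_, ih⟩
      have : IsMarkovKernel κ₁ := ⟨hP⟩
      let κ₂ : Kernel (T × ((j : Finset.Iic n) → (fun _ : ℕ => E) j)) E := ⟨_, hK n⟩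
      have : IsMarkovKernel κ₂ := ⟨fun p => inferInstanceAs (IsProbabilityMeasure (K p.1 n p.2))⟩
      have hprod : ∀ t, ((η t).map (Preorder.frestrictLe (π := fun _ : ℕ => E) n)) ⊗ₘ K t n
          = (κ₁ ⊗ₖ κ₂) t := by
        intro t
        ext s hs
        rw [Measure.compProd_apply hs, Kernel.compProd_apply hs]
        rfl
      simp_rw [hrec, hprod]
      exact (Measure.measurable_map _ hgm).comp (κ₁ ⊗ₖ κ₂).measurable
  refine Measure.measurable_of_measurable_coe _ fun s hs => ?_
  refine MeasurableSpace.induction_on_inter (C := fun s _ => Measurable fun t => η t s)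
    (generateFrom_measurableCylinders (α := fun _ : ℕ => E)).symm
    isPiSystem_measurableCylinders (by simp) ?_ ?_ ?_ s hs
  · intro s hs
    obtain ⟨I, S, hS, rfl⟩ := (mem_measurableCylinders _).1 hs
    obtain ⟨n, hn⟩ : ∃ n, I ⊆ Finset.Iic n := ⟨I.sup id, fun i hi =>
      Finset.mem_Iic.2 (Finset.le_sup (f := id) hi)⟩
    have hS' : MeasurableSet ((Finset.restrict₂ (π := fun _ : ℕ => E) hn ⁻¹' S :
        Set ((j : Finset.Iic n) → (fun _ : ℕ => E) j))) := Finset.measurable_restrict₂ hn hS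
    have : ∀ t, η t (cylinder I S) = (η t).map (Preorder.frestrictLe (π := fun _ : ℕ => E) n)
        (Finset.restrict₂ (π := fun _ : ℕ => E) hn ⁻¹' S) := by
      intro t
      exact (Measure.map_apply (μ := η t) (Preorder.measurable_frestrictLe n) hS').symm
    simp_rw [this]
    exact (Measure.measurable_coe hS').comp (hfin n)
  · intro s hs h
    simp_rw [prob_compl_eq_one_sub hs]
    exact h.const_sub 1
  · intro f hd hf h
    simp_rw [measure_iUnion hd hf]
    exact Measurable.tsum h

/-! ### Block gradients -/

section Blocks

variable {N : ℕ} {M : Fin N → ℕ}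

/-- The parameter vector with block `i` equal to `x` and all the other blocks equal to zero. -/
def Params.single (i : Fin N) (x : EuclideanSpace ℝ (Fin (M i))) : Params M :=
  WithLp.toLp 2 (Pi.single i x)

@[simp]
lemma Params.norm_single (i : Fin N) (x : EuclideanSpace ℝ (Fin (M i))) :
    ‖Params.single (M := M) i x‖ = ‖x‖ :=
  PiLp.norm_single 2 (fun i : Fin N => EuclideanSpace ℝ (Fin (M i))) i x

lemma Params.single_apply_self (i : Fin N) (x : EuclideanSpace ℝ (Fin (M i))) :
    Params.single (M := M) i x i = x := by
  simp [Params.single]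

lemma Params.single_apply_of_ne {i j : Fin N} (h : j ≠ i) (x : EuclideanSpace ℝ (Fin (M i))) :
    Params.single (M := M) i x j = 0 := by
  simp [Params.single, h]

lemma Params.sum_single (v : Params M) : ∑ i, Params.single i (v i) = v := by
  ext j : 1
  rw [WithLp.ofLp_sum, Finset.sum_apply, Finset.sum_eq_single j]
  · exact Params.single_apply_self j _
  · intro i _ hij
    exact Params.single_apply_of_ne hij.symm _
  · simp

lemma Params.update_eq_add_single (θ : Params M) (i : Fin N) (x : EuclideanSpace ℝ (Fin (M i))) :
    θ.update i x = θ + Params.single i (x - θ i) := by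
  ext j : 1
  by_cases h : j = i
  · subst h
    simp [Params.update, Params.single]
  · simp [Params.update, Params.single, h]

lemma Params.inner_eq_sum (v w : Params M) : inner ℝ v w = ∑ i, inner ℝ (v i) (w i) :=
  PiLp.inner_apply v w

lemma Params.inner_single (v : Params M) (i : Fin N) (x : EuclideanSpace ℝ (Fin (M i))) :
    inner ℝ v (Params.single i x) = inner ℝ (v i) x := by
  rw [Params.inner_eq_sum, Finset.sum_eq_single i]
  · rw [Params.single_apply_self]
  · intro j _ hj
    rw [Params.single_apply_of_ne hj, inner_zero_right]
  · simp

lemma Params.norm_apply_le (v : Params M) (i : Fin N) : ‖v i‖ ≤ ‖v‖ :=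
  PiLp.norm_apply_le v i

lemma Params.norm_le_sum (v : Params M) : ‖v‖ ≤ ∑ i, ‖v i‖ := by
  calc ‖v‖ = ‖∑ i, Params.single i (v i)‖ := by rw [Params.sum_single]
    _ ≤ ∑ i, ‖Params.single i (v i)‖ := norm_sum_le _ _
    _ = ∑ i, ‖v i‖ := by simp

/-- `Params.single` as a linear map. -/
def Params.singleL (i : Fin N) : EuclideanSpace ℝ (Fin (M i)) →ₗ[ℝ] Params M where
  toFun := Params.single i
  map_add' x y := by
    ext j : 1
    simp [Params.single, Pi.single_add]
  map_smul' c x := by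
    ext j : 1
    simp [Params.single, Pi.single_smul]

lemma Params.hasFDerivAt_update (θ : Params M) (i : Fin N) (x : EuclideanSpace ℝ (Fin (M i))) :
    HasFDerivAt (fun x => θ.update i x) (LinearMap.toContinuousLinearMap (Params.singleL i)) x := by
  have h : (fun x => θ.update i x) =
      fun x => θ + LinearMap.toContinuousLinearMap (Params.singleL i) (x - θ i) := by
    funext x
    exact θ.update_eq_add_single i x
  rw [h]
  exact (((LinearMap.toContinuousLinearMap (Params.singleL i)).hasFDerivAt).comp x
    ((hasFDerivAt_id x).sub_const (θ i))).const_add θ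

@[simp]
lemma Params.update_self (θ : Params M) (i : Fin N) : θ.update i (θ i) = θ := by
  ext j : 1
  simp [Params.update]

/-- The block gradient of a function with a known derivative. -/
lemma inner_blockGrad {f : Params M → ℝ} {θ : Params M} {f' : Params M →L[ℝ] ℝ}
    (hf : HasFDerivAt f f' θ) (i : Fin N) (x : EuclideanSpace ℝ (Fin (M i))) :
    inner ℝ (blockGrad i f θ) x = f' (Params.single i x) := by
  have h0 : HasFDerivAt f f' (θ.update i (θ i)) := by rwa [Params.update_self]
  have h := h0.comp (θ i) (θ.hasFDerivAt_update i (θ i))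
  have h2 : fderiv ℝ (fun x => f (θ.update i x)) (θ i)
      = f'.comp (LinearMap.toContinuousLinearMap (Params.singleL i)) := h.fderiv
  rw [blockGrad, gradient, h2, InnerProductSpace.toDual_symm_apply]
  rfl

lemma inner_fullGrad {f : Params M → ℝ} {θ : Params M} {f' : Params M →L[ℝ] ℝ}
    (hf : HasFDerivAt f f' θ) (v : Params M) : inner ℝ (fullGrad f θ) v = f' v := by
  rw [Params.inner_eq_sum]
  have : ∀ i, inner ℝ ((fullGrad f θ) i) (v i) = f' (Params.single i (v i)) := fun i =>
    inner_blockGrad hf i (v i)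
  simp_rw [this, ← map_sum, Params.sum_single]

lemma hasGradientAt_fullGrad {f : Params M → ℝ} {θ : Params M} (hf : DifferentiableAt ℝ f θ) :
    HasFDerivAt f (innerSL ℝ (fullGrad f θ)) θ := by
  have h : innerSL ℝ (fullGrad f θ) = fderiv ℝ f θ :=
    ContinuousLinearMap.ext fun v => inner_fullGrad hf.hasFDerivAt v
  rw [h]
  exact hf.hasFDerivAt

end Blocks

/-! ### Score functions -/

section Scores

variable {N : ℕ} {M : Fin N → ℕ} {S A : Type*} [MeasurableSpace S] [MeasurableSpace A]
  {ν : Measure A}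

/-- The score `∇ log π_{n,θ}(a_n | s)` with respect to all the parameters. -/
def PolicyFamily.fullScore (π : PolicyFamily M S A ν) (n : Fin N) (θ : Params M) (s : S) (a : A) :
    Params M :=
  fullGrad (fun ϑ => Real.log (π.dens n ϑ s a)) θ

lemma PolicyFamily.fullScore_apply (π : PolicyFamily M S A ν) (n i : Fin N) (θ : Params M) (s : S)
    (a : A) : π.fullScore n θ s a i = π.score i n θ s a := rfl

lemma PolicyFamily.hasFDerivAt_log_dens (π : PolicyFamily M S A ν) (n : Fin N) (θ : Params M)
    (s : S) (a : A) :
    HasFDerivAt (fun ϑ => Real.log (π.dens n ϑ s a)) (innerSL ℝ (π.fullScore n θ s a)) θ :=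
  hasGradientAt_fullGrad ((π.differentiable_dens n s a θ).log (π.dens_pos n θ s a).ne')

/-- Log-derivative trick: a positive density is the exponential of its logarithm. -/
lemma PolicyFamily.hasFDerivAt_dens (π : PolicyFamily M S A ν) (n : Fin N) (θ : Params M)
    (s : S) (a : A) :
    HasFDerivAt (fun ϑ => π.dens n ϑ s a) (π.dens n θ s a • innerSL ℝ (π.fullScore n θ s a)) θ := by
  have h := (π.hasFDerivAt_log_dens n θ s a).exp
  simpa only [Real.exp_log (π.dens_pos n _ s a)] using h

lemma PolicyFamily.hasDerivAt_dens_line (π : PolicyFamily M S A ν) (n : Fin N) (θ δ : Params M)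
    (s : S) (a : A) (t : ℝ) :
    HasDerivAt (fun t : ℝ => π.dens n (θ + t • δ) s a)
      (π.dens n (θ + t • δ) s a * inner ℝ (π.fullScore n (θ + t • δ) s a) δ) t := by
  have h1 : HasDerivAt (fun t : ℝ => θ + t • δ) δ t := by
    simpa using ((hasDerivAt_id t).smul_const δ).const_add θ
  have h2 := (π.hasFDerivAt_dens n (θ + t • δ) s a).comp_hasDerivAt t h1
  refine HasDerivAt.congr_deriv h2 ?_
  simp

/-- The directional score is the limit of difference quotients of the density along `θ + v / (k +
1)`, divided by the density. Each quotient is measurable in the state and the action. -/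
lemma PolicyFamily.measurable_inner_fullScore (π : PolicyFamily M S A ν) (n : Fin N)
    (θ v : Params M) :
    Measurable (fun x : S × A => inner ℝ (π.fullScore n θ x.1 x.2) v) := by
  have hlim : ∀ x : S × A, Tendsto (fun k : ℕ => ((k : ℝ) + 1) *
      (π.dens n (θ + (((k : ℝ) + 1)⁻¹) • v) x.1 x.2 - π.dens n θ x.1 x.2) / π.dens n θ x.1 x.2)
      atTop (𝓝 (inner ℝ (π.fullScore n θ x.1 x.2) v)) := by
    intro x
    have h := (π.hasDerivAt_dens_line n θ v x.1 x.2 0).tendsto_slope_zero_right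
    have hk : Tendsto (fun k : ℕ => ((k : ℝ) + 1)⁻¹) atTop (𝓝[>] 0) := by
      refine tendsto_nhdsWithin_iff.2 ⟨?_, Eventually.of_forall fun k => ?_⟩
      · simpa using tendsto_one_div_add_atTop_nhds_zero_nat (𝕜 := ℝ)
      · exact Set.mem_Ioi.2 (by positivity)
    have h2 := (h.comp hk).div_const (π.dens n θ x.1 x.2)
    have hpos := (π.dens_pos n θ x.1 x.2).ne'
    simp only [zero_smul, add_zero, zero_add, smul_eq_mul] at h2
    rw [mul_div_cancel_left₀ _ hpos] at h2
    refine h2.congr fun k => ?_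
    simp
  refine measurable_of_tendsto_metrizable (fun k => ?_) (tendsto_pi_nhds.2 hlim)
  exact (((π.measurable_dens n _).sub (π.measurable_dens n θ)).const_mul _).div
    (π.measurable_dens n θ)

lemma PolicyFamily.measurable_score (π : PolicyFamily M S A ν) (i n : Fin N) (θ : Params M) :
    Measurable (fun x : S × A => π.score i n θ x.1 x.2) := by
  have h : ∀ m : Fin (M i), Measurable (fun x : S × A => π.score i n θ x.1 x.2 m) := by
    intro m
    have := π.measurable_inner_fullScore n θ (Params.single i (EuclideanSpace.single m 1))
    simpa only [Params.inner_single, π.fullScore_apply, EuclideanSpace.inner_single_right,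
      one_mul, conj_trivial] using this
  have h2 : Measurable (fun x : S × A => WithLp.ofLp (π.score i n θ x.1 x.2)) :=
    measurable_pi_lambda _ h
  exact (WithLp.measurable_toLp 2 (Fin (M i) → ℝ)).comp h2

lemma PolicyFamily.measurable_fullScore (π : PolicyFamily M S A ν) (n : Fin N) (θ : Params M) :
    Measurable (fun x : S × A => π.fullScore n θ x.1 x.2) := by
  have h2 : Measurable (fun x : S × A => WithLp.ofLp (π.fullScore n θ x.1 x.2)) :=
    measurable_pi_lambda _ fun i => π.measurable_score i n θ
  exact (WithLp.measurable_toLp 2 _).comp h2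

variable {π : PolicyFamily M S A ν} {B V Λ : ℝ}

lemma ScoreBounds.norm_fullScore_sub_le (h : ScoreBounds π B V Λ) (n : Fin N)
    (θ₁ θ₂ : Params M) (s : S) (a : A) :
    ‖π.fullScore n θ₁ s a - π.fullScore n θ₂ s a‖ ≤ N * Λ * ‖θ₁ - θ₂‖ := by
  calc ‖π.fullScore n θ₁ s a - π.fullScore n θ₂ s a‖
      ≤ ∑ i, ‖(π.fullScore n θ₁ s a - π.fullScore n θ₂ s a) i‖ := Params.norm_le_sum _
    _ ≤ ∑ _i : Fin N, Λ * ‖θ₁ - θ₂‖ := Finset.sum_le_sum fun i _ => h.lipschitz i n θ₁ θ₂ s a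
    _ = N * Λ * ‖θ₁ - θ₂‖ := by simp [mul_assoc]

lemma ScoreBounds.lintegral_fullScore_le (h : ScoreBounds π B V Λ) (n : Fin N) (θ : Params M)
    (s : S) :
    ∫⁻ a, ‖π.fullScore n θ s a‖ₑ * ENNReal.ofReal (π.dens n θ s a) ∂ν ≤ N * ENNReal.ofReal B := by
  have hm : ∀ i, Measurable fun a => ‖π.score i n θ s a‖ₑ * ENNReal.ofReal (π.dens n θ s a) :=
    fun i => (((π.measurable_score i n θ).comp measurable_prodMk_left).enorm).mul
      ((π.measurable_dens n θ).comp measurable_prodMk_left).ennreal_ofReal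
  calc ∫⁻ a, ‖π.fullScore n θ s a‖ₑ * ENNReal.ofReal (π.dens n θ s a) ∂ν
      ≤ ∫⁻ a, ∑ i, ‖π.score i n θ s a‖ₑ * ENNReal.ofReal (π.dens n θ s a) ∂ν := by
        refine lintegral_mono fun a => ?_
        rw [← Finset.sum_mul]
        gcongr
        simp_rw [← ofReal_norm]
        rw [← ENNReal.ofReal_sum_of_nonneg fun _ _ => norm_nonneg _]
        exact ENNReal.ofReal_le_ofReal (Params.norm_le_sum _)
    _ = ∑ i, ∫⁻ a, ‖π.score i n θ s a‖ₑ * ENNReal.ofReal (π.dens n θ s a) ∂ν :=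
        lintegral_finsetSum _ fun i _ => hm i
    _ ≤ ∑ _i : Fin N, ENNReal.ofReal B := Finset.sum_le_sum fun i _ => h.first_moment i n θ s
    _ = N * ENNReal.ofReal B := by simp

lemma ScoreBounds.lintegral_fullScore_sq_le (h : ScoreBounds π B V Λ) (n : Fin N) (θ : Params M)
    (s : S) :
    ∫⁻ a, ‖π.fullScore n θ s a‖ₑ ^ 2 * ENNReal.ofReal (π.dens n θ s a) ∂ν
      ≤ N * ENNReal.ofReal (V ^ 2) := by
  have hm : ∀ i, Measurable fun a => ‖π.score i n θ s a‖ₑ ^ 2 * ENNReal.ofReal (π.dens n θ s a) :=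
    fun i => ((((π.measurable_score i n θ).comp measurable_prodMk_left).enorm).pow_const 2).mul
      ((π.measurable_dens n θ).comp measurable_prodMk_left).ennreal_ofReal
  calc ∫⁻ a, ‖π.fullScore n θ s a‖ₑ ^ 2 * ENNReal.ofReal (π.dens n θ s a) ∂ν
      ≤ ∫⁻ a, ∑ i, ‖π.score i n θ s a‖ₑ ^ 2 * ENNReal.ofReal (π.dens n θ s a) ∂ν := by
        refine lintegral_mono fun a => ?_
        rw [← Finset.sum_mul]
        gcongr
        simp_rw [← ofReal_norm, ← ENNReal.ofReal_pow (norm_nonneg _)]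
        rw [← ENNReal.ofReal_sum_of_nonneg fun _ _ => by positivity]
        refine ENNReal.ofReal_le_ofReal (le_of_eq ?_)
        rw [PiLp.norm_sq_eq_of_L2]
        rfl
    _ = ∑ i, ∫⁻ a, ‖π.score i n θ s a‖ₑ ^ 2 * ENNReal.ofReal (π.dens n θ s a) ∂ν :=
        lintegral_finsetSum _ fun i _ => hm i
    _ ≤ ∑ _i : Fin N, ENNReal.ofReal (V ^ 2) :=
        Finset.sum_le_sum fun i _ => h.second_moment i n θ s
    _ = N * ENNReal.ofReal (V ^ 2) := by simp

attribute [irreducible] PolicyFamily.fullScore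

end Scores

/-- Two moments of `G` control every function of at most quadratic growth in `G`; `f` need not be
measurable. With `G` the sum of the score norms, this is the source of the moment bounds below. -/
lemma lintegral_le_of_abs_le_quadratic {X : Type*} [MeasurableSpace X] {m : Measure X}
    [IsProbabilityMeasure m] {f G : X → ℝ} (hGm : Measurable G) (hG : ∀ x, 0 ≤ G x)
    {C₁ C₂ c₀ c₁ c₂ : ℝ} (hG₁ : ∫⁻ x, ENNReal.ofReal (G x) ∂m ≤ ENNReal.ofReal C₁)
    (hG₂ : ∫⁻ x, ENNReal.ofReal (G x ^ 2) ∂m ≤ ENNReal.ofReal C₂) (hC₁ : 0 ≤ C₁) (hC₂ : 0 ≤ C₂)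
    (h₀ : 0 ≤ c₀) (h₁ : 0 ≤ c₁) (h₂ : 0 ≤ c₂)
    (hf : ∀ x, |f x| ≤ c₀ + c₁ * G x + c₂ * G x ^ 2) :
    ∫⁻ x, ‖f x‖ₑ ∂m ≤ ENNReal.ofReal (c₀ + c₁ * C₁ + c₂ * C₂) := by
  have hm1 : Measurable fun x => ENNReal.ofReal c₁ * ENNReal.ofReal (G x) :=
    hGm.ennreal_ofReal.const_mul _
  have hm2 : Measurable fun x => ENNReal.ofReal c₂ * ENNReal.ofReal (G x ^ 2) :=
    (hGm.pow_const 2).ennreal_ofReal.const_mul _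
  calc ∫⁻ x, ‖f x‖ₑ ∂m
      ≤ ∫⁻ x, (ENNReal.ofReal c₀ + ENNReal.ofReal c₁ * ENNReal.ofReal (G x)
          + ENNReal.ofReal c₂ * ENNReal.ofReal (G x ^ 2)) ∂m := by
        refine lintegral_mono fun x => ?_
        have hGx := hG x
        rw [← ENNReal.ofReal_mul h₁, ← ENNReal.ofReal_mul h₂,
          ← ENNReal.ofReal_add h₀ (mul_nonneg h₁ hGx),
          ← ENNReal.ofReal_add (add_nonneg h₀ (mul_nonneg h₁ hGx)) (mul_nonneg h₂ (sq_nonneg _)),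
          Real.enorm_eq_ofReal_abs]
        exact ENNReal.ofReal_le_ofReal (hf x)
    _ = ENNReal.ofReal c₀ + ENNReal.ofReal c₁ * ∫⁻ x, ENNReal.ofReal (G x) ∂m
          + ENNReal.ofReal c₂ * ∫⁻ x, ENNReal.ofReal (G x ^ 2) ∂m := by
        rw [lintegral_add_right _ hm2, lintegral_add_right _ hm1,
          lintegral_const_mul _ hGm.ennreal_ofReal,
          lintegral_const_mul _ (hGm.pow_const 2).ennreal_ofReal]
        simp
    _ ≤ ENNReal.ofReal c₀ + ENNReal.ofReal c₁ * ENNReal.ofReal C₁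
          + ENNReal.ofReal c₂ * ENNReal.ofReal C₂ := by gcongr
    _ = ENNReal.ofReal (c₀ + c₁ * C₁ + c₂ * C₂) := by
        rw [← ENNReal.ofReal_mul h₁, ← ENNReal.ofReal_mul h₂,
          ← ENNReal.ofReal_add h₀ (mul_nonneg h₁ hC₁),
          ← ENNReal.ofReal_add (add_nonneg h₀ (mul_nonneg h₁ hC₁)) (mul_nonneg h₂ hC₂)]

/-! ### The joint action density and the moments of its scores -/

section JointPolicy

variable {N : ℕ} {M : Fin N → ℕ} {S A : Type*} [MeasurableSpace S] [MeasurableSpace A]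
  {ν : Measure A}

/-- The real-valued density of the joint action. -/
def PolicyFamily.jointReal (π : PolicyFamily M S A ν) (b : Fin N → Params M) (s : S)
    (a : Fin N → A) : ℝ :=
  ∏ n, π.dens n (b n) s (a n)

lemma PolicyFamily.jointReal_pos (π : PolicyFamily M S A ν) (b : Fin N → Params M) (s : S)
    (a : Fin N → A) : 0 < π.jointReal b s a :=
  Finset.prod_pos fun n _ => π.dens_pos n (b n) s (a n)

lemma PolicyFamily.measurable_jointReal (π : PolicyFamily M S A ν) (b : Fin N → Params M) :
    Measurable fun x : S × (Fin N → A) => π.jointReal b x.1 x.2 :=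
  Finset.measurable_prod _ fun n _ => (π.measurable_dens n (b n)).comp
    (measurable_fst.prodMk ((measurable_pi_apply n).comp measurable_snd))

lemma PolicyFamily.measurable_jointReal_right (π : PolicyFamily M S A ν) (b : Fin N → Params M)
    (s : S) : Measurable fun a : Fin N → A => π.jointReal b s a :=
  (π.measurable_jointReal b).comp measurable_prodMk_left

lemma PolicyFamily.measurable_dens_right (π : PolicyFamily M S A ν) (n : Fin N) (θ : Params M)
    (s : S) : Measurable fun a : A => π.dens n θ s a :=
  (π.measurable_dens n θ).comp measurable_prodMk_left

/-- The sum of the norms of the individual scores. -/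
def PolicyFamily.scoreSum (π : PolicyFamily M S A ν) (b : Fin N → Params M) (s : S)
    (a : Fin N → A) : ℝ :=
  ∑ n, ‖π.fullScore n (b n) s (a n)‖

lemma PolicyFamily.scoreSum_nonneg (π : PolicyFamily M S A ν) (b : Fin N → Params M) (s : S)
    (a : Fin N → A) : 0 ≤ π.scoreSum b s a :=
  Finset.sum_nonneg fun _ _ => norm_nonneg _

lemma measurable_fst_eval (n : Fin N) :
    Measurable fun x : S × (Fin N → A) => (x.1, x.2 n) :=
  measurable_fst.prodMk ((measurable_pi_apply n).comp measurable_snd)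

lemma PolicyFamily.measurable_scoreSum (π : PolicyFamily M S A ν) (b : Fin N → Params M) :
    Measurable fun x : S × (Fin N → A) => π.scoreSum b x.1 x.2 := by
  unfold PolicyFamily.scoreSum
  refine Finset.measurable_sum _ fun n _ => ?_
  have h : Measurable fun x : S × A => ‖π.fullScore n (b n) x.1 x.2‖ :=
    (π.measurable_fullScore n (b n)).norm
  have h2 := h.comp (measurable_fst_eval (S := S) (A := A) n)
  exact h2

lemma PolicyFamily.measurable_scoreSum_right (π : PolicyFamily M S A ν) (b : Fin N → Params M)
    (s : S) : Measurable fun a : Fin N → A => π.scoreSum b s a := by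
  have h := (π.measurable_scoreSum b).comp (measurable_prodMk_left (x := s))
  exact h

/-- The derivative of the logarithm of the joint density at `b` in the direction `δ`. -/
def PolicyFamily.dirScore (π : PolicyFamily M S A ν) (b δ : Fin N → Params M) (s : S)
    (a : Fin N → A) : ℝ :=
  ∑ n, inner ℝ (π.fullScore n (b n) s (a n)) (δ n)

lemma PolicyFamily.measurable_dirScore (π : PolicyFamily M S A ν) (b δ : Fin N → Params M) :
    Measurable fun x : S × (Fin N → A) => π.dirScore b δ x.1 x.2 := by
  unfold PolicyFamily.dirScore
  refine Finset.measurable_sum _ fun n _ => ?_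
  have h := π.measurable_inner_fullScore n (b n) (δ n)
  have h2 := h.comp (measurable_fst_eval (S := S) (A := A) n)
  exact h2

lemma PolicyFamily.measurable_dirScore_right (π : PolicyFamily M S A ν) (b δ : Fin N → Params M)
    (s : S) : Measurable fun a : Fin N → A => π.dirScore b δ s a := by
  have h := (π.measurable_dirScore b δ).comp (measurable_prodMk_left (x := s))
  exact h

lemma PolicyFamily.abs_dirScore_le (π : PolicyFamily M S A ν) (b δ : Fin N → Params M) (s : S)
    (a : Fin N → A) {c : ℝ} (hc : ∀ n, ‖δ n‖ ≤ c) :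
    |π.dirScore b δ s a| ≤ c * π.scoreSum b s a := by
  rw [PolicyFamily.dirScore, PolicyFamily.scoreSum, Finset.mul_sum]
  refine (Finset.abs_sum_le_sum_abs _ _).trans (Finset.sum_le_sum fun n _ => ?_)
  refine (abs_real_inner_le_norm _ _).trans ?_
  rw [mul_comm]
  gcongr
  exact hc n

lemma PolicyFamily.dirScore_add (π : PolicyFamily M S A ν) (b δ δ' : Fin N → Params M) (s : S)
    (a : Fin N → A) :
    π.dirScore b (δ + δ') s a = π.dirScore b δ s a + π.dirScore b δ' s a := by
  simp only [PolicyFamily.dirScore, Pi.add_apply, inner_add_right, Finset.sum_add_distrib]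

lemma PolicyFamily.dirScore_smul (π : PolicyFamily M S A ν) (b δ : Fin N → Params M) (c : ℝ)
    (s : S) (a : Fin N → A) : π.dirScore b (c • δ) s a = c * π.dirScore b δ s a := by
  simp only [PolicyFamily.dirScore, Pi.smul_apply, inner_smul_right, Finset.mul_sum]

/-- Product rule: differentiating the factor of agent `n` reproduces the whole product times the
score of that agent. Every agent may move from its own parameter `b n` in its own direction `δ n`.
-/
lemma PolicyFamily.hasDerivAt_jointReal_line (π : PolicyFamily M S A ν)
    (b δ : Fin N → Params M) (s : S) (a : Fin N → A) (t : ℝ) :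
    HasDerivAt (fun t : ℝ => π.jointReal (b + t • δ) s a)
      (π.jointReal (b + t • δ) s a * π.dirScore (b + t • δ) δ s a) t := by
  have h := HasDerivAt.fun_finsetProd (u := Finset.univ) (x := t)
    (f := fun (n : Fin N) (t : ℝ) => π.dens n (b n + t • δ n) s (a n))
    (f' := fun n => π.dens n (b n + t • δ n) s (a n) *
      inner ℝ (π.fullScore n (b n + t • δ n) s (a n)) (δ n))
    (fun n _ => π.hasDerivAt_dens_line n (b n) (δ n) s (a n) t)
  refine h.congr_deriv ?_
  rw [PolicyFamily.dirScore, Finset.mul_sum]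
  refine Finset.sum_congr rfl fun n _ => ?_
  rw [smul_eq_mul, ← mul_assoc, Finset.prod_erase_mul _ _ (Finset.mem_univ n)]
  rfl

lemma PolicyFamily.integrable_dens (π : PolicyFamily M S A ν) (n : Fin N) (θ : Params M) (s : S) :
    Integrable (fun x => π.dens n θ s x) ν := by
  by_contra h
  have := π.integral_dens n θ s
  rw [integral_undef h] at this
  exact zero_ne_one this

/-- The law of the action of agent `n` in state `s`. -/
def PolicyFamily.actionLaw (π : PolicyFamily M S A ν) (n : Fin N) (θ : Params M) (s : S) :
    Measure A :=
  ν.withDensity fun x => ENNReal.ofReal (π.dens n θ s x)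

instance PolicyFamily.isProbabilityMeasure_actionLaw (π : PolicyFamily M S A ν) (n : Fin N)
    (θ : Params M) (s : S) : IsProbabilityMeasure (π.actionLaw n θ s) := by
  refine ⟨?_⟩
  rw [PolicyFamily.actionLaw, withDensity_apply _ MeasurableSet.univ, Measure.restrict_univ,
    ← ofReal_integral_eq_lintegral_ofReal (π.integrable_dens n θ s)
      (Eventually.of_forall fun x => (π.dens_pos n θ s x).le), π.integral_dens]
  simp

variable {π : PolicyFamily M S A ν} {B V Λ : ℝ}

/-- Lipschitz scores allow their evaluation point to be exchanged, so that moments are always taken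
under the policy that generates the actions. -/
lemma ScoreBounds.scoreSum_le_add (h : ScoreBounds π B V Λ) (b b' : Fin N → Params M)
    (s : S) (a : Fin N → A) :
    π.scoreSum b s a ≤ π.scoreSum b' s a + N * Λ * ∑ n, ‖b n - b' n‖ := by
  rw [PolicyFamily.scoreSum, PolicyFamily.scoreSum, Finset.mul_sum, ← Finset.sum_add_distrib]
  refine Finset.sum_le_sum fun n _ => ?_
  have h1 := h.norm_fullScore_sub_le n (b n) (b' n) s (a n)
  have h2 := norm_sub_norm_le (π.fullScore n (b n) s (a n)) (π.fullScore n (b' n) s (a n))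
  linarith

lemma ScoreBounds.abs_dirScore_sub_le (h : ScoreBounds π B V Λ) (b b' δ : Fin N → Params M)
    (s : S) (a : Fin N → A) {c : ℝ} (hc : ∀ n, ‖δ n‖ ≤ c) :
    |π.dirScore b δ s a - π.dirScore b' δ s a| ≤ N * Λ * (∑ n, ‖b n - b' n‖) * c := by
  rw [PolicyFamily.dirScore, PolicyFamily.dirScore, ← Finset.sum_sub_distrib, Finset.mul_sum,
    Finset.sum_mul]
  refine (Finset.abs_sum_le_sum_abs _ _).trans (Finset.sum_le_sum fun n _ => ?_)
  rw [← inner_sub_left]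
  refine (abs_real_inner_le_norm _ _).trans ?_
  have h1 := h.norm_fullScore_sub_le n (b n) (b' n) s (a n)
  exact mul_le_mul h1 (hc n) (norm_nonneg _) ((norm_nonneg _).trans h1)

variable [SigmaFinite ν]

lemma PolicyFamily.joint_apply (π : PolicyFamily M S A ν) (b : Fin N → Params M) (s : S) :
    π.joint b s = (Measure.pi fun _ : Fin N => ν).withDensity
      fun a => ENNReal.ofReal (π.jointReal b s a) := by
  rw [PolicyFamily.joint, Kernel.withDensity_apply _ (π.measurable_jointDens b)]
  rfl

/-- A product density with respect to a product measure has independent coordinates. This reduces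
moments of one score under the joint policy to the hypotheses about a single agent. -/
lemma PolicyFamily.joint_eq_pi (π : PolicyFamily M S A ν) (b : Fin N → Params M) (s : S) :
    π.joint b s = Measure.pi fun n => π.actionLaw n (b n) s := by
  refine (Measure.pi_eq fun D hD => ?_).symm
  have hint : ∀ n, Integrable (fun x => π.dens n (b n) s x) (ν.restrict (D n)) := fun n =>
    (π.integrable_dens n (b n) s).restrict
  rw [π.joint_apply, withDensity_apply _ (MeasurableSet.univ_pi hD), Measure.restrict_pi_pi]
  simp only [PolicyFamily.jointReal]
  rw [← ofReal_integral_eq_lintegral_ofReal (Integrable.fintype_prod_dep hint)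
      (Eventually.of_forall fun x => (π.jointReal_pos b s x).le)]
  rw [integral_fintype_prod_eq_prod (f := fun n x => π.dens n (b n) s x),
    ENNReal.ofReal_prod_of_nonneg fun n _ =>
      integral_nonneg fun x => (π.dens_pos n (b n) s x).le]
  refine Finset.prod_congr rfl fun n _ => ?_
  rw [PolicyFamily.actionLaw, withDensity_apply _ (hD n),
    ofReal_integral_eq_lintegral_ofReal (hint n)
      (Eventually.of_forall fun x => (π.dens_pos n (b n) s x).le)]

lemma PolicyFamily.lintegral_joint_eval (π : PolicyFamily M S A ν) (b : Fin N → Params M) (s : S)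
    (n : Fin N) {f : A → ℝ≥0∞} (hf : Measurable f) :
    ∫⁻ a, f (a n) ∂π.joint b s = ∫⁻ x, f x * ENNReal.ofReal (π.dens n (b n) s x) ∂ν := by
  rw [π.joint_eq_pi, (measurePreserving_eval (fun n => π.actionLaw n (b n) s) n).lintegral_comp hf,
    PolicyFamily.actionLaw, lintegral_withDensity_eq_lintegral_mul _
      (π.measurable_dens_right n (b n) s).ennreal_ofReal hf]
  refine lintegral_congr fun x => ?_
  simp [mul_comm]

lemma PolicyFamily.lintegral_joint (π : PolicyFamily M S A ν) (b : Fin N → Params M) (s : S)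
    (f : (Fin N → A) → ℝ≥0∞) (hf : Measurable f) :
    ∫⁻ a, f a ∂π.joint b s =
      ∫⁻ a, ENNReal.ofReal (π.jointReal b s a) * f a ∂(Measure.pi fun _ : Fin N => ν) := by
  rw [π.joint_apply, lintegral_withDensity_eq_lintegral_mul _
    (π.measurable_jointReal_right b s).ennreal_ofReal hf]
  rfl

lemma PolicyFamily.integral_joint (π : PolicyFamily M S A ν) (b : Fin N → Params M) (s : S)
    (f : (Fin N → A) → ℝ) :
    ∫ a, f a ∂π.joint b s = ∫ a, π.jointReal b s a * f a ∂(Measure.pi fun _ : Fin N => ν) := by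
  rw [π.joint_apply, integral_withDensity_eq_integral_toReal_smul
    (π.measurable_jointReal_right b s).ennreal_ofReal (by simp)]
  refine integral_congr_ae (Eventually.of_forall fun a => ?_)
  simp [ENNReal.toReal_ofReal (π.jointReal_pos b s a).le]

lemma ScoreBounds.lintegral_scoreSum_le (h : ScoreBounds π B V Λ)
    (b : Fin N → Params M) (s : S) :
    ∫⁻ a, ENNReal.ofReal (π.scoreSum b s a) ∂π.joint b s ≤ ENNReal.ofReal (N ^ 2 * B) := by
  have hm : ∀ n, Measurable fun a => ‖π.fullScore n (b n) s a‖ₑ := fun n =>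
    ((π.measurable_fullScore n (b n)).comp measurable_prodMk_left).enorm
  calc ∫⁻ a, ENNReal.ofReal (π.scoreSum b s a) ∂π.joint b s
      = ∫⁻ a, ∑ n, ‖π.fullScore n (b n) s (a n)‖ₑ ∂π.joint b s := by
        refine lintegral_congr fun a => ?_
        rw [PolicyFamily.scoreSum, ENNReal.ofReal_sum_of_nonneg fun _ _ => norm_nonneg _]
        simp_rw [ofReal_norm]
    _ = ∑ n, ∫⁻ a, ‖π.fullScore n (b n) s (a n)‖ₑ ∂π.joint b s :=
        lintegral_finsetSum _ fun n _ => (hm n).comp (measurable_pi_apply n)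
    _ ≤ ∑ _n : Fin N, N * ENNReal.ofReal B := by
        refine Finset.sum_le_sum fun n _ => ?_
        rw [π.lintegral_joint_eval b s n (hm n)]
        exact h.lintegral_fullScore_le n (b n) s
    _ = ENNReal.ofReal (N ^ 2 * B) := by
        rw [ENNReal.ofReal_mul (by positivity)]
        simp [sq, mul_assoc]

/-- The three factors `N` come from Cauchy–Schwarz over the agents, from the sum over the agents,
and from the `N` blocks of each full score. -/
lemma ScoreBounds.lintegral_scoreSum_sq_le (h : ScoreBounds π B V Λ)
    (b : Fin N → Params M) (s : S) :
    ∫⁻ a, ENNReal.ofReal (π.scoreSum b s a ^ 2) ∂π.joint b s ≤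
      ENNReal.ofReal (N ^ 3 * V ^ 2) := by
  have hm : ∀ n, Measurable fun a => ‖π.fullScore n (b n) s a‖ₑ ^ 2 := fun n =>
    ((π.measurable_fullScore n (b n)).comp measurable_prodMk_left).enorm.pow_const 2
  calc ∫⁻ a, ENNReal.ofReal (π.scoreSum b s a ^ 2) ∂π.joint b s
      ≤ ∫⁻ a, ∑ n, N * ‖π.fullScore n (b n) s (a n)‖ₑ ^ 2 ∂π.joint b s := by
        refine lintegral_mono fun a => ?_
        simp_rw [← ofReal_norm, ← ENNReal.ofReal_pow (norm_nonneg _)]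
        rw [← Finset.mul_sum, ← ENNReal.ofReal_sum_of_nonneg fun _ _ => by positivity,
          ← ENNReal.ofReal_natCast, ← ENNReal.ofReal_mul (by positivity)]
        refine ENNReal.ofReal_le_ofReal ?_
        have := sq_sum_le_card_mul_sum_sq (s := Finset.univ)
          (f := fun n => ‖π.fullScore n (b n) s (a n)‖)
        simpa [PolicyFamily.scoreSum] using this
    _ = ∑ n, ∫⁻ a, N * ‖π.fullScore n (b n) s (a n)‖ₑ ^ 2 ∂π.joint b s :=
        lintegral_finsetSum _ fun n _ => ((hm n).comp (measurable_pi_apply n)).const_mul _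
    _ ≤ ∑ _n : Fin N, N * (N * ENNReal.ofReal (V ^ 2)) := by
        refine Finset.sum_le_sum fun n _ => ?_
        have hmn : Measurable fun a : Fin N → A => ‖π.fullScore n (b n) s (a n)‖ₑ ^ 2 :=
          (hm n).comp (measurable_pi_apply n)
        rw [lintegral_const_mul _ hmn, π.lintegral_joint_eval b s n (hm n)]
        gcongr
        exact h.lintegral_fullScore_sq_le n (b n) s
    _ = ENNReal.ofReal (N ^ 3 * V ^ 2) := by
        rw [ENNReal.ofReal_mul (by positivity)]
        simp [pow_succ, mul_assoc]

/-- Functions dominated by a quadratic polynomial in the scores are integrable under the joint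
policy, uniformly in the state. -/
lemma ScoreBounds.lintegral_joint_le (h : ScoreBounds π B V Λ) (hB : 0 ≤ B)
    (b : Fin N → Params M) (s : S) (f : (Fin N → A) → ℝ) {c₀ c₁ c₂ : ℝ} (h₀ : 0 ≤ c₀)
    (h₁ : 0 ≤ c₁) (h₂ : 0 ≤ c₂)
    (hf : ∀ a, |f a| ≤ c₀ + c₁ * π.scoreSum b s a + c₂ * π.scoreSum b s a ^ 2) :
    ∫⁻ a, ‖f a‖ₑ ∂π.joint b s ≤
      ENNReal.ofReal (c₀ + c₁ * (N ^ 2 * B) + c₂ * (N ^ 3 * V ^ 2)) := by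
  exact lintegral_le_of_abs_le_quadratic (π.measurable_scoreSum_right b s)
    (π.scoreSum_nonneg b s) (h.lintegral_scoreSum_le b s) (h.lintegral_scoreSum_sq_le b s)
    (by positivity) (by positivity) h₀ h₁ h₂ hf

lemma ScoreBounds.lintegral_jointReal_mul_le (h : ScoreBounds π B V Λ) (hB : 0 ≤ B)
    (b : Fin N → Params M) (s : S) (f : (Fin N → A) → ℝ) (hfm : Measurable f) {c₀ c₁ c₂ : ℝ}
    (h₀ : 0 ≤ c₀) (h₁ : 0 ≤ c₁) (h₂ : 0 ≤ c₂)
    (hf : ∀ a, |f a| ≤ c₀ + c₁ * π.scoreSum b s a + c₂ * π.scoreSum b s a ^ 2) :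
    ∫⁻ a, ‖π.jointReal b s a * f a‖ₑ ∂(Measure.pi fun _ : Fin N => ν) ≤
      ENNReal.ofReal (c₀ + c₁ * (N ^ 2 * B) + c₂ * (N ^ 3 * V ^ 2)) := by
  refine le_trans (le_of_eq ?_) (h.lintegral_joint_le hB b s f h₀ h₁ h₂ hf)
  rw [π.lintegral_joint b s _ hfm.enorm]
  refine lintegral_congr fun a => ?_
  rw [enorm_mul, Real.enorm_of_nonneg (π.jointReal_pos b s a).le]

attribute [irreducible] PolicyFamily.scoreSum PolicyFamily.dirScore PolicyFamily.jointReal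

end JointPolicy

/-! ### Sensitivity of the joint policy -/

/-- Integrals of bounded functions against the second-order remainder. -/
lemma abs_integral_le_of_lintegral_le {X : Type*} [MeasurableSpace X] {m : Measure X} {f g : X → ℝ}
    {C c : ℝ} (hC : 0 ≤ C) (hc : 0 ≤ c) (hg : ∀ x, |g x| ≤ c)
    (hf : ∫⁻ x, ‖f x‖ₑ ∂m ≤ ENNReal.ofReal C) :
    |∫ x, f x * g x ∂m| ≤ C * c := by
  have h1 : ‖∫ x, f x * g x ∂m‖ₑ ≤ ENNReal.ofReal (C * c) := by
    calc ‖∫ x, f x * g x ∂m‖ₑ ≤ ∫⁻ x, ‖f x * g x‖ₑ ∂m := enorm_integral_le_lintegral_enorm _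
      _ ≤ ∫⁻ x, ‖f x‖ₑ * ENNReal.ofReal c ∂m := by
          refine lintegral_mono fun x => ?_
          rw [enorm_mul]
          gcongr
          rw [Real.enorm_eq_ofReal_abs]
          exact ENNReal.ofReal_le_ofReal (hg x)
      _ = (∫⁻ x, ‖f x‖ₑ ∂m) * ENNReal.ofReal c := lintegral_mul_const' _ _ ENNReal.ofReal_ne_top
      _ ≤ ENNReal.ofReal C * ENNReal.ofReal c := by gcongr
      _ = ENNReal.ofReal (C * c) := (ENNReal.ofReal_mul hC).symm
  rw [Real.enorm_eq_ofReal_abs] at h1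
  exact (ENNReal.ofReal_le_ofReal_iff (by positivity)).1 h1

section Sensitivity

variable {N : ℕ} {M : Fin N → ℕ} {S A : Type*} [MeasurableSpace S] [MeasurableSpace A]
  {ν : Measure A}

/-- The distance between two families of beliefs. -/
def beliefDist (b b' : Fin N → Params M) : ℝ := ∑ n, ‖b n - b' n‖

lemma beliefDist_nonneg (b b' : Fin N → Params M) : 0 ≤ beliefDist b b' :=
  Finset.sum_nonneg fun _ _ => norm_nonneg _

lemma norm_sub_le_beliefDist (b b' : Fin N → Params M) (n : Fin N) :
    ‖b n - b' n‖ ≤ beliefDist b b' :=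
  Finset.single_le_sum (f := fun n => ‖b n - b' n‖) (fun _ _ => norm_nonneg _) (Finset.mem_univ n)

lemma beliefDist_line (b b' : Fin N → Params M) {t : ℝ} (ht : 0 ≤ t) :
    beliefDist (b' + t • (b - b')) b' = t * beliefDist b b' := by
  simp only [beliefDist, Finset.mul_sum]
  refine Finset.sum_congr rfl fun n _ => ?_
  simp [norm_smul, abs_of_nonneg ht]

/-- The Lipschitz constant of the joint policy, in the weighted `L¹` norm, with respect to the
parameters. -/
def policyLip (N : ℕ) (B V Λ : ℝ) : ℝ :=
  N ^ 3 * V ^ 2 + N * Λ * (N ^ 2 * B) + 2 * (N ^ 2 * B) + N * Λ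

lemma policyLip_nonneg {B V Λ : ℝ} (hB : 0 ≤ B) (hΛ : 0 ≤ Λ) : 0 ≤ policyLip N B V Λ := by
  unfold policyLip; positivity

variable {π : PolicyFamily M S A ν} {B V Λ : ℝ}

lemma ScoreBounds.abs_dirScore_const_le (h : ScoreBounds π B V Λ) (b : Fin N → Params M)
    (θ v : Params M) (s : S) (a : Fin N → A) :
    |π.dirScore (fun _ => θ) (fun _ => v) s a| ≤
      ‖v‖ * (π.scoreSum b s a + N * Λ * beliefDist b (fun _ => θ)) := by
  refine (π.abs_dirScore_le (fun _ => θ) (fun _ => v) s a (c := ‖v‖) fun _ => le_rfl).trans ?_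
  gcongr
  refine (h.scoreSum_le_add (fun _ => θ) b s a).trans (le_of_eq ?_)
  unfold beliefDist
  simp_rw [norm_sub_rev θ]

lemma ScoreBounds.continuous_dirScore_line (h : ScoreBounds π B V Λ) (hΛ : 0 ≤ Λ)
    (b δ : Fin N → Params M) (s : S) (a : Fin N → A) :
    Continuous fun t : ℝ => π.dirScore (b + t • δ) δ s a := by
  have hc : ∀ n, ‖δ n‖ ≤ ∑ n, ‖δ n‖ := fun n =>
    Finset.single_le_sum (f := fun n => ‖δ n‖) (fun _ _ => norm_nonneg _) (Finset.mem_univ n)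
  set c := ∑ n, ‖δ n‖ with hcdef
  have hc0 : 0 ≤ c := Finset.sum_nonneg fun _ _ => norm_nonneg _
  have hL : LipschitzWith (Real.toNNReal (N * Λ * c * c))
      fun t : ℝ => π.dirScore (b + t • δ) δ s a := by
    refine LipschitzWith.of_dist_le_mul fun t t' => ?_
    rw [Real.coe_toNNReal _ (by positivity), Real.dist_eq, Real.dist_eq]
    refine (h.abs_dirScore_sub_le (b + t • δ) (b + t' • δ) δ s a hc).trans (le_of_eq ?_)
    have : ∀ n, ‖(b + t • δ) n - (b + t' • δ) n‖ = |t - t'| * ‖δ n‖ := by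
      intro n
      rw [← Real.norm_eq_abs, ← norm_smul]
      congr 1
      simp only [Pi.add_apply, Pi.smul_apply, sub_smul]
      abel
    simp_rw [this, ← Finset.mul_sum]
    ring
  exact hL.continuous

variable [SigmaFinite ν]

/-- The L¹ mean value inequality on the segment from `b'` to `b`. The weight `g` leaves room for an
unbounded factor such as a score. -/
lemma ScoreBounds.lintegral_jointReal_line_le (h : ScoreBounds π B V Λ) (hΛ : 0 ≤ Λ)
    (b b' : Fin N → Params M) (s : S) (g : (Fin N → A) → ℝ≥0∞) (hg : Measurable g) (C : ℝ≥0∞)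
    (hC : ∀ t ∈ Set.Icc (0 : ℝ) 1, ∫⁻ a, ‖π.jointReal (b' + t • (b - b')) s a *
      π.dirScore (b' + t • (b - b')) (b - b') s a‖ₑ * g a ∂(Measure.pi fun _ : Fin N => ν) ≤ C) :
    ∫⁻ a, ‖π.jointReal b s a - π.jointReal b' s a‖ₑ * g a ∂(Measure.pi fun _ : Fin N => ν) ≤ C := by
  have key := lintegral_sub_le_of_deriv (Measure.pi fun _ : Fin N => ν)
    (fun t a => π.jointReal (b' + t • (b - b')) s a)
    (fun t a => π.jointReal (b' + t • (b - b')) s a *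
      π.dirScore (b' + t • (b - b')) (b - b') s a) g C
    (fun t a => π.hasDerivAt_jointReal_line b' (b - b') s a t)
    (fun a => (continuous_iff_continuousAt.2 fun t =>
      (π.hasDerivAt_jointReal_line b' (b - b') s a t).continuousAt).mul
        (h.continuous_dirScore_line hΛ b' (b - b') s a))
    (fun t => (π.measurable_jointReal_right _ s).mul (π.measurable_dirScore_right _ _ s)) hg hC
  simpa only [one_smul, zero_smul, add_zero, add_sub_cancel] using key

lemma ScoreBounds.lintegral_jointReal_sub_le (h : ScoreBounds π B V Λ) (hB : 0 ≤ B) (hΛ : 0 ≤ Λ)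
    (b b' : Fin N → Params M) (s : S) :
    ∫⁻ a, ‖π.jointReal b s a - π.jointReal b' s a‖ₑ ∂(Measure.pi fun _ : Fin N => ν) ≤
      ENNReal.ofReal (N ^ 2 * B * beliefDist b b') := by
  have he := beliefDist_nonneg b b'
  have key := h.lintegral_jointReal_line_le hΛ b b' s (fun _ => 1) measurable_const
    (ENNReal.ofReal (N ^ 2 * B * beliefDist b b')) fun t _ => ?_
  · simpa using key
  · simp only [mul_one]
    refine (h.lintegral_jointReal_mul_le hB _ s _ (π.measurable_dirScore_right _ _ s)
      (c₀ := 0) (c₁ := beliefDist b b') (c₂ := 0) le_rfl he le_rfl fun a => ?_).trans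
        (le_of_eq ?_)
    · simpa using π.abs_dirScore_le (b' + t • (b - b')) (b - b') s a (norm_sub_le_beliefDist b b')
    · congr 1; ring

/-- The score weight is unbounded, so the second moment is needed. The bound has to be linear in the
distance both for near and for far beliefs, since only first moments of belief errors are available
later. -/
lemma ScoreBounds.lintegral_jointReal_sub_mul_scoreSum_le (h : ScoreBounds π B V Λ) (hB : 0 ≤ B)
    (hΛ : 0 ≤ Λ) (b b' : Fin N → Params M) (s : S) :
    ∫⁻ a, ‖π.jointReal b s a - π.jointReal b' s a‖ₑ * ENNReal.ofReal (π.scoreSum b' s a)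
      ∂(Measure.pi fun _ : Fin N => ν) ≤
      ENNReal.ofReal (policyLip N B V Λ * beliefDist b b') := by
  have he := beliefDist_nonneg b b'
  set e := beliefDist b b' with hedef
  have hGm : Measurable fun a => ENNReal.ofReal (π.scoreSum b' s a) :=
    (π.measurable_scoreSum_right b' s).ennreal_ofReal
  have hmul : ∀ (c : Fin N → Params M) (f : (Fin N → A) → ℝ) (a : Fin N → A),
      ‖π.jointReal c s a * f a‖ₑ * ENNReal.ofReal (π.scoreSum b' s a) =
      ‖π.jointReal c s a * (f a * π.scoreSum b' s a)‖ₑ := by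
    intro c f a
    rw [← mul_assoc, enorm_mul _ (π.scoreSum b' s a),
      Real.enorm_of_nonneg (π.scoreSum_nonneg b' s a)]
  -- For `e ≤ 1` the mean value inequality yields `e * N³V² + NΛe² * N²B`, and `e² ≤ e`. For `e ≥ 1`
  -- the crude triangle inequality yields `2N²B + NΛe`, and `1 ≤ e`. The constant `policyLip` adds
  -- the coefficients of both cases.
  rcases le_total e 1 with h1 | h1
  · refine (h.lintegral_jointReal_line_le hΛ b b' s _ hGm
      (ENNReal.ofReal (0 + N * Λ * e * e * (N ^ 2 * B) + e * (N ^ 3 * V ^ 2)))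
      fun t ht => ?_).trans ?_
    · simp_rw [hmul]
      refine h.lintegral_jointReal_mul_le hB _ s _ ((π.measurable_dirScore_right _ _ s).mul
        (π.measurable_scoreSum_right b' s)) le_rfl (by positivity) he fun a => ?_
      have g1 := π.abs_dirScore_le (b' + t • (b - b')) (b - b') s a (norm_sub_le_beliefDist b b')
      have g2 := h.scoreSum_le_add b' (b' + t • (b - b')) s a
      have g3 : ∑ n, ‖b' n - (b' + t • (b - b')) n‖ ≤ e := by
        have := beliefDist_line b b' ht.1
        rw [beliefDist] at this
        simp_rw [norm_sub_rev (b' _)]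
        rw [this]
        exact mul_le_of_le_one_left he ht.2
      have hG := π.scoreSum_nonneg (b' + t • (b - b')) s a
      have hG' := π.scoreSum_nonneg b' s a
      rw [Pi.mul_apply, abs_mul, abs_of_nonneg hG']
      calc _ ≤ (e * π.scoreSum (b' + t • (b - b')) s a) *
            (π.scoreSum (b' + t • (b - b')) s a + N * Λ * e) := by
            refine mul_le_mul g1 (g2.trans ?_) hG' (by positivity)
            gcongr
        _ = _ := by ring
    · refine ENNReal.ofReal_le_ofReal ?_
      have : N * Λ * e * e * (N ^ 2 * B) ≤ N * Λ * e * 1 * (N ^ 2 * B) := by gcongr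
      have p1 : 0 ≤ (2 * (N ^ 2 * B) + N * Λ) * e := by positivity
      unfold policyLip
      linarith
  · have hb := h.lintegral_jointReal_mul_le hB b s (fun a => 1 * π.scoreSum b' s a)
      ((π.measurable_scoreSum_right b' s).const_mul 1)
      (c₀ := N * Λ * e) (c₁ := 1) (c₂ := 0) (by positivity) zero_le_one le_rfl fun a => by
        have g2 := h.scoreSum_le_add b' b s a
        have hG' := π.scoreSum_nonneg b' s a
        have : ∑ n, ‖b' n - b n‖ = e := by
          simp_rw [norm_sub_rev (b' _)]
          rfl
        rw [this] at g2
        rw [one_mul, abs_of_nonneg hG']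
        linarith
    have hb' := h.lintegral_jointReal_mul_le hB b' s (fun a => 1 * π.scoreSum b' s a)
      ((π.measurable_scoreSum_right b' s).const_mul 1)
      (c₀ := 0) (c₁ := 1) (c₂ := 0) le_rfl zero_le_one le_rfl fun a => by
        have hG' := π.scoreSum_nonneg b' s a
        rw [one_mul, abs_of_nonneg hG']
        linarith
    calc _ ≤ ∫⁻ a, (‖π.jointReal b s a * (1 * π.scoreSum b' s a)‖ₑ +
            ‖π.jointReal b' s a * (1 * π.scoreSum b' s a)‖ₑ)
            ∂(Measure.pi fun _ : Fin N => ν) := by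
          refine lintegral_mono fun a => ?_
          simp only [← hmul _ (fun _ => 1), mul_one, ← add_mul]
          gcongr
          exact enorm_sub_le
      _ = _ := lintegral_add_left ((π.measurable_jointReal_right b s).mul
          ((π.measurable_scoreSum_right b' s).const_mul 1)).enorm _
      _ ≤ _ := add_le_add hb hb'
      _ ≤ _ := by
          rw [← ENNReal.ofReal_add (by positivity) (by positivity)]
          refine ENNReal.ofReal_le_ofReal ?_
          have p1 : 2 * (N ^ 2 * B) * 1 ≤ 2 * (N ^ 2 * B) * e := by gcongr
          have p2 : 0 ≤ (N ^ 3 * V ^ 2 + N * Λ * (N ^ 2 * B)) * e := by positivity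
          unfold policyLip
          linarith

-- The mean value inequality is applied to the density along the segment minus its linearization at
-- `b'`. The derivative of that difference splits in two: the change of the density times the fixed
-- score at `b'`, covered by the score-weighted Lipschitz bound, and the density times the change of
-- the score, covered by the Lipschitz property. Each is of order `e` times `e`.
set_option maxHeartbeats 800000 in
lemma ScoreBounds.lintegral_jointReal_taylor_le (h : ScoreBounds π B V Λ) (hB : 0 ≤ B)
    (hΛ : 0 ≤ Λ) (b b' : Fin N → Params M) (s : S) :
    ∫⁻ a, ‖π.jointReal b s a - π.jointReal b' s a
        - π.jointReal b' s a * π.dirScore b' (b - b') s a‖ₑ ∂(Measure.pi fun _ : Fin N => ν) ≤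
      ENNReal.ofReal ((policyLip N B V Λ + N * Λ) * beliefDist b b' ^ 2) := by
  have he := beliefDist_nonneg b b'
  have hL := policyLip_nonneg (N := N) (V := V) hB hΛ
  set e := beliefDist b b' with hedef
  have hjc : ∀ a, Continuous fun t : ℝ => π.jointReal (b' + t • (b - b')) s a := fun a =>
    continuous_iff_continuousAt.2 fun t =>
      (π.hasDerivAt_jointReal_line b' (b - b') s a t).continuousAt
  have key := lintegral_sub_le_of_deriv (Measure.pi fun _ : Fin N => ν)
    (fun t a => π.jointReal (b' + t • (b - b')) s a -
      t * (π.jointReal b' s a * π.dirScore b' (b - b') s a))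
    (fun t a => π.jointReal (b' + t • (b - b')) s a *
      π.dirScore (b' + t • (b - b')) (b - b') s a -
        π.jointReal b' s a * π.dirScore b' (b - b') s a) (fun _ => 1)
    (ENNReal.ofReal ((policyLip N B V Λ + N * Λ) * e ^ 2))
    (fun t a => by
      have := (π.hasDerivAt_jointReal_line b' (b - b') s a t).sub
        ((hasDerivAt_id t).mul_const (π.jointReal b' s a * π.dirScore b' (b - b') s a))
      refine this.congr_deriv ?_
      ring)
    (fun a => ((hjc a).mul (h.continuous_dirScore_line hΛ b' (b - b') s a)).sub continuous_const)
    (fun t => ((π.measurable_jointReal_right _ s).mul (π.measurable_dirScore_right _ _ s)).sub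
      ((π.measurable_jointReal_right _ s).mul (π.measurable_dirScore_right _ _ s)))
    measurable_const (fun t ht => ?_)
  · refine le_trans (le_of_eq (lintegral_congr fun a => ?_)) key
    simp only [one_smul, zero_smul, add_zero, add_sub_cancel, mul_one, one_mul, zero_mul, sub_zero]
    congr 1
    ring
  · have g1 := h.lintegral_jointReal_sub_mul_scoreSum_le hB hΛ (b' + t • (b - b')) b' s
    have hdl := beliefDist_line b b' ht.1
    have hte : t * e ≤ e := mul_le_of_le_one_left he ht.2
    have g2 := h.lintegral_jointReal_mul_le hB (b' + t • (b - b')) s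
      (fun a => π.dirScore (b' + t • (b - b')) (b - b') s a - π.dirScore b' (b - b') s a)
      ((π.measurable_dirScore_right _ _ s).sub (π.measurable_dirScore_right _ _ s))
      (c₀ := N * Λ * e * e) (c₁ := 0) (c₂ := 0) (by positivity) le_rfl le_rfl fun a => by
        refine (h.abs_dirScore_sub_le _ _ _ s a (norm_sub_le_beliefDist b b')).trans ?_
        have : ∑ n, ‖(b' + t • (b - b')) n - b' n‖ ≤ e := by
          rw [beliefDist] at hdl
          rw [hdl]
          exact hte
        simp only [zero_mul, add_zero]
        gcongr
    calc _ ≤ ∫⁻ a, (ENNReal.ofReal e * (‖π.jointReal (b' + t • (b - b')) s a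
              - π.jointReal b' s a‖ₑ * ENNReal.ofReal (π.scoreSum b' s a)) +
            ‖π.jointReal (b' + t • (b - b')) s a * (π.dirScore (b' + t • (b - b')) (b - b') s a
              - π.dirScore b' (b - b') s a)‖ₑ) ∂(Measure.pi fun _ : Fin N => ν) := by
          refine lintegral_mono fun a => ?_
          have hsplit : π.jointReal (b' + t • (b - b')) s a *
              π.dirScore (b' + t • (b - b')) (b - b') s a -
              π.jointReal b' s a * π.dirScore b' (b - b') s a =
              (π.jointReal (b' + t • (b - b')) s a - π.jointReal b' s a) *
                π.dirScore b' (b - b') s a +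
              π.jointReal (b' + t • (b - b')) s a *
                (π.dirScore (b' + t • (b - b')) (b - b') s a - π.dirScore b' (b - b') s a) := by
            ring
          rw [mul_one, hsplit]
          refine (enorm_add_le _ _).trans ?_
          gcongr
          rw [enorm_mul, mul_left_comm]
          gcongr
          rw [← ENNReal.ofReal_mul he, Real.enorm_eq_ofReal_abs]
          exact ENNReal.ofReal_le_ofReal
            (π.abs_dirScore_le b' (b - b') s a (norm_sub_le_beliefDist b b'))
      _ = ENNReal.ofReal e * ∫⁻ a, ‖π.jointReal (b' + t • (b - b')) s a
              - π.jointReal b' s a‖ₑ * ENNReal.ofReal (π.scoreSum b' s a)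
              ∂(Measure.pi fun _ : Fin N => ν) +
            ∫⁻ a, ‖π.jointReal (b' + t • (b - b')) s a *
              (π.dirScore (b' + t • (b - b')) (b - b') s a
              - π.dirScore b' (b - b') s a)‖ₑ ∂(Measure.pi fun _ : Fin N => ν) := by
          have hm : Measurable fun a => ‖π.jointReal (b' + t • (b - b')) s a
              - π.jointReal b' s a‖ₑ * ENNReal.ofReal (π.scoreSum b' s a) :=
            (((π.measurable_jointReal_right _ s).sub
              (π.measurable_jointReal_right _ s)).enorm).mul
              (π.measurable_scoreSum_right b' s).ennreal_ofReal
          rw [lintegral_add_left (hm.const_mul _), lintegral_const_mul _ hm]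
      _ ≤ ENNReal.ofReal e * ENNReal.ofReal (policyLip N B V Λ * e) +
            ENNReal.ofReal (N * Λ * e * e) := by
          gcongr
          · refine g1.trans (ENNReal.ofReal_le_ofReal ?_)
            rw [hdl]
            gcongr
          · simpa using g2
      _ = _ := by
          have p1 : 0 ≤ (N : ℝ) * Λ * e * e := by positivity
          have p2 : 0 ≤ e * (policyLip N B V Λ * e) := mul_nonneg he (mul_nonneg hL he)
          rw [← ENNReal.ofReal_mul he, ← ENNReal.ofReal_add p2 p1]
          congr 1
          ring

end Sensitivity

/-! ### Bounded measurable functions -/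

/-- Measurable functions bounded by `c`. -/
structure BddMeas {X : Type*} [MeasurableSpace X] (f : X → ℝ) (c : ℝ) : Prop where
  meas : Measurable f
  bound : ∀ x, |f x| ≤ c

section BddMeas

variable {X Y : Type*} [MeasurableSpace X] [MeasurableSpace Y]

lemma BddMeas.integrable {f : X → ℝ} {c : ℝ} (hf : BddMeas f c) (m : Measure X)
    [IsFiniteMeasure m] : Integrable f m :=
  Integrable.of_bound hf.meas.aestronglyMeasurable c (Eventually.of_forall hf.bound)

lemma BddMeas.abs_integral_le {f : X → ℝ} {c : ℝ} (hf : BddMeas f c) (m : Measure X)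
    [IsProbabilityMeasure m] : |∫ x, f x ∂m| ≤ c := by
  have := norm_integral_le_of_norm_le_const (μ := m) (f := f) (C := c)
    (Eventually.of_forall hf.bound)
  simpa using this

lemma BddMeas.integral_kernel {f : X → ℝ} {c : ℝ} (hf : BddMeas f c) (κ : Kernel Y X)
    [IsMarkovKernel κ] : BddMeas (fun y => ∫ x, f x ∂κ y) c where
  meas := (StronglyMeasurable.integral_kernel hf.meas.stronglyMeasurable).measurable
  bound y := hf.abs_integral_le (κ y)

lemma BddMeas.comp {f : X → ℝ} {c : ℝ} (hf : BddMeas f c) {g : Y → X} (hg : Measurable g) :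
    BddMeas (fun y => f (g y)) c where
  meas := hf.meas.comp hg
  bound y := hf.bound (g y)

lemma BddMeas.sub {f g : X → ℝ} {c d : ℝ} (hf : BddMeas f c) (hg : BddMeas g d) :
    BddMeas (fun x => f x - g x) (c + d) where
  meas := hf.meas.sub hg.meas
  bound x := (abs_sub _ _).trans (add_le_add (hf.bound x) (hg.bound x))

lemma BddMeas.integral_comp {f : X → ℝ} {c : ℝ} (hf : BddMeas f c) (κ : Kernel Y X)
    [IsMarkovKernel κ] (m : Measure Y) [IsProbabilityMeasure m] :
    ∫ x, f x ∂(κ ∘ₘ m) = ∫ y, ∫ x, f x ∂κ y ∂m := by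
  rw [← Measure.snd_compProd, Measure.snd, integral_map measurable_snd.aemeasurable
    hf.meas.aestronglyMeasurable]
  exact Measure.integral_compProd ((hf.comp measurable_snd).integrable _)

lemma BddMeas.integral_compProd {f : Y × X → ℝ} {c : ℝ} (hf : BddMeas f c) (κ : Kernel Y X)
    [IsMarkovKernel κ] (m : Measure Y) [IsProbabilityMeasure m] :
    ∫ x, f x ∂(m ⊗ₘ κ) = ∫ y, ∫ x, f (y, x) ∂κ y ∂m :=
  Measure.integral_compProd (hf.integrable _)

lemma summable_discounted {γ c : ℝ} (h₀ : 0 ≤ γ) (h₁ : γ < 1) {a : ℕ → ℝ} (ha : ∀ k, |a k| ≤ c) :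
    Summable fun k => γ ^ k * a k := by
  refine Summable.of_norm_bounded ((summable_geometric_of_lt_one h₀ h₁).mul_right c) fun k => ?_
  rw [norm_mul, Real.norm_of_nonneg (pow_nonneg h₀ k)]
  exact mul_le_mul_of_nonneg_left (ha k) (pow_nonneg h₀ k)

lemma abs_tsum_discounted_le {γ c : ℝ} (h₀ : 0 ≤ γ) (h₁ : γ < 1) {a : ℕ → ℝ}
    (ha : ∀ k, |a k| ≤ c) : |∑' k, γ ^ k * a k| ≤ (1 - γ)⁻¹ * c := by
  have h := tsum_of_norm_bounded ((hasSum_geometric_of_lt_one h₀ h₁).mul_right c)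
    (f := fun k => γ ^ k * a k) fun k => by
      rw [norm_mul, Real.norm_of_nonneg (pow_nonneg h₀ k)]
      exact mul_le_mul_of_nonneg_left (ha k) (pow_nonneg h₀ k)
  simpa using h

lemma BddMeas.tsum_discounted {γ c : ℝ} (h₀ : 0 ≤ γ) (h₁ : γ < 1) {a : ℕ → X → ℝ}
    (ha : ∀ k, BddMeas (a k) c) : BddMeas (fun x => ∑' k, γ ^ k * a k x) ((1 - γ)⁻¹ * c) where
  meas := by
    refine measurable_of_tendsto_metrizable
      (f := fun (n : ℕ) x => ∑ k ∈ Finset.range n, γ ^ k * a k x) (fun n => ?_) ?_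
    · exact Finset.measurable_sum _ fun k _ => (ha k).meas.const_mul _
    · exact tendsto_pi_nhds.2 fun x =>
        (summable_discounted h₀ h₁ fun k => (ha k).bound x).hasSum.tendsto_sum_nat
  bound x := abs_tsum_discounted_le h₀ h₁ fun k => (ha k).bound x

lemma integral_tsum_discounted {γ c : ℝ} (h₀ : 0 ≤ γ) (h₁ : γ < 1) {a : ℕ → X → ℝ}
    (ha : ∀ k, BddMeas (a k) c) (m : Measure X) [IsProbabilityMeasure m] :
    ∫ x, ∑' k, γ ^ k * a k x ∂m = ∑' k, γ ^ k * ∫ x, a k x ∂m := by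
  have h : HasSum (fun k => ∫ x, γ ^ k * a k x ∂m) (∫ x, ∑' k, γ ^ k * a k x ∂m) := by
    refine hasSum_integral_of_summable_integral_norm
      (fun k => ((ha k).integrable m).const_mul _) ?_
    refine Summable.of_nonneg_of_le (fun k => integral_nonneg fun x => norm_nonneg _) (fun k => ?_)
      ((summable_geometric_of_lt_one h₀ h₁).mul_right c)
    simp_rw [norm_mul, Real.norm_of_nonneg (pow_nonneg h₀ k)]
    rw [integral_const_mul]
    refine mul_le_mul_of_nonneg_left ?_ (pow_nonneg h₀ k)
    have hn : BddMeas (fun x => ‖a k x‖) c := ⟨(ha k).meas.norm, fun x => by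
      simpa using (ha k).bound x⟩
    exact (le_abs_self _).trans (hn.abs_integral_le m)
  rw [← h.tsum_eq]
  exact tsum_congr fun k => integral_const_mul _ _

/-- Iterates of a transition kernel. -/
def iterKernel (K : Kernel X X) : ℕ → Kernel X X
  | 0 => Kernel.id
  | k + 1 => K ∘ₖ iterKernel K k

instance (K : Kernel X X) [IsMarkovKernel K] (k : ℕ) : IsMarkovKernel (iterKernel K k) := by
  induction k with
  | zero => exact inferInstanceAs (IsMarkovKernel Kernel.id)
  | succ k ih => exact inferInstanceAs (IsMarkovKernel (K ∘ₖ iterKernel K k))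

/-- The definition appends a step at the end of the chain; the Bellman equation needs the first step
split off instead. -/
lemma iterKernel_succ' (K : Kernel X X) (k : ℕ) :
    iterKernel K (k + 1) = iterKernel K k ∘ₖ K := by
  induction k with
  | zero => simp [iterKernel]
  | succ k ih =>
    change K ∘ₖ iterKernel K (k + 1) = (K ∘ₖ iterKernel K k) ∘ₖ K
    rw [ih, Kernel.comp_assoc]

end BddMeas

/-! ### Marginal laws of the trajectories -/

section Trajectories

variable {N : ℕ} {M : Fin N → ℕ} {S A : Type*} [MeasurableSpace S] [MeasurableSpace A]
  {ν : Measure A} [SigmaFinite ν]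

/-- The law of the trajectory with `s_0 ∼ ρ`. -/
def pathLaw (G : MarkovGame N S A) (π : PolicyFamily M S A ν) (b : Fin N → Params M) :
    Measure (Path N S A) :=
  pathKernel G π b ∘ₘ G.ρ

instance (G : MarkovGame N S A) (π : PolicyFamily M S A ν) (b : Fin N → Params M) :
    IsProbabilityMeasure (pathLaw G π b) := by
  unfold pathLaw; infer_instance

/-- The law of the state `s_k`. -/
def stateLaw (G : MarkovGame N S A) (π : PolicyFamily M S A ν) (b : Fin N → Params M) :
    ℕ → Measure S
  | 0 => G.ρ
  | k + 1 => G.P ∘ₘ (stateLaw G π b k ⊗ₘ π.joint b)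

/-- The law of the state-action pair `(s_k, a_k)`. -/
def stateActionLaw (G : MarkovGame N S A) (π : PolicyFamily M S A ν) (b : Fin N → Params M)
    (k : ℕ) : Measure (S × (Fin N → A)) :=
  stateLaw G π b k ⊗ₘ π.joint b

instance (G : MarkovGame N S A) (π : PolicyFamily M S A ν) (b : Fin N → Params M) (k : ℕ) :
    IsProbabilityMeasure (stateLaw G π b k) := by
  induction k with
  | zero => exact inferInstanceAs (IsProbabilityMeasure G.ρ)
  | succ k ih =>
    exact inferInstanceAs (IsProbabilityMeasure (G.P ∘ₘ (stateLaw G π b k ⊗ₘ π.joint b)))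

instance (G : MarkovGame N S A) (π : PolicyFamily M S A ν) (b : Fin N → Params M) (k : ℕ) :
    IsProbabilityMeasure (stateActionLaw G π b k) := by
  unfold stateActionLaw; infer_instance

variable (G : MarkovGame N S A) (π : PolicyFamily M S A ν) (b : Fin N → Params M)

lemma comp_stepKernel_eq_compProd (m : Measure (S × (Fin N → A))) [IsProbabilityMeasure m] :
    stepKernel G π b ∘ₘ m = (G.P ∘ₘ m) ⊗ₘ π.joint b := by
  refine Measure.ext_of_lintegral _ fun f hf => ?_
  rw [Measure.lintegral_bind (stepKernel G π b).aemeasurable hf.aemeasurable,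
    Measure.lintegral_compProd hf, Measure.lintegral_bind G.P.aemeasurable
      (Measurable.lintegral_kernel_prod_right' hf).aemeasurable]
  refine lintegral_congr fun z => ?_
  rw [stepKernel, Kernel.lintegral_compProd _ _ _ hf]
  rfl

lemma stateActionLaw_succ (k : ℕ) :
    stateActionLaw G π b (k + 1) = stepKernel G π b ∘ₘ stateActionLaw G π b k := by
  rw [comp_stepKernel_eq_compProd]
  rfl

lemma stateActionLaw_eq_comp (k : ℕ) :
    stateActionLaw G π b k = iterKernel (stepKernel G π b) k ∘ₘ stateActionLaw G π b 0 := by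
  induction k with
  | zero => simp [iterKernel]
  | succ k ih => rw [stateActionLaw_succ, ih, iterKernel, Measure.comp_assoc]

lemma pathLaw_eq_trajMeasure :
    pathLaw G π b = Kernel.trajMeasure (X := fun _ : ℕ => S × (Fin N → A))
      (stateActionLaw G π b 0) (historyKernel G π b) := by
  rw [pathLaw, pathKernel, Kernel.trajMeasure, stateActionLaw, stateLaw,
    Measure.compProd_eq_comp_prod, Measure.map_comp _ _ (by fun_prop), Measure.comp_assoc]

lemma pathKernel_eq_trajMeasure (s : S) :
    pathKernel G π b s = Kernel.trajMeasure (X := fun _ : ℕ => S × (Fin N → A))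
      ((Measure.dirac s) ⊗ₘ π.joint b) (historyKernel G π b) := by
  rw [pathKernel, Kernel.trajMeasure, Measure.compProd_eq_comp_prod,
    Measure.map_comp _ _ (by fun_prop), Measure.comp_assoc, Measure.dirac_bind (Kernel.measurable _)]

lemma map_eval_zero_pathLaw : (pathLaw G π b).map (fun x => x 0) = stateActionLaw G π b 0 := by
  have h : (fun x : Path N S A => x 0) =
      (fun y : (j : Finset.Iic 0) → (fun _ : ℕ => S × (Fin N → A)) j => y ⟨0, by simp⟩) ∘
        Preorder.frestrictLe (π := fun _ : ℕ => S × (Fin N → A)) 0 := rfl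
  rw [h, ← Measure.map_map (by fun_prop) (by fun_prop), pathLaw_eq_trajMeasure,
    Kernel.trajMeasure, Measure.map_comp _ _ (by fun_prop), Kernel.traj_map_frestrictLe,
    Kernel.partialTraj_self, Measure.id_comp, Measure.map_map (by fun_prop) (by fun_prop)]
  exact Measure.map_id

/-- One-step Markov property with the whole history retained. It is the recursion defining the
trajectory measure, whose transition looks only at the last pair. -/
lemma lintegral_pathLaw_succ (n : ℕ)
    (f : ((j : Finset.Iic n) → (fun _ : ℕ => S × (Fin N → A)) j) × (S × (Fin N → A)) → ℝ≥0∞)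
    (hf : Measurable f) :
    ∫⁻ x, f (Preorder.frestrictLe (π := fun _ : ℕ => S × (Fin N → A)) n x, x (n + 1))
        ∂pathLaw G π b =
      ∫⁻ x, ∫⁻ z, f (Preorder.frestrictLe (π := fun _ : ℕ => S × (Fin N → A)) n x, z)
        ∂stepKernel G π b (x n) ∂pathLaw G π b := by
  have h := Kernel.map_frestrictLe_trajMeasure_compProd_eq_map_trajMeasure
    (X := fun _ : ℕ => S × (Fin N → A)) (μ₀ := stateActionLaw G π b 0)
    (κ := historyKernel G π b) (a := n)
  rw [← pathLaw_eq_trajMeasure] at h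
  have h2 : ∫⁻ x, f x ∂((pathLaw G π b).map (fun x =>
      (Preorder.frestrictLe (π := fun _ : ℕ => S × (Fin N → A)) n x, x (n + 1)))) =
      ∫⁻ x, f (Preorder.frestrictLe (π := fun _ : ℕ => S × (Fin N → A)) n x, x (n + 1))
        ∂pathLaw G π b := lintegral_map hf (by fun_prop)
  rw [← h2, ← h, Measure.lintegral_compProd hf, lintegral_map
    (Measurable.lintegral_kernel_prod_right' hf) (by fun_prop)]
  rfl

/-- Markov property over `m` steps, by integrating out the last coordinate. Both endpoints are kept
because the score at time `k` has to be correlated with the reward at time `k + m`. -/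
lemma lintegral_pathLaw_pair (k m : ℕ)
    (f : (S × (Fin N → A)) × (S × (Fin N → A)) → ℝ≥0∞) (hf : Measurable f) :
    ∫⁻ x, f (x k, x (k + m)) ∂pathLaw G π b =
      ∫⁻ x, ∫⁻ z, f (x k, z) ∂iterKernel (stepKernel G π b) m (x k) ∂pathLaw G π b := by
  induction m generalizing f with
  | zero =>
    refine lintegral_congr fun x => ?_
    have : ∫⁻ z, f (x k, z) ∂iterKernel (stepKernel G π b) 0 (x k) = f (x k, x k) := by
      have hfx : Measurable fun z => f (x k, z) := hf.comp measurable_prodMk_left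
      rw [iterKernel, Kernel.id_apply, lintegral_dirac' _ hfx]
    rw [this]
    rfl
  | succ m ih =>
    have h1 := lintegral_pathLaw_succ G π b (k + m)
      (fun p => f (p.1 ⟨k, by simp⟩, p.2)) (by fun_prop)
    have hg : Measurable fun p : (S × (Fin N → A)) × (S × (Fin N → A)) =>
        ∫⁻ z, f (p.1, z) ∂stepKernel G π b p.2 := by
      have := Measurable.lintegral_kernel_prod_right'
        (κ := (stepKernel G π b).comap
          (Prod.snd : (S × (Fin N → A)) × (S × (Fin N → A)) → _) measurable_snd)
        (f := fun q => f (q.1.1, q.2)) (by fun_prop)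
      exact this
    have h2 := ih (fun p => ∫⁻ z, f (p.1, z) ∂stepKernel G π b p.2) hg
    rw [← add_assoc]
    refine h1.trans (h2.trans (lintegral_congr fun x => ?_))
    have hfx : Measurable fun z => f (x k, z) := hf.comp measurable_prodMk_left
    rw [iterKernel, Kernel.lintegral_comp _ _ _ hfx]

lemma map_eval_pathLaw (k : ℕ) :
    (pathLaw G π b).map (fun x => x k) = stateActionLaw G π b k := by
  rw [stateActionLaw_eq_comp, ← map_eval_zero_pathLaw]
  refine Measure.ext_of_lintegral _ fun f hf => ?_
  rw [lintegral_map hf (by fun_prop), Measure.lintegral_bind (Kernel.aemeasurable _)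
    hf.aemeasurable, lintegral_map (hf.lintegral_kernel) (by fun_prop)]
  have h := lintegral_pathLaw_pair G π b 0 k (fun p => f p.2) (by fun_prop)
  simpa using h

lemma map_pair_pathLaw (k m : ℕ) :
    (pathLaw G π b).map (fun x => (x k, x (k + m))) =
      stateActionLaw G π b k ⊗ₘ iterKernel (stepKernel G π b) m := by
  refine Measure.ext_of_lintegral _ fun f hf => ?_
  rw [lintegral_map hf (by fun_prop), Measure.lintegral_compProd hf, ← map_eval_pathLaw,
    lintegral_map (Measurable.lintegral_kernel_prod_right' hf) (by fun_prop)]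
  exact lintegral_pathLaw_pair G π b k m f hf

end Trajectories

/-! ### Value functions and performance differences -/

section Values

variable {N : ℕ} {M : Fin N → ℕ} {S A : Type*} [MeasurableSpace S] [MeasurableSpace A]
  {ν : Measure A} [SigmaFinite ν]

/-- The expectation of `g(s, a)` over the joint action `a` in state `s`. -/
def actionAvg (π : PolicyFamily M S A ν) (b : Fin N → Params M) (g : S × (Fin N → A) → ℝ)
    (s : S) : ℝ :=
  ∫ a, g (s, a) ∂π.joint b s

/-- The discounted sum of expected values of `f` along the state-action chain, as a function of the
initial state-action pair. -/
def qFn (G : MarkovGame N S A) (π : PolicyFamily M S A ν) (b : Fin N → Params M)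
    (f : S × (Fin N → A) → ℝ) (z : S × (Fin N → A)) : ℝ :=
  ∑' k : ℕ, G.γ ^ k * ∫ x, f x ∂iterKernel (stepKernel G π b) k z

/-- The discounted sum of expected values of `f` along the state-action chain. -/
def discVal (G : MarkovGame N S A) (π : PolicyFamily M S A ν) (b : Fin N → Params M)
    (f : S × (Fin N → A) → ℝ) : ℝ :=
  ∑' k : ℕ, G.γ ^ k * ∫ x, f x ∂stateActionLaw G π b k

/-- The integral against the (unnormalized) discounted state occupancy measure. -/
def occ (G : MarkovGame N S A) (π : PolicyFamily M S A ν) (b : Fin N → Params M)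
    (F : S → ℝ) : ℝ :=
  ∑' k : ℕ, G.γ ^ k * ∫ s, F s ∂stateLaw G π b k

variable {G : MarkovGame N S A} {π : PolicyFamily M S A ν} {b b' : Fin N → Params M}
  {f : S × (Fin N → A) → ℝ} {c : ℝ}

lemma BddMeas.actionAvg (hf : BddMeas f c) : BddMeas (actionAvg π b f) c where
  meas := (StronglyMeasurable.integral_kernel_prod_right'
    hf.meas.stronglyMeasurable).measurable
  bound s := (hf.comp (measurable_prodMk_left (x := s))).abs_integral_le _

lemma BddMeas.integral_stateActionLaw (hf : BddMeas f c) (k : ℕ) :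
    ∫ x, f x ∂stateActionLaw G π b k = ∫ s, MarkovPG.actionAvg π b f s ∂stateLaw G π b k :=
  hf.integral_compProd _ _

lemma BddMeas.qFn (hf : BddMeas f c) : BddMeas (qFn G π b f) ((1 - G.γ)⁻¹ * c) :=
  BddMeas.tsum_discounted G.γ_pos.le G.γ_lt_one fun _ => hf.integral_kernel _

lemma BddMeas.stepKernel_integral (hf : BddMeas f c) (z : S × (Fin N → A)) :
    ∫ x, f x ∂stepKernel G π b z = ∫ s, MarkovPG.actionAvg π b f s ∂G.P z := by
  unfold stepKernel
  rw [ProbabilityTheory.integral_compProd (hf.integrable _)]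
  rfl

/-- Bellman equation: the zeroth iterate is the identity and contributes `f z`; in the other terms
one factor `γ` and the first step of the chain are split off. -/
lemma BddMeas.qFn_eq (hf : BddMeas f c) (z : S × (Fin N → A)) :
    MarkovPG.qFn G π b f z = f z + G.γ * ∫ x, MarkovPG.qFn G π b f x ∂stepKernel G π b z := by
  have hk : ∀ k, BddMeas (fun z => ∫ x, f x ∂iterKernel (stepKernel G π b) k z) c := fun k =>
    hf.integral_kernel _
  have hint := integral_tsum_discounted G.γ_pos.le G.γ_lt_one hk (stepKernel G π b z)
  have hs := summable_discounted G.γ_pos.le G.γ_lt_one fun k => (hk k).bound z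
  unfold MarkovPG.qFn
  rw [hint, hs.tsum_eq_zero_add, ← tsum_mul_left]
  congr 1
  · rw [pow_zero, one_mul, iterKernel, Kernel.id_apply, integral_dirac' _ _
      hf.meas.stronglyMeasurable]
  · refine tsum_congr fun k => ?_
    rw [iterKernel_succ', pow_succ, ← mul_assoc, mul_comm (G.γ ^ k) G.γ]
    congr 1
    have := hf.integral_comp (iterKernel (stepKernel G π b) k) (stepKernel G π b z)
    rw [← this, Kernel.comp_apply]

lemma BddMeas.discVal_eq (hf : BddMeas f c) :
    discVal G π b f = ∫ s, MarkovPG.actionAvg π b (MarkovPG.qFn G π b f) s ∂G.ρ := by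
  have hk : ∀ k, BddMeas (fun z => ∫ x, f x ∂iterKernel (stepKernel G π b) k z) c := fun k =>
    hf.integral_kernel _
  have h1 := hf.qFn (G := G) (π := π) (b := b) |>.integral_stateActionLaw (G := G) (π := π)
    (b := b) 0
  have h2 := integral_tsum_discounted G.γ_pos.le G.γ_lt_one hk (stateActionLaw G π b 0)
  have h3 : ∫ x, MarkovPG.qFn G π b f x ∂stateActionLaw G π b 0 = discVal G π b f := by
    unfold MarkovPG.qFn discVal
    rw [h2]
    refine tsum_congr fun k => ?_
    rw [stateActionLaw_eq_comp G π b k, hf.integral_comp]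
  rw [← h3, h1]
  rfl

lemma BddMeas.abs_occ_le {F : S → ℝ} (hF : BddMeas F c) :
    |occ G π b F| ≤ (1 - G.γ)⁻¹ * c :=
  abs_tsum_discounted_le G.γ_pos.le G.γ_lt_one fun _ => hF.abs_integral_le _

lemma BddMeas.occ_sub {F F' : S → ℝ} {c' : ℝ} (hF : BddMeas F c) (hF' : BddMeas F' c') :
    occ G π b (fun s => F s - F' s) = occ G π b F - occ G π b F' := by
  unfold occ
  rw [← (summable_discounted G.γ_pos.le G.γ_lt_one fun k => hF.abs_integral_le _).tsum_sub
    (summable_discounted G.γ_pos.le G.γ_lt_one fun k => hF'.abs_integral_le _)]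
  refine tsum_congr fun k => ?_
  rw [integral_sub (hF.integrable _) (hF'.integrable _), mul_sub]

lemma BddMeas.occ_add {F F' : S → ℝ} {c' : ℝ} (hF : BddMeas F c) (hF' : BddMeas F' c') :
    occ G π b (fun s => F s + F' s) = occ G π b F + occ G π b F' := by
  unfold occ
  rw [← (summable_discounted G.γ_pos.le G.γ_lt_one fun k => hF.abs_integral_le _).tsum_add
    (summable_discounted G.γ_pos.le G.γ_lt_one fun k => hF'.abs_integral_le _)]
  refine tsum_congr fun k => ?_
  rw [integral_add (hF.integrable _) (hF'.integrable _), mul_add]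

lemma occ_const_mul {F : S → ℝ} (d : ℝ) :
    occ G π b (fun s => d * F s) = d * occ G π b F := by
  unfold occ
  rw [← tsum_mul_left]
  refine tsum_congr fun k => ?_
  rw [integral_const_mul]
  ring

lemma BddMeas.occ_eq_discVal {F : S → ℝ} (hF : BddMeas F c) :
    occ G π b F = discVal G π b (fun z => F z.1) := by
  unfold occ discVal
  refine tsum_congr fun k => ?_
  rw [(hF.comp measurable_fst).integral_stateActionLaw]
  simp [MarkovPG.actionAvg]

/-- The performance difference lemma. -/
lemma BddMeas.discVal_sub (hf : BddMeas f c) :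
    discVal G π b f - discVal G π b' f =
      occ G π b (fun s => MarkovPG.actionAvg π b (MarkovPG.qFn G π b' f) s
        - MarkovPG.actionAvg π b' (MarkovPG.qFn G π b' f) s) := by
  have hW := hf.qFn (G := G) (π := π) (b := b')
  set W := MarkovPG.qFn G π b' f with hWdef
  set d := (1 - G.γ)⁻¹ * c
  have hA : BddMeas (MarkovPG.actionAvg π b W) d := hW.actionAvg
  have hB : BddMeas (MarkovPG.actionAvg π b' W) d := hW.actionAvg
  rw [hA.occ_sub hB]
  -- The Bellman equation for `b'` rewrites `f`, which is then averaged along the chain of `b`. The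
  -- subtracted term sits one time step later and carries the factor `γ`, so the discounted sum
  -- telescopes.
  have hBel : ∀ k, ∫ x, f x ∂stateActionLaw G π b k =
      (∫ s, MarkovPG.actionAvg π b W s ∂stateLaw G π b k) -
        G.γ * ∫ s, MarkovPG.actionAvg π b' W s ∂stateLaw G π b (k + 1) := by
    intro k
    have h1 : ∀ z, f z = W z - G.γ * ∫ s, MarkovPG.actionAvg π b' W s ∂G.P z := by
      intro z
      rw [← hW.stepKernel_integral (b := b'), hWdef, hf.qFn_eq (G := G) (π := π) (b := b') z]
      ring
    have h2 : BddMeas (fun z => ∫ s, MarkovPG.actionAvg π b' W s ∂G.P z) d :=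
      hB.integral_kernel G.P
    simp_rw [h1]
    rw [integral_sub (hW.integrable _) ((h2.integrable _).const_mul _), integral_const_mul,
      hW.integral_stateActionLaw, stateLaw, hB.integral_comp]
    rfl
  have hsA := summable_discounted G.γ_pos.le G.γ_lt_one fun k =>
    hA.abs_integral_le (stateLaw G π b k)
  have hsB := summable_discounted G.γ_pos.le G.γ_lt_one fun k =>
    hB.abs_integral_le (stateLaw G π b k)
  -- At time zero the state law is `ρ` for every policy, so the first term is the value of `b'`.
  have hB0 : occ G π b (MarkovPG.actionAvg π b' W) = discVal G π b' f +
      ∑' k, G.γ ^ k * (G.γ * ∫ s, MarkovPG.actionAvg π b' W s ∂stateLaw G π b (k + 1)) := by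
    rw [hf.discVal_eq, occ, hsB.tsum_eq_zero_add, pow_zero, one_mul]
    congr 1
    refine tsum_congr fun k => ?_
    rw [pow_succ, mul_assoc]
  have hsB' : Summable fun k => G.γ ^ k *
      (G.γ * ∫ s, MarkovPG.actionAvg π b' W s ∂stateLaw G π b (k + 1)) := by
    refine ((summable_nat_add_iff 1).2 hsB).congr fun k => ?_
    rw [pow_succ, mul_assoc]
  rw [hB0]
  have : discVal G π b f = occ G π b (MarkovPG.actionAvg π b W) -
      ∑' k, G.γ ^ k * (G.γ * ∫ s, MarkovPG.actionAvg π b' W s ∂stateLaw G π b (k + 1)) := by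
    unfold discVal occ
    rw [← hsA.tsum_sub hsB']
    refine tsum_congr fun k => ?_
    rw [hBel k, mul_sub]
  rw [this]
  ring

variable {B V Λ : ℝ}

lemma PolicyFamily.integrable_jointReal_mul (π : PolicyFamily M S A ν) (b : Fin N → Params M) (s : S)
    (hf : BddMeas f c) : Integrable (fun a => π.jointReal b s a * f (s, a))
      (Measure.pi fun _ : Fin N => ν) := by
  have h1 : Integrable (fun a => f (s, a)) (π.joint b s) :=
    (hf.comp (measurable_prodMk_left (x := s))).integrable _
  rw [π.joint_apply, integrable_withDensity_iff_integrable_smul'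
    (π.measurable_jointReal_right b s).ennreal_ofReal (by simp)] at h1
  refine h1.congr (Eventually.of_forall fun a => ?_)
  simp [ENNReal.toReal_ofReal (π.jointReal_pos b s a).le]

lemma ScoreBounds.abs_actionAvg_sub_le (h : ScoreBounds π B V Λ) (hB : 0 ≤ B) (hΛ : 0 ≤ Λ)
    (hf : BddMeas f c) (hc : 0 ≤ c) (s : S) :
    |actionAvg π b f s - actionAvg π b' f s| ≤ N ^ 2 * B * beliefDist b b' * c := by
  have he := beliefDist_nonneg b b'
  have h1 : actionAvg π b f s - actionAvg π b' f s =
      ∫ a, (π.jointReal b s a - π.jointReal b' s a) * f (s, a)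
        ∂(Measure.pi fun _ : Fin N => ν) := by
    unfold actionAvg
    rw [π.integral_joint, π.integral_joint, ← integral_sub
      (π.integrable_jointReal_mul b s hf) (π.integrable_jointReal_mul b' s hf)]
    simp_rw [sub_mul]
  rw [h1]
  exact abs_integral_le_of_lintegral_le (by positivity) hc (fun a => hf.bound (s, a))
    (h.lintegral_jointReal_sub_le hB hΛ b b' s)

lemma ScoreBounds.abs_discVal_sub_le (h : ScoreBounds π B V Λ) (hB : 0 ≤ B) (hΛ : 0 ≤ Λ)
    (hf : BddMeas f c) (hc : 0 ≤ c) :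
    |discVal G π b f - discVal G π b' f| ≤
      (1 - G.γ)⁻¹ * (N ^ 2 * B * beliefDist b b' * ((1 - G.γ)⁻¹ * c)) := by
  have hg : 0 ≤ (1 - G.γ)⁻¹ := inv_nonneg.2 (by linarith [G.γ_lt_one])
  have hW := hf.qFn (G := G) (π := π) (b := b')
  rw [hf.discVal_sub]
  have : BddMeas (fun s => actionAvg π b (qFn G π b' f) s - actionAvg π b' (qFn G π b' f) s)
      (N ^ 2 * B * beliefDist b b' * ((1 - G.γ)⁻¹ * c)) :=
    ⟨(hW.actionAvg (π := π) (b := b)).meas.sub (hW.actionAvg (π := π) (b := b')).meas,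
      fun s => h.abs_actionAvg_sub_le hB hΛ hW (by positivity) s⟩
  exact this.abs_occ_le

/-- The occupancy integral is itself the discounted value of a reward that ignores the actions, so
the sensitivity of values applies. -/
lemma ScoreBounds.abs_occ_sub_le (h : ScoreBounds π B V Λ) (hB : 0 ≤ B) (hΛ : 0 ≤ Λ)
    {F : S → ℝ} (hF : BddMeas F c) (hc : 0 ≤ c) :
    |occ G π b F - occ G π b' F| ≤
      (1 - G.γ)⁻¹ * (N ^ 2 * B * beliefDist b b' * ((1 - G.γ)⁻¹ * c)) := by
  rw [hF.occ_eq_discVal, hF.occ_eq_discVal]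
  exact h.abs_discVal_sub_le hB hΛ (hF.comp measurable_fst) hc

/-- Contraction argument: subtracting the two Bellman equations shows that the supremum distance
`D`, finite because both functions are bounded, satisfies `D ≤ γ D + X`, where `X` bounds the effect
of changing the policy in one action average. -/
lemma ScoreBounds.abs_qFn_sub_le (h : ScoreBounds π B V Λ) (hB : 0 ≤ B) (hΛ : 0 ≤ Λ)
    (hf : BddMeas f c) (hc : 0 ≤ c) (z : S × (Fin N → A)) :
    |qFn G π b f z - qFn G π b' f z| ≤
      (1 - G.γ)⁻¹ * (N ^ 2 * B * beliefDist b b' * ((1 - G.γ)⁻¹ * c)) := by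
  have hγ1 : 0 < 1 - G.γ := by linarith [G.γ_lt_one]
  have hg : 0 ≤ (1 - G.γ)⁻¹ := inv_nonneg.2 hγ1.le
  have he := beliefDist_nonneg b b'
  have hW := hf.qFn (G := G) (π := π) (b := b)
  have hW' := hf.qFn (G := G) (π := π) (b := b')
  set X := N ^ 2 * B * beliefDist b b' * ((1 - G.γ)⁻¹ * c) with hX
  have hX0 : 0 ≤ X := by positivity
  have hd := hW.sub hW'
  have hbdd : BddAbove (Set.range fun z => |qFn G π b f z - qFn G π b' f z|) :=
    ⟨_, by rintro _ ⟨z, rfl⟩; exact hd.bound z⟩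
  set D := ⨆ z, |qFn G π b f z - qFn G π b' f z| with hD
  have hle : ∀ z, |qFn G π b f z - qFn G π b' f z| ≤ D := fun z => le_ciSup hbdd z
  have hstep : ∀ z, |qFn G π b f z - qFn G π b' f z| ≤ G.γ * D + X := by
    intro z
    -- Inserting the `b`-average of the Q-function of `b'` separates the change of the Q-function
    -- from the change of the policy.
    have e1 : qFn G π b f z - qFn G π b' f z =
        G.γ * ((∫ x, (qFn G π b f x - qFn G π b' f x) ∂stepKernel G π b z) +
          ∫ s, (actionAvg π b (qFn G π b' f) s - actionAvg π b' (qFn G π b' f) s) ∂G.P z) := by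
      rw [hf.qFn_eq z, hf.qFn_eq (b := b') z,
        integral_sub (hW.integrable _) (hW'.integrable _),
        integral_sub ((hW'.actionAvg).integrable _) ((hW'.actionAvg).integrable _),
        ← hW'.stepKernel_integral, ← hW'.stepKernel_integral]
      ring
    have b1 : |∫ x, (qFn G π b f x - qFn G π b' f x) ∂stepKernel G π b z| ≤ D :=
      BddMeas.abs_integral_le ⟨hd.meas, hle⟩ _
    have b2 : |∫ s, (actionAvg π b (qFn G π b' f) s - actionAvg π b' (qFn G π b' f) s) ∂G.P z|
        ≤ X :=
      BddMeas.abs_integral_le ⟨(hW'.actionAvg (π := π) (b := b)).meas.sub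
        (hW'.actionAvg (π := π) (b := b')).meas,
        fun s => h.abs_actionAvg_sub_le hB hΛ hW' (by positivity) s⟩ _
    rw [e1, abs_mul, abs_of_pos G.γ_pos]
    calc _ ≤ G.γ * (D + X) := by
          refine mul_le_mul_of_nonneg_left ?_ G.γ_pos.le
          exact (abs_add_le _ _).trans (add_le_add b1 b2)
      _ ≤ _ := by
          have := mul_le_of_le_one_left hX0 G.γ_lt_one.le
          linarith
  have hne : Nonempty (S × (Fin N → A)) := ⟨z⟩
  have hDle : D ≤ G.γ * D + X := ciSup_le hstep
  refine (hle z).trans ?_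
  rw [inv_mul_eq_div, le_div_iff₀ hγ1]
  linarith

lemma utility_eq_discVal {R : ℝ} (hr : BoundedRewards G R) (i : Fin N) (θ : Params M) :
    utility G π i θ = discVal G π (fun _ => θ) (G.r i) := by
  have hrb : BddMeas (G.r i) R := ⟨G.measurable_r i, hr i⟩
  have hk : ∀ k, BddMeas (fun x : Path N S A => G.r i (x k)) R := fun k =>
    hrb.comp (measurable_pi_apply k)
  have hsum := BddMeas.tsum_discounted G.γ_pos.le G.γ_lt_one hk
  have h1 := integral_tsum_discounted G.γ_pos.le G.γ_lt_one hk (pathLaw G π fun _ => θ)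
  have h2 : utility G π i θ = ∫ x, ∑' k : ℕ, G.γ ^ k * G.r i (x k) ∂pathLaw G π fun _ => θ := by
    unfold utility valueFn pathLaw
    rw [hsum.integral_comp]
  rw [h2, h1, discVal]
  refine tsum_congr fun k => ?_
  rw [← map_eval_pathLaw, integral_map (measurable_pi_apply k).aemeasurable hrb.meas.aestronglyMeasurable]

end Values

/-! ### Policy gradients -/

section Gradients

variable {N : ℕ} {M : Fin N → ℕ} {S A : Type*} [MeasurableSpace S] [MeasurableSpace A]
  {ν : Measure A} [SigmaFinite ν]

/-- The expectation, under the joint policy with parameters `b`, of `g` times the directional score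
at `θ` in the direction `v`. -/
def scoreAvg (π : PolicyFamily M S A ν) (b : Fin N → Params M) (θ v : Params M)
    (g : S × (Fin N → A) → ℝ) (s : S) : ℝ :=
  ∫ a, π.dirScore (fun _ => θ) (fun _ => v) s a * g (s, a) ∂π.joint b s

variable {G : MarkovGame N S A} {π : PolicyFamily M S A ν} {b : Fin N → Params M}
  {θ θ' v : Params M} {f g : S × (Fin N → A) → ℝ} {c B V Λ : ℝ}

lemma beliefDist_const (θ θ' : Params M) :
    beliefDist (fun _ => θ) (fun _ => θ') = N * ‖θ - θ'‖ := by
  simp [beliefDist]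

lemma ScoreBounds.lintegral_dirScore_le (h : ScoreBounds π B V Λ) (hB : 0 ≤ B) (hΛ : 0 ≤ Λ)
    (b : Fin N → Params M) (θ v : Params M) (s : S) :
    ∫⁻ a, ‖π.dirScore (fun _ => θ) (fun _ => v) s a‖ₑ ∂π.joint b s ≤
      ENNReal.ofReal (‖v‖ * (N ^ 2 * B + N * Λ * beliefDist b (fun _ => θ))) := by
  have he := beliefDist_nonneg b (fun _ => θ)
  refine (h.lintegral_joint_le hB b s _ (c₀ := ‖v‖ * (N * Λ * beliefDist b (fun _ => θ)))
    (c₁ := ‖v‖) (c₂ := 0) (by positivity) (norm_nonneg _) le_rfl fun a => ?_).trans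
      (ENNReal.ofReal_le_ofReal (le_of_eq (by ring)))
  refine (h.abs_dirScore_const_le b θ v s a).trans (le_of_eq (by ring))

lemma ScoreBounds.integrable_dirScore_mul (h : ScoreBounds π B V Λ) (hB : 0 ≤ B) (hΛ : 0 ≤ Λ)
    (b : Fin N → Params M) (θ v : Params M) (hg : BddMeas g c) (s : S) :
    Integrable (fun a => π.dirScore (fun _ => θ) (fun _ => v) s a * g (s, a)) (π.joint b s) := by
  have h1 : Integrable (fun a => π.dirScore (fun _ => θ) (fun _ => v) s a) (π.joint b s) :=
    ⟨(π.measurable_dirScore_right _ _ s).aestronglyMeasurable,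
      (h.lintegral_dirScore_le hB hΛ b θ v s).trans_lt ENNReal.ofReal_lt_top⟩
  exact h1.mul_bdd (c := c) ((hg.meas.comp (measurable_prodMk_left (x := s))).aestronglyMeasurable)
    (Eventually.of_forall fun a => hg.bound (s, a))

lemma measurable_scoreAvg (π : PolicyFamily M S A ν) (b : Fin N → Params M) (θ v : Params M)
    (hg : Measurable g) : Measurable (scoreAvg π b θ v g) := by
  have h : Measurable fun z : S × (Fin N → A) =>
      π.dirScore (fun _ => θ) (fun _ => v) z.1 z.2 * g z :=
    (π.measurable_dirScore (fun _ => θ) (fun _ => v)).mul hg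
  exact (StronglyMeasurable.integral_kernel_prod_right' (κ := π.joint b)
    h.stronglyMeasurable).measurable

lemma ScoreBounds.bddMeas_scoreAvg (h : ScoreBounds π B V Λ) (hB : 0 ≤ B) (hΛ : 0 ≤ Λ)
    (b : Fin N → Params M) (θ v : Params M) (hg : BddMeas g c) (hc : 0 ≤ c) :
    BddMeas (scoreAvg π b θ v g)
      (‖v‖ * (N ^ 2 * B + N * Λ * beliefDist b (fun _ => θ)) * c) where
  meas := measurable_scoreAvg π b θ v hg.meas
  bound s := by
    have he := beliefDist_nonneg b (fun _ => θ)
    exact abs_integral_le_of_lintegral_le (by positivity) hc (fun a => hg.bound (s, a))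
      (h.lintegral_dirScore_le hB hΛ b θ v s)

lemma ScoreBounds.bddMeas_scoreAvg_const (h : ScoreBounds π B V Λ) (hB : 0 ≤ B) (hΛ : 0 ≤ Λ)
    (θ v : Params M) (hg : BddMeas g c) (hc : 0 ≤ c) :
    BddMeas (scoreAvg π (fun _ => θ) θ v g) (‖v‖ * (N ^ 2 * B) * c) := by
  have := h.bddMeas_scoreAvg hB hΛ (fun _ => θ) θ v hg hc
  simpa [beliefDist_const] using this

lemma ScoreBounds.scoreAvg_sub (h : ScoreBounds π B V Λ) (hB : 0 ≤ B) (hΛ : 0 ≤ Λ)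
    (b : Fin N → Params M) (θ v : Params M) (hf : BddMeas f c) {c' : ℝ} (hg : BddMeas g c')
    (s : S) :
    scoreAvg π b θ v (fun z => f z - g z) s = scoreAvg π b θ v f s - scoreAvg π b θ v g s := by
  unfold scoreAvg
  rw [← integral_sub (h.integrable_dirScore_mul hB hΛ b θ v hf s)
    (h.integrable_dirScore_mul hB hΛ b θ v hg s)]
  simp_rw [mul_sub]

lemma ScoreBounds.scoreAvg_add_dir (h : ScoreBounds π B V Λ) (hB : 0 ≤ B) (hΛ : 0 ≤ Λ)
    (b : Fin N → Params M) (θ v w : Params M) (hg : BddMeas g c) (s : S) :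
    scoreAvg π b θ (v + w) g s = scoreAvg π b θ v g s + scoreAvg π b θ w g s := by
  unfold scoreAvg
  rw [← integral_add (h.integrable_dirScore_mul hB hΛ b θ v hg s)
    (h.integrable_dirScore_mul hB hΛ b θ w hg s)]
  refine integral_congr_ae (Eventually.of_forall fun a => ?_)
  have := π.dirScore_add (fun _ => θ) (fun _ => v) (fun _ => w) s a
  have h2 : (fun _ : Fin N => v + w) = (fun _ => v) + (fun _ => w) := rfl
  simp only [h2, this, add_mul]

lemma scoreAvg_smul_dir (π : PolicyFamily M S A ν) (b : Fin N → Params M) (θ v : Params M) (d : ℝ)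
    (s : S) :
    scoreAvg π b θ (d • v) g s = d * scoreAvg π b θ v g s := by
  unfold scoreAvg
  rw [← integral_const_mul]
  refine integral_congr_ae (Eventually.of_forall fun a => ?_)
  have := π.dirScore_smul (fun _ => θ) (fun _ => v) d s a
  have h2 : (fun _ : Fin N => d • v) = d • (fun _ : Fin N => v) := rfl
  simp only [h2, this, mul_assoc]

lemma ScoreBounds.abs_scoreAvg_sub_score_le (h : ScoreBounds π B V Λ) (hB : 0 ≤ B) (hΛ : 0 ≤ Λ)
    (b : Fin N → Params M) (θ θ' v : Params M) (hg : BddMeas g c) (hc : 0 ≤ c) (s : S) :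
    |scoreAvg π b θ' v g s - scoreAvg π b θ v g s| ≤ N ^ 2 * Λ * ‖θ' - θ‖ * ‖v‖ * c := by
  unfold scoreAvg
  rw [← integral_sub (h.integrable_dirScore_mul hB hΛ b θ' v hg s)
    (h.integrable_dirScore_mul hB hΛ b θ v hg s)]
  simp_rw [← sub_mul]
  refine abs_integral_le_of_lintegral_le (by positivity) hc (fun a => hg.bound (s, a)) ?_
  have := h.lintegral_joint_le hB b s (fun a => π.dirScore (fun _ => θ') (fun _ => v) s a -
    π.dirScore (fun _ => θ) (fun _ => v) s a) (c₀ := N ^ 2 * Λ * ‖θ' - θ‖ * ‖v‖) (c₁ := 0)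
    (c₂ := 0) (by positivity) le_rfl le_rfl fun a => by
      refine (h.abs_dirScore_sub_le (fun _ => θ') (fun _ => θ) (fun _ => v) s a (c := ‖v‖)
        fun _ => le_rfl).trans (le_of_eq ?_)
      simp only [Finset.sum_const, Finset.card_univ, Fintype.card_fin, nsmul_eq_mul]
      ring
  simpa using this

/-- Only the policy generating the actions changes, while the integrand contains an unbounded score;
the score-weighted L¹ estimate of the densities is what this requires. -/
lemma ScoreBounds.abs_scoreAvg_sub_policy_le (h : ScoreBounds π B V Λ) (hB : 0 ≤ B) (hΛ : 0 ≤ Λ)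
    (b : Fin N → Params M) (θ v : Params M) (hg : BddMeas g c) (hc : 0 ≤ c) (s : S) :
    |scoreAvg π b θ v g s - scoreAvg π (fun _ => θ) θ v g s| ≤
      policyLip N B V Λ * beliefDist b (fun _ => θ) * ‖v‖ * c := by
  have he := beliefDist_nonneg b (fun _ => θ)
  have hL := policyLip_nonneg (N := N) (V := V) hB hΛ
  have hint : ∀ b' : Fin N → Params M, Integrable (fun a => π.jointReal b' s a *
      (π.dirScore (fun _ => θ) (fun _ => v) s a * g (s, a))) (Measure.pi fun _ : Fin N => ν) := by
    intro b'
    have h1 := h.integrable_dirScore_mul hB hΛ b' θ v hg s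
    rw [π.joint_apply, integrable_withDensity_iff_integrable_smul'
      (π.measurable_jointReal_right b' s).ennreal_ofReal (by simp)] at h1
    refine h1.congr (Eventually.of_forall fun a => ?_)
    simp [ENNReal.toReal_ofReal (π.jointReal_pos b' s a).le]
  unfold scoreAvg
  rw [π.integral_joint, π.integral_joint, ← integral_sub (hint _) (hint _)]
  simp_rw [← sub_mul, ← mul_assoc]
  refine abs_integral_le_of_lintegral_le (by positivity) hc (fun a => hg.bound (s, a)) ?_
  calc ∫⁻ a, ‖(π.jointReal b s a - π.jointReal (fun _ => θ) s a) *
        π.dirScore (fun _ => θ) (fun _ => v) s a‖ₑ ∂(Measure.pi fun _ : Fin N => ν)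
      ≤ ∫⁻ a, (‖π.jointReal b s a - π.jointReal (fun _ => θ) s a‖ₑ *
        ENNReal.ofReal (π.scoreSum (fun _ => θ) s a)) * ENNReal.ofReal ‖v‖
          ∂(Measure.pi fun _ : Fin N => ν) := by
        refine lintegral_mono fun a => ?_
        rw [enorm_mul, mul_assoc]
        gcongr
        rw [← ENNReal.ofReal_mul (π.scoreSum_nonneg _ s a), Real.enorm_eq_ofReal_abs, mul_comm]
        exact ENNReal.ofReal_le_ofReal
          (π.abs_dirScore_le (fun _ => θ) (fun _ => v) s a fun _ => le_rfl)
    _ = (∫⁻ a, (‖π.jointReal b s a - π.jointReal (fun _ => θ) s a‖ₑ *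
        ENNReal.ofReal (π.scoreSum (fun _ => θ) s a))
          ∂(Measure.pi fun _ : Fin N => ν)) * ENNReal.ofReal ‖v‖ :=
        lintegral_mul_const' _ _ ENNReal.ofReal_ne_top
    _ ≤ ENNReal.ofReal (policyLip N B V Λ * beliefDist b (fun _ => θ)) * ENNReal.ofReal ‖v‖ := by
        gcongr
        exact h.lintegral_jointReal_sub_mul_scoreSum_le hB hΛ b (fun _ => θ) s
    _ = _ := by rw [← ENNReal.ofReal_mul (by positivity)]

/-- First-order expansion of the expectation of a bounded function under the joint policy. -/
lemma ScoreBounds.abs_actionAvg_taylor_le (h : ScoreBounds π B V Λ) (hB : 0 ≤ B) (hΛ : 0 ≤ Λ)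
    (θ₁ θ : Params M) (hg : BddMeas g c) (hc : 0 ≤ c) (s : S) :
    |actionAvg π (fun _ => θ₁) g s - actionAvg π (fun _ => θ) g s
      - scoreAvg π (fun _ => θ) θ (θ₁ - θ) g s| ≤
      (policyLip N B V Λ + N * Λ) * (N * ‖θ₁ - θ‖) ^ 2 * c := by
  have hL := policyLip_nonneg (N := N) (V := V) hB hΛ
  have hint : Integrable (fun a => π.jointReal (fun _ => θ) s a *
      (π.dirScore (fun _ => θ) (fun _ => θ₁ - θ) s a * g (s, a)))
        (Measure.pi fun _ : Fin N => ν) := by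
    have h1 := h.integrable_dirScore_mul hB hΛ (fun _ => θ) θ (θ₁ - θ) hg s
    rw [π.joint_apply, integrable_withDensity_iff_integrable_smul'
      (π.measurable_jointReal_right (fun _ => θ) s).ennreal_ofReal (by simp)] at h1
    refine h1.congr (Eventually.of_forall fun a => ?_)
    simp [ENNReal.toReal_ofReal (π.jointReal_pos (fun _ => θ) s a).le]
  have i1 := π.integrable_jointReal_mul (fun _ => θ₁) s hg
  have i2 := π.integrable_jointReal_mul (fun _ => θ) s hg
  have i3 : Integrable (fun a => π.jointReal (fun _ => θ₁) s a * g (s, a) -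
      π.jointReal (fun _ => θ) s a * g (s, a)) (Measure.pi fun _ : Fin N => ν) := i1.sub i2
  unfold actionAvg scoreAvg
  rw [π.integral_joint, π.integral_joint, π.integral_joint, ← integral_sub i1 i2,
    ← integral_sub i3 hint]
  simp_rw [← mul_assoc, ← sub_mul]
  refine abs_integral_le_of_lintegral_le (by positivity) hc (fun a => hg.bound (s, a)) ?_
  have := h.lintegral_jointReal_taylor_le hB hΛ (fun _ => θ₁) (fun _ => θ) s
  rw [beliefDist_const] at this
  exact this

/-- Scores have zero mean. -/
lemma ScoreBounds.integral_dirScore_eq_zero (h : ScoreBounds π B V Λ) (hB : 0 ≤ B) (hΛ : 0 ≤ Λ)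
    (θ v : Params M) (s : S) :
    ∫ a, π.dirScore (fun _ => θ) (fun _ => v) s a ∂π.joint (fun _ => θ) s = 0 := by
  have hL := policyLip_nonneg (N := N) (V := V) hB hΛ
  have hone : BddMeas (fun _ : S × (Fin N → A) => (1 : ℝ)) 1 := ⟨measurable_const, by simp⟩
  set I := ∫ a, π.dirScore (fun _ => θ) (fun _ => v) s a ∂π.joint (fun _ => θ) s with hI
  set K := (policyLip N B V Λ + N * Λ) * (N * ‖v‖) ^ 2 with hK
  -- The first-order expansion is applied to the constant function one, whose action averages agree
  -- for all parameters. It leaves `t * |I| ≤ t² K`, and `t → 0` concludes.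
  have key : ∀ t : ℝ, 0 < t → |I| ≤ t * K := by
    intro t ht
    have h1 := h.abs_actionAvg_taylor_le hB hΛ (θ + t • v) θ hone zero_le_one s
    rw [add_sub_cancel_left, scoreAvg_smul_dir] at h1
    have h2 : scoreAvg π (fun _ => θ) θ v (fun _ => (1 : ℝ)) s = I := by
      simp [scoreAvg, hI]
    simp only [actionAvg, integral_const, probReal_univ, smul_eq_mul, mul_one, sub_self,
      zero_sub, h2, abs_neg, abs_mul, abs_of_pos ht, norm_smul, Real.norm_eq_abs] at h1
    have : t * |I| ≤ t * (t * K) := by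
      rw [hK]
      calc _ ≤ _ := h1
        _ = _ := by ring
    exact le_of_mul_le_mul_left this ht
  have hlim : Tendsto (fun t : ℝ => t * K) (𝓝[>] 0) (𝓝 0) := by
    have : Tendsto (fun t : ℝ => t * K) (𝓝 0) (𝓝 (0 * K)) :=
      (continuous_id.mul continuous_const).tendsto 0
    rw [zero_mul] at this
    exact this.mono_left nhdsWithin_le_nhds
  have : |I| ≤ 0 := ge_of_tendsto hlim (eventually_nhdsWithin_of_forall fun t ht => key t ht)
  exact abs_nonpos_iff.1 this

/-- Baselines that depend on the state only have a small effect. -/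
lemma ScoreBounds.abs_scoreAvg_baseline_le (h : ScoreBounds π B V Λ) (hB : 0 ≤ B) (hΛ : 0 ≤ Λ)
    (b : Fin N → Params M) (θ θ' v : Params M) {φ : S → ℝ} (hφ : BddMeas φ c) (hc : 0 ≤ c)
    (s : S) :
    |scoreAvg π b θ' v (fun z => φ z.1) s| ≤
      (N ^ 2 * Λ * ‖θ' - θ‖ + policyLip N B V Λ * beliefDist b (fun _ => θ)) * ‖v‖ * c := by
  have hg : BddMeas (fun z : S × (Fin N → A) => φ z.1) c := hφ.comp measurable_fst
  have h1 := h.abs_scoreAvg_sub_score_le hB hΛ b θ θ' v hg hc s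
  have h2 := h.abs_scoreAvg_sub_policy_le hB hΛ b θ v hg hc s
  -- The baseline is constant in the action, so it factors out of the average and meets a score of
  -- mean zero.
  have h3 : scoreAvg π (fun _ => θ) θ v (fun z => φ z.1) s = 0 := by
    unfold scoreAvg
    simp only
    rw [integral_mul_const, h.integral_dirScore_eq_zero hB hΛ, zero_mul]
  rw [h3, sub_zero] at h2
  have h4 : scoreAvg π b θ' v (fun z => φ z.1) s =
    (scoreAvg π b θ' v (fun z => φ z.1) s - scoreAvg π b θ v (fun z => φ z.1) s) +
      scoreAvg π b θ v (fun z => φ z.1) s := by ring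
  rw [h4]
  refine (abs_add_le _ _).trans ((add_le_add h1 h2).trans (le_of_eq ?_))
  ring

/-- The derivative of the discounted value of `f` at `θ` in the direction `v`. -/
def valueDeriv (G : MarkovGame N S A) (π : PolicyFamily M S A ν) (f : S × (Fin N → A) → ℝ)
    (θ v : Params M) : ℝ :=
  occ G π (fun _ => θ) (scoreAvg π (fun _ => θ) θ v (qFn G π (fun _ => θ) f))

lemma ScoreBounds.abs_valueDeriv_le (h : ScoreBounds π B V Λ) (hB : 0 ≤ B) (hΛ : 0 ≤ Λ)
    (θ v : Params M) (hf : BddMeas f c) (hc : 0 ≤ c) :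
    |valueDeriv G π f θ v| ≤ (1 - G.γ)⁻¹ * (N ^ 2 * B * ((1 - G.γ)⁻¹ * c)) * ‖v‖ := by
  have hg : 0 ≤ (1 - G.γ)⁻¹ := inv_nonneg.2 (by linarith [G.γ_lt_one])
  have hq := hf.qFn (G := G) (π := π) (b := fun _ => θ)
  refine (h.bddMeas_scoreAvg_const hB hΛ θ v hq (by positivity)).abs_occ_le.trans (le_of_eq ?_)
  ring

/-- The derivative of the discounted value as a linear map. -/
def ScoreBounds.valueDerivL (h : ScoreBounds π B V Λ) (hB : 0 ≤ B) (hΛ : 0 ≤ Λ)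
    (G : MarkovGame N S A) (hf : BddMeas f c) (hc : 0 ≤ c) (θ : Params M) :
    Params M →L[ℝ] ℝ :=
  LinearMap.mkContinuous
    { toFun := valueDeriv G π f θ
      map_add' := fun v w => by
        have hg : 0 ≤ (1 - G.γ)⁻¹ := inv_nonneg.2 (by linarith [G.γ_lt_one])
        have hq := hf.qFn (G := G) (π := π) (b := fun _ => θ)
        have hqc : 0 ≤ (1 - G.γ)⁻¹ * c := by positivity
        unfold valueDeriv
        rw [← (h.bddMeas_scoreAvg_const hB hΛ θ v hq hqc).occ_add
          (h.bddMeas_scoreAvg_const hB hΛ θ w hq hqc)]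
        congr 1
        funext s
        exact h.scoreAvg_add_dir hB hΛ _ θ v w hq s
      map_smul' := fun d v => by
        unfold valueDeriv
        rw [RingHom.id_apply, smul_eq_mul, ← occ_const_mul]
        congr 1
        funext s
        exact scoreAvg_smul_dir π _ θ v d s }
    ((1 - G.γ)⁻¹ * (N ^ 2 * B * ((1 - G.γ)⁻¹ * c)))
    (fun v => h.abs_valueDeriv_le hB hΛ θ v hf hc)

/-- The policy gradient theorem. -/
lemma ScoreBounds.hasFDerivAt_discVal (h : ScoreBounds π B V Λ) (hB : 0 ≤ B) (hΛ : 0 ≤ Λ)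
    (hf : BddMeas f c) (hc : 0 ≤ c) (θ : Params M) :
    HasFDerivAt (fun ϑ => discVal G π (fun _ => ϑ) f) (h.valueDerivL hB hΛ G hf hc θ) θ := by
  have hg : 0 ≤ (1 - G.γ)⁻¹ := inv_nonneg.2 (by linarith [G.γ_lt_one])
  have hL := policyLip_nonneg (N := N) (V := V) hB hΛ
  have hq := hf.qFn (G := G) (π := π) (b := fun _ => θ)
  have hqc : 0 ≤ (1 - G.γ)⁻¹ * c := by positivity
  set q := qFn G π (fun _ => θ) f with hqdef
  set cq := (1 - G.γ)⁻¹ * c with hcq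
  -- The first summand comes from the Taylor remainder of the action average. The second comes from
  -- replacing the occupancy at `ϑ` by the one at `θ`, applied to a function that is already of
  -- order `‖ϑ - θ‖`.
  set K : ℝ := (1 - G.γ)⁻¹ * ((policyLip N B V Λ + N * Λ) * N ^ 2 * cq) +
    (1 - G.γ)⁻¹ * (N ^ 2 * B * N * ((1 - G.γ)⁻¹ * (N ^ 2 * B * cq))) with hK
  have key : ∀ ϑ, |discVal G π (fun _ => ϑ) f - discVal G π (fun _ => θ) f -
      valueDeriv G π f θ (ϑ - θ)| ≤ K * ‖ϑ - θ‖ ^ 2 := by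
    intro ϑ
    have hs := h.bddMeas_scoreAvg_const hB hΛ θ (ϑ - θ) hq hqc
    have hH : BddMeas (fun s => actionAvg π (fun _ => ϑ) q s - actionAvg π (fun _ => θ) q s)
        (cq + cq) := (hq.actionAvg).sub hq.actionAvg
    have e1 : |occ G π (fun _ => ϑ) (fun s =>
        actionAvg π (fun _ => ϑ) q s - actionAvg π (fun _ => θ) q s) -
        occ G π (fun _ => ϑ) (scoreAvg π (fun _ => θ) θ (ϑ - θ) q)| ≤
        (1 - G.γ)⁻¹ * ((policyLip N B V Λ + N * Λ) * (N * ‖ϑ - θ‖) ^ 2 * cq) := by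
      rw [← hH.occ_sub hs]
      exact BddMeas.abs_occ_le ⟨hH.meas.sub hs.meas, fun s =>
        h.abs_actionAvg_taylor_le hB hΛ ϑ θ hq hqc s⟩
    have e2 := h.abs_occ_sub_le (G := G) (b := fun _ => ϑ) (b' := fun _ => θ) hB hΛ hs
      (by positivity)
    rw [beliefDist_const] at e2
    rw [hf.discVal_sub, valueDeriv]
    calc _ ≤ (1 - G.γ)⁻¹ * ((policyLip N B V Λ + N * Λ) * (N * ‖ϑ - θ‖) ^ 2 * cq) +
          (1 - G.γ)⁻¹ * (N ^ 2 * B * (N * ‖ϑ - θ‖) *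
            ((1 - G.γ)⁻¹ * (‖ϑ - θ‖ * (N ^ 2 * B) * cq))) := by
          refine le_trans (le_of_eq ?_) ((abs_add_le _ _).trans (add_le_add e1 e2))
          congr 1
          ring
      _ = _ := by rw [hK]; ring
  rw [hasFDerivAt_iff_isLittleO_nhds_zero]
  have hO : (fun v : Params M => discVal G π (fun _ => θ + v) f - discVal G π (fun _ => θ) f -
      (h.valueDerivL hB hΛ G hf hc θ) v) =O[𝓝 0] fun v => ‖v‖ ^ 2 := by
    refine Asymptotics.IsBigO.of_bound K (Eventually.of_forall fun v => ?_)
    have := key (θ + v)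
    rw [add_sub_cancel_left] at this
    rwa [norm_pow, norm_norm]
  refine hO.trans_isLittleO ?_
  have := Asymptotics.isLittleO_norm_pow_id (E' := Params M) (n := 2) (by norm_num)
  exact this

lemma ScoreBounds.inner_blockGrad_utility (h : ScoreBounds π B V Λ) (hB : 0 ≤ B) (hΛ : 0 ≤ Λ)
    {R : ℝ} (hR : 0 ≤ R) (hr : BoundedRewards G R) (i : Fin N) (θ : Params M)
    (x : EuclideanSpace ℝ (Fin (M i))) :
    inner ℝ (blockGrad i (utility G π i) θ) x =
      valueDeriv G π (G.r i) θ (Params.single i x) := by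
  have hrb : BddMeas (G.r i) R := ⟨G.measurable_r i, hr i⟩
  have hu : utility G π i = fun ϑ => discVal G π (fun _ => ϑ) (G.r i) :=
    funext fun ϑ => utility_eq_discVal hr i ϑ
  rw [hu]
  exact inner_blockGrad (h.hasFDerivAt_discVal hB hΛ hrb hR θ) i x

/-- A bound for the policy gradients. -/
def gradBound (N : ℕ) (γ R B : ℝ) : ℝ := (1 - γ)⁻¹ * (N ^ 2 * B * ((1 - γ)⁻¹ * R))

/-- A Lipschitz constant for the policy gradients. -/
def gradLip (N : ℕ) (γ R B V Λ : ℝ) : ℝ :=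
  (1 - γ)⁻¹ * (N ^ 2 * Λ + policyLip N B V Λ + N ^ 2 * B * ((1 - γ)⁻¹ * (N ^ 2 * B)) +
    N ^ 2 * B * ((1 - γ)⁻¹ * (N ^ 2 * B))) * ((1 - γ)⁻¹ * R)

/-- Expected estimates with actions drawn at `b` and scores evaluated at `θ'` are close to the
derivative of the value at `θ`. -/
lemma ScoreBounds.abs_occ_scoreAvg_sub_valueDeriv_le (h : ScoreBounds π B V Λ) (hB : 0 ≤ B)
    (hΛ : 0 ≤ Λ) (hf : BddMeas f c) (hc : 0 ≤ c) (b : Fin N → Params M) (θ θ' v : Params M) :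
    |occ G π b (scoreAvg π b θ' v (qFn G π b f)) - valueDeriv G π f θ v| ≤
      gradLip N G.γ c B V Λ * (‖θ' - θ‖ + beliefDist b (fun _ => θ)) * ‖v‖ := by
  have hg : 0 ≤ (1 - G.γ)⁻¹ := inv_nonneg.2 (by linarith [G.γ_lt_one])
  have hL := policyLip_nonneg (N := N) (V := V) hB hΛ
  have he := beliefDist_nonneg b (fun _ => θ)
  have hq := hf.qFn (G := G) (π := π) (b := fun _ => θ)
  have hqb := hf.qFn (G := G) (π := π) (b := b)
  have hqc : 0 ≤ (1 - G.γ)⁻¹ * c := by positivity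
  set q := qFn G π (fun _ => θ) f with hqdef
  set qb := qFn G π b f with hqbdef
  set cq := (1 - G.γ)⁻¹ * c with hcq
  set e := beliefDist b (fun _ => θ) with hedef
  have s1 := h.bddMeas_scoreAvg hB hΛ b θ' v hqb hqc
  have s2 := h.bddMeas_scoreAvg hB hΛ b θ v hqb hqc
  have s3 := h.bddMeas_scoreAvg_const hB hΛ θ v hqb hqc
  have s4 := h.bddMeas_scoreAvg_const hB hΛ θ v hq hqc
  have hqd : BddMeas (fun z => qb z - q z) ((1 - G.γ)⁻¹ * (N ^ 2 * B * e * cq)) :=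
    ⟨hqb.meas.sub hq.meas, fun z => h.abs_qFn_sub_le hB hΛ hf hc z⟩
  -- One ingredient is changed at a time: in `d1` the parameter of the score, in `d2` the policy of
  -- the action average, in `d3` the Q-function, in `d4` the occupancy. They produce the four
  -- summands of `gradLip`.
  have d1 : |occ G π b (scoreAvg π b θ' v qb) - occ G π b (scoreAvg π b θ v qb)| ≤
      (1 - G.γ)⁻¹ * (N ^ 2 * Λ * ‖θ' - θ‖ * ‖v‖ * cq) := by
    rw [← s1.occ_sub s2]
    exact BddMeas.abs_occ_le ⟨s1.meas.sub s2.meas, fun s =>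
      h.abs_scoreAvg_sub_score_le hB hΛ b θ θ' v hqb hqc s⟩
  have d2 : |occ G π b (scoreAvg π b θ v qb) - occ G π b (scoreAvg π (fun _ => θ) θ v qb)| ≤
      (1 - G.γ)⁻¹ * (policyLip N B V Λ * e * ‖v‖ * cq) := by
    rw [← s2.occ_sub s3]
    exact BddMeas.abs_occ_le ⟨s2.meas.sub s3.meas, fun s =>
      h.abs_scoreAvg_sub_policy_le hB hΛ b θ v hqb hqc s⟩
  have d3 : |occ G π b (scoreAvg π (fun _ => θ) θ v qb) -
      occ G π b (scoreAvg π (fun _ => θ) θ v q)| ≤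
      (1 - G.γ)⁻¹ * (‖v‖ * (N ^ 2 * B) * ((1 - G.γ)⁻¹ * (N ^ 2 * B * e * cq))) := by
    rw [← s3.occ_sub s4]
    have := (h.bddMeas_scoreAvg_const hB hΛ θ v hqd (by positivity)).abs_occ_le
      (G := G) (π := π) (b := b)
    refine le_trans (le_of_eq ?_) this
    congr 2
    funext s
    exact (h.scoreAvg_sub hB hΛ _ θ v hqb hq s).symm
  have d4 := h.abs_occ_sub_le (G := G) (b := b) (b' := fun _ => θ) hB hΛ s4 (by positivity)
  have hsum := (abs_add_le _ _).trans (add_le_add ((abs_add_le _ _).trans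
    (add_le_add ((abs_add_le _ _).trans (add_le_add d1 d2)) d3)) d4)
  unfold valueDeriv
  refine le_trans (le_of_eq ?_) (hsum.trans ?_)
  · congr 1
    ring
  -- `p1` and `p2` are the cross terms by which the product form of the bound exceeds the sum of the
  -- four estimates.
  · have p1 : 0 ≤ (1 - G.γ)⁻¹ * (N ^ 2 * Λ) * cq * ‖v‖ * e := by positivity
    have p2 : 0 ≤ (1 - G.γ)⁻¹ * (policyLip N B V Λ + N ^ 2 * B * ((1 - G.γ)⁻¹ * (N ^ 2 * B)) +
      N ^ 2 * B * ((1 - G.γ)⁻¹ * (N ^ 2 * B))) * cq * ‖v‖ * ‖θ' - θ‖ := by positivity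
    rw [← sub_nonneg]
    refine (add_nonneg p1 p2).trans (le_of_eq ?_)
    rw [gradLip, ← hcq]
    ring

lemma gradLip_nonneg {N : ℕ} {γ R B V Λ : ℝ} (hγ : γ < 1) (hR : 0 ≤ R) (hB : 0 ≤ B)
    (hΛ : 0 ≤ Λ) : 0 ≤ gradLip N γ R B V Λ := by
  have hL := policyLip_nonneg (N := N) (V := V) hB hΛ
  have hg : 0 ≤ (1 - γ)⁻¹ := inv_nonneg.2 (by linarith)
  unfold gradLip
  positivity

lemma gradBound_nonneg {N : ℕ} {γ R B : ℝ} (hγ : γ < 1) (hR : 0 ≤ R) (hB : 0 ≤ B) :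
    0 ≤ gradBound N γ R B := by
  have hg : 0 ≤ (1 - γ)⁻¹ := inv_nonneg.2 (by linarith)
  unfold gradBound
  positivity

lemma norm_le_of_forall_inner_le {E : Type*} [NormedAddCommGroup E] [InnerProductSpace ℝ E]
    {x : E} {C : ℝ} (hC : 0 ≤ C) (h : ∀ y, |inner ℝ x y| ≤ C * ‖y‖) : ‖x‖ ≤ C := by
  have h1 := h x
  rw [real_inner_self_eq_norm_sq, abs_of_nonneg (sq_nonneg _), sq] at h1
  rcases (norm_nonneg x).eq_or_lt with h0 | h0
  · rwa [← h0]
  · exact le_of_mul_le_mul_right h1 h0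

lemma ScoreBounds.norm_blockGrad_utility_le (h : ScoreBounds π B V Λ) (hB : 0 ≤ B) (hΛ : 0 ≤ Λ)
    {R : ℝ} (hR : 0 ≤ R) (hr : BoundedRewards G R) (i : Fin N) (θ : Params M) :
    ‖blockGrad i (utility G π i) θ‖ ≤ gradBound N G.γ R B := by
  have hrb : BddMeas (G.r i) R := ⟨G.measurable_r i, hr i⟩
  refine norm_le_of_forall_inner_le (gradBound_nonneg G.γ_lt_one hR hB) fun x => ?_
  rw [h.inner_blockGrad_utility hB hΛ hR hr]
  simpa [gradBound] using h.abs_valueDeriv_le (G := G) hB hΛ θ (Params.single i x) hrb hR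

/-- A special case of the bias estimate: if actions, scores and Q-function all use `θ₁`, the
expected estimate is exactly the derivative at `θ₁`, compared here with the one at `θ₂`. The factor
`1 + N` arises because the constant families are at distance `N * ‖θ₁ - θ₂‖`. -/
lemma ScoreBounds.norm_blockGrad_utility_sub_le (h : ScoreBounds π B V Λ) (hB : 0 ≤ B)
    (hΛ : 0 ≤ Λ) {R : ℝ} (hR : 0 ≤ R) (hr : BoundedRewards G R) (i : Fin N) (θ₁ θ₂ : Params M) :
    ‖blockGrad i (utility G π i) θ₁ - blockGrad i (utility G π i) θ₂‖ ≤
      gradLip N G.γ R B V Λ * (1 + N) * ‖θ₁ - θ₂‖ := by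
  have hrb : BddMeas (G.r i) R := ⟨G.measurable_r i, hr i⟩
  have hL := gradLip_nonneg (N := N) (V := V) G.γ_lt_one hR hB hΛ
  refine norm_le_of_forall_inner_le (by positivity) fun x => ?_
  rw [inner_sub_left, h.inner_blockGrad_utility hB hΛ hR hr,
    h.inner_blockGrad_utility hB hΛ hR hr]
  have := h.abs_occ_scoreAvg_sub_valueDeriv_le (G := G) hB hΛ hrb hR (fun _ => θ₁) θ₂ θ₁
    (Params.single i x)
  rw [beliefDist_const, Params.norm_single] at this
  refine le_trans this (le_of_eq ?_)
  ring

end Gradients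

/-! ### Functions with Lipschitz block gradients -/

section BlockSmooth

variable {N : ℕ} {M : Fin N → ℕ}

lemma Params.update_update (θ : Params M) (i : Fin N) (x y : EuclideanSpace ℝ (Fin (M i))) :
    (θ.update i x).update i y = θ.update i y := by
  simp [Params.update]

lemma Params.update_apply_self (θ : Params M) (i : Fin N) (x : EuclideanSpace ℝ (Fin (M i))) :
    θ.update i x i = x := by
  simp [Params.update]

/-- Functions that are differentiable in each block separately, with block gradients that are bounded
by `D` and `K`-Lipschitz in all the parameters. -/
structure BlockSmooth (u : Params M → ℝ) (D K : ℝ) : Prop where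
  differentiableAt : ∀ i (θ : Params M), DifferentiableAt ℝ (fun x => u (θ.update i x)) (θ i)
  bound : ∀ i θ, ‖blockGrad i u θ‖ ≤ D
  lipschitz : ∀ i θ₁ θ₂, ‖blockGrad i u θ₁ - blockGrad i u θ₂‖ ≤ K * ‖θ₁ - θ₂‖

/-- Differentiability is assumed only at the block of the base point. Updating a block twice equals
updating it once, so the base point can be moved to any `x`. -/
lemma hasFDerivAt_block {u : Params M → ℝ} {i : Fin N}
    (hu : ∀ θ : Params M, DifferentiableAt ℝ (fun x => u (θ.update i x)) (θ i)) (θ : Params M)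
    (x : EuclideanSpace ℝ (Fin (M i))) :
    HasFDerivAt (fun x => u (θ.update i x)) (innerSL ℝ (blockGrad i u (θ.update i x))) x := by
  have h := (hu (θ.update i x)).hasFDerivAt
  have e : innerSL ℝ (blockGrad i u (θ.update i x)) =
      fderiv ℝ (fun y => u ((θ.update i x).update i y)) (θ.update i x i) :=
    ContinuousLinearMap.ext fun y => by
      rw [innerSL_apply_apply, blockGrad, gradient, InnerProductSpace.toDual_symm_apply]
  rw [← e] at h
  simpa only [Params.update_update, Params.update_apply_self] using h

/-- Mean value inequality in one block, with an approximate gradient `g`. -/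
lemma abs_update_sub_le {u : Params M → ℝ} {i : Fin N}
    (hu : ∀ θ : Params M, DifferentiableAt ℝ (fun x => u (θ.update i x)) (θ i)) (θ : Params M)
    (y g : EuclideanSpace ℝ (Fin (M i))) {c : ℝ}
    (hc : ∀ z : EuclideanSpace ℝ (Fin (M i)), ‖z‖ ≤ ‖y‖ →
      ‖blockGrad i u (θ + Params.single i z) - g‖ ≤ c) :
    |u (θ + Params.single i y) - u θ - inner ℝ g y| ≤ c * ‖y‖ := by
  have h := (convex_closedBall (θ i) ‖y‖).norm_image_sub_le_of_norm_hasFDerivWithin_le'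
    (f := fun x => u (θ.update i x)) (f' := fun x => innerSL ℝ (blockGrad i u (θ.update i x)))
    (φ := innerSL ℝ g) (C := c) (x := θ i) (y := θ i + y)
    (fun x _ => (hasFDerivAt_block hu θ x).hasFDerivWithinAt)
    (fun x hx => by
      rw [← map_sub, innerSL_apply_norm]
      rw [mem_closedBall_iff_norm] at hx
      rw [Params.update_eq_add_single]
      exact hc _ hx)
    (by simp) (by simp)
  rw [Params.update_self, Params.update_eq_add_single] at h
  simpa using h

/-- Blocks are changed one after the other and the increments telescope. This uses no joint
differentiability of `u`. -/
lemma abs_sub_sub_sum_le_of_steps (u : Params M → ℝ) (θ δ : Params M) (ℓ c : Fin N → ℝ)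
    (hstep : ∀ i, ∀ s : Finset (Fin N), i ∉ s →
      |u (θ + ∑ j ∈ s, Params.single j (δ j) + Params.single i (δ i)) -
        u (θ + ∑ j ∈ s, Params.single j (δ j)) - ℓ i| ≤ c i) :
    |u (θ + δ) - u θ - ∑ i, ℓ i| ≤ ∑ i, c i := by
  have key : ∀ s : Finset (Fin N),
      |u (θ + ∑ j ∈ s, Params.single j (δ j)) - u θ - ∑ i ∈ s, ℓ i| ≤ ∑ i ∈ s, c i := by
    intro s
    induction s using Finset.induction_on with
    | empty => simp
    | insert i s his ih =>
      rw [Finset.sum_insert his, Finset.sum_insert his, Finset.sum_insert his,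
        add_comm (Params.single i (δ i)), ← add_assoc]
      refine le_trans (le_of_eq ?_) ((abs_add_le _ _).trans (add_le_add (hstep i s his) ih))
      congr 1
      ring
  have h := key Finset.univ
  rwa [Params.sum_single] at h

lemma Params.norm_partial_sum_le (δ : Params M) {i : Fin N} {s : Finset (Fin N)} (hi : i ∉ s)
    {z : EuclideanSpace ℝ (Fin (M i))} (hz : ‖z‖ ≤ ‖δ i‖) :
    ‖∑ j ∈ s, Params.single j (δ j) + Params.single i z‖ ≤ ∑ j, ‖δ j‖ := by
  calc _ ≤ ∑ j ∈ s, ‖δ j‖ + ‖δ i‖ := by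
        refine (norm_add_le _ _).trans (add_le_add ((norm_sum_le _ _).trans ?_) ?_)
        · simp
        · simpa using hz
    _ = ∑ j ∈ insert i s, ‖δ j‖ := by rw [Finset.sum_insert hi, add_comm]
    _ ≤ _ := Finset.sum_le_sum_of_subset_of_nonneg (Finset.subset_univ _)
        fun _ _ _ => norm_nonneg _

namespace BlockSmooth

variable {u : Params M → ℝ} {D K : ℝ}

lemma abs_sub_le (hu : BlockSmooth u D K) (θ δ : Params M) :
    |u (θ + δ) - u θ| ≤ D * ∑ j, ‖δ j‖ := by
  have h := abs_sub_sub_sum_le_of_steps u θ δ (fun _ => 0) (fun i => D * ‖δ i‖) fun i s _ => by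
    have := abs_update_sub_le (hu.differentiableAt i) (θ + ∑ j ∈ s, Params.single j (δ j))
      (δ i) 0 (c := D) fun z _ => by simpa using hu.bound i _
    simpa using this
  simpa [Finset.mul_sum] using h

lemma abs_sub_sub_inner_le_linear (hu : BlockSmooth u D K) (θ δ : Params M) :
    |u (θ + δ) - u θ - inner ℝ (fullGrad u θ) δ| ≤ 2 * D * ∑ j, ‖δ j‖ := by
  rw [Params.inner_eq_sum, Finset.mul_sum]
  refine abs_sub_sub_sum_le_of_steps u θ δ _ _ fun i s _ => ?_
  refine abs_update_sub_le (hu.differentiableAt i) _ (δ i) (blockGrad i u θ) fun z _ => ?_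
  have h1 := hu.bound i (θ + (∑ j ∈ s, Params.single j (δ j)) + Params.single i z)
  exact (norm_sub_le _ _).trans (by linarith [hu.bound i θ])

lemma abs_sub_sub_inner_le_quadratic (hu : BlockSmooth u D K) (hK : 0 ≤ K) (θ δ : Params M) :
    |u (θ + δ) - u θ - inner ℝ (fullGrad u θ) δ| ≤ K * (∑ j, ‖δ j‖) ^ 2 := by
  rw [Params.inner_eq_sum, sq, ← mul_assoc, Finset.mul_sum]
  refine abs_sub_sub_sum_le_of_steps u θ δ _ _ fun i s his => ?_
  refine abs_update_sub_le (hu.differentiableAt i) _ (δ i) (blockGrad i u θ) fun z hz => ?_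
  refine (hu.lipschitz i _ _).trans (mul_le_mul_of_nonneg_left ?_ hK)
  have := Params.norm_partial_sum_le δ his hz
  refine le_trans (le_of_eq ?_) this
  congr 1
  abel

/-- A step whose block norms are at most `X i + Y i` costs a quadratic term in `X` and a linear term
in `Y`. -/
lemma sub_le_neg_inner_add (hu : BlockSmooth u D K) (hD : 0 ≤ D) (hK : 0 ≤ K) (θ δ : Params M)
    {X Y : Fin N → ℝ} (hX : ∀ i, 0 ≤ X i) (hY : ∀ i, 0 ≤ Y i) (hδ : ∀ i, ‖δ i‖ ≤ X i + Y i) :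
    u θ - u (θ + δ) ≤ -inner ℝ (fullGrad u θ) δ + 4 * K * N * ∑ i, X i ^ 2 +
      4 * D * ∑ i, Y i := by
  have hσ : ∑ j, ‖δ j‖ ≤ ∑ i, X i + ∑ i, Y i := by
    rw [← Finset.sum_add_distrib]
    exact Finset.sum_le_sum fun i _ => hδ i
  have hσ0 : 0 ≤ ∑ j, ‖δ j‖ := Finset.sum_nonneg fun _ _ => norm_nonneg _
  have hX0 : 0 ≤ ∑ i, X i := Finset.sum_nonneg fun i _ => hX i
  have hY0 : 0 ≤ ∑ i, Y i := Finset.sum_nonneg fun i _ => hY i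
  have hcs : (∑ i, X i) ^ 2 ≤ N * ∑ i, X i ^ 2 := by
    simpa using sq_sum_le_card_mul_sum_sq (s := Finset.univ) (f := X)
  have hsq : 0 ≤ K * (N * ∑ i, X i ^ 2) :=
    mul_nonneg hK (mul_nonneg (Nat.cast_nonneg N) (Finset.sum_nonneg fun i _ => sq_nonneg _))
  have hcsK := mul_le_mul_of_nonneg_left hcs hK
  -- If X dominates, the quadratic remainder is at most `K * (2 ∑ X)²`, and Cauchy–Schwarz gives `4
  -- * K * N * ∑ X²`. If Y dominates, the linear remainder is at most `2 * D * (2 ∑ Y)`. Hence the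
  -- square of Y never appears.
  rcases le_total (∑ i, Y i) (∑ i, X i) with hYX | hXY
  · have h := (abs_le.1 (hu.abs_sub_sub_inner_le_quadratic hK θ δ)).1
    have h2 : (∑ j, ‖δ j‖) ^ 2 ≤ (2 * ∑ i, X i) ^ 2 :=
      pow_le_pow_left₀ hσ0 (by linarith) 2
    have h3 := mul_le_mul_of_nonneg_left h2 hK
    have h4 := mul_nonneg hD hY0
    nlinarith
  · have h := (abs_le.1 (hu.abs_sub_sub_inner_le_linear θ δ)).1
    have h2 : D * ∑ j, ‖δ j‖ ≤ D * (2 * ∑ i, Y i) :=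
      mul_le_mul_of_nonneg_left (by linarith) hD
    nlinarith

lemma continuous (hu : BlockSmooth u D K) : Continuous u := by
  refine continuous_iff_continuousAt.2 fun θ => ?_
  rw [ContinuousAt, tendsto_iff_norm_sub_tendsto_zero]
  have h2 : Tendsto (fun ϑ : Params M => D * ∑ j, ‖(ϑ - θ) j‖) (𝓝 θ) (𝓝 0) := by
    have hc : Continuous fun ϑ : Params M => D * ∑ j, ‖(ϑ - θ) j‖ := by fun_prop
    simpa using hc.tendsto θ
  refine squeeze_zero (fun _ => norm_nonneg _) (fun ϑ => ?_) h2
  have := hu.abs_sub_le θ (ϑ - θ)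
  rwa [add_sub_cancel] at this

lemma continuous_blockGrad (hu : BlockSmooth u D K) (i : Fin N) :
    Continuous fun θ => blockGrad i u θ := by
  refine continuous_iff_continuousAt.2 fun θ => ?_
  rw [ContinuousAt, tendsto_iff_norm_sub_tendsto_zero]
  have h2 : Tendsto (fun ϑ : Params M => K * ‖ϑ - θ‖) (𝓝 θ) (𝓝 0) := by
    have hc : Continuous fun ϑ : Params M => K * ‖ϑ - θ‖ := by fun_prop
    simpa using hc.tendsto θ
  exact squeeze_zero (fun _ => norm_nonneg _) (fun ϑ => hu.lipschitz i ϑ θ) h2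

lemma continuous_fullGrad (hu : BlockSmooth u D K) : Continuous (fullGrad u) :=
  (PiLp.continuous_toLp 2 _).comp (continuous_pi fun i => hu.continuous_blockGrad i)

lemma norm_fullGrad_sq (u : Params M → ℝ) (θ : Params M) :
    ‖fullGrad u θ‖ ^ 2 = ∑ i, ‖blockGrad i u θ‖ ^ 2 := by
  rw [PiLp.norm_sq_eq_of_L2]
  rfl

lemma norm_fullGrad_sq_le (hu : BlockSmooth u D K) (θ : Params M) :
    ‖fullGrad u θ‖ ^ 2 ≤ N * D ^ 2 := by
  rw [norm_fullGrad_sq]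
  calc _ ≤ ∑ _i : Fin N, D ^ 2 :=
        Finset.sum_le_sum fun i _ => pow_le_pow_left₀ (norm_nonneg _) (hu.bound i θ) 2
    _ = N * D ^ 2 := by simp

end BlockSmooth

end BlockSmooth

/-! ### Potentials -/

section Potential

variable {N : ℕ} {M : Fin N → ℕ} {S A : Type*} [MeasurableSpace S] [MeasurableSpace A]
  {ν : Measure A} [SigmaFinite ν] {G : MarkovGame N S A} {π : PolicyFamily M S A ν}
  {B V Λ R : ℝ} {u : Params M → ℝ}

lemma abs_utility_le (hr : BoundedRewards G R) (i : Fin N) (θ : Params M) :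
    |utility G π i θ| ≤ (1 - G.γ)⁻¹ * R := by
  rw [utility_eq_discVal hr]
  exact abs_tsum_discounted_le G.γ_pos.le G.γ_lt_one fun k =>
    (BddMeas.abs_integral_le ⟨G.measurable_r i, hr i⟩ _)

lemma ScoreBounds.differentiableAt_utility (h : ScoreBounds π B V Λ) (hB : 0 ≤ B) (hΛ : 0 ≤ Λ)
    (hR : 0 ≤ R) (hr : BoundedRewards G R) (i : Fin N) (θ : Params M) :
    DifferentiableAt ℝ (utility G π i) θ := by
  have hrb : BddMeas (G.r i) R := ⟨G.measurable_r i, hr i⟩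
  have hu : utility G π i = fun ϑ => discVal G π (fun _ => ϑ) (G.r i) :=
    funext fun ϑ => utility_eq_discVal hr i ϑ
  rw [hu]
  exact (h.hasFDerivAt_discVal hB hΛ hrb hR θ).differentiableAt

lemma IsPotential.blockSmooth (hu : IsPotential G π u) (h : ScoreBounds π B V Λ) (hB : 0 ≤ B)
    (hΛ : 0 ≤ Λ) (hR : 0 ≤ R) (hr : BoundedRewards G R) :
    BlockSmooth u (gradBound N G.γ R B) (gradLip N G.γ R B V Λ * (1 + N)) where
  differentiableAt i θ := (hu i θ).1
  bound i θ := by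
    rw [← (hu i θ).2]
    exact h.norm_blockGrad_utility_le hB hΛ hR hr i θ
  lipschitz i θ₁ θ₂ := by
    rw [← (hu i θ₁).2, ← (hu i θ₂).2]
    exact h.norm_blockGrad_utility_sub_le hB hΛ hR hr i θ₁ θ₂

/-- Along the parameters of agent `i`, a potential differs from `u_i` by a constant. -/
lemma IsPotential.abs_add_single_sub_le (hu : IsPotential G π u) (h : ScoreBounds π B V Λ)
    (hB : 0 ≤ B) (hΛ : 0 ≤ Λ) (hR : 0 ≤ R) (hr : BoundedRewards G R) (i : Fin N) (θ : Params M)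
    (y : EuclideanSpace ℝ (Fin (M i))) :
    |u (θ + Params.single i y) - u θ| ≤ 2 * ((1 - G.γ)⁻¹ * R) := by
  have hd : ∀ ϑ : Params M, DifferentiableAt ℝ (fun x => utility G π i (ϑ.update i x)) (ϑ i) := by
    intro ϑ
    have h0 : DifferentiableAt ℝ (utility G π i) (ϑ.update i (ϑ i)) :=
      h.differentiableAt_utility hB hΛ hR hr i _
    exact h0.comp (ϑ i) (ϑ.hasFDerivAt_update i (ϑ i)).differentiableAt
  -- As functions of block `i` alone, the potential and the utility of agent `i` have the same
  -- gradient everywhere, so their difference is constant.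
  have hconst := is_const_of_fderiv_eq_zero (𝕜 := ℝ)
    (f := fun x => u (θ.update i x) - utility G π i (θ.update i x))
    (fun x => ((hasFDerivAt_block (fun ϑ => (hu i ϑ).1) θ x).sub
      (hasFDerivAt_block hd θ x)).differentiableAt)
    (fun x => by
      have := ((hasFDerivAt_block (fun ϑ => (hu i ϑ).1) θ x).sub
        (hasFDerivAt_block hd θ x)).fderiv
      rw [(hu i _).2, sub_self] at this
      exact this)
    (θ i + y) (θ i)
  have e : θ.update i (θ i + y) = θ + Params.single i y := by
    rw [Params.update_eq_add_single, add_sub_cancel_left]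
  rw [Params.update_self, e] at hconst
  have h1 := abs_le.1 (abs_utility_le (π := π) hr i (θ + Params.single i y))
  have h2 := abs_le.1 (abs_utility_le (π := π) hr i θ)
  rw [abs_le]
  constructor <;> linarith [h1.1, h1.2, h2.1, h2.2]

/-- Any two parameter vectors are joined by `N` changes of a single block, each costing at most the
oscillation of one bounded utility. -/
lemma IsPotential.abs_sub_le (hu : IsPotential G π u) (h : ScoreBounds π B V Λ)
    (hB : 0 ≤ B) (hΛ : 0 ≤ Λ) (hR : 0 ≤ R) (hr : BoundedRewards G R) (θ θ' : Params M) :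
    |u θ' - u θ| ≤ N * (2 * ((1 - G.γ)⁻¹ * R)) := by
  have := abs_sub_sub_sum_le_of_steps u θ (θ' - θ) (fun _ => 0)
    (fun _ => 2 * ((1 - G.γ)⁻¹ * R)) fun i s _ => by
      rw [sub_zero]
      exact hu.abs_add_single_sub_le h hB hΛ hR hr i _ _
  simpa using this

lemma IsPotential.bddAbove (hu : IsPotential G π u) (h : ScoreBounds π B V Λ)
    (hB : 0 ≤ B) (hΛ : 0 ≤ Λ) (hR : 0 ≤ R) (hr : BoundedRewards G R) :
    BddAbove (Set.range u) := by
  refine ⟨u 0 + N * (2 * ((1 - G.γ)⁻¹ * R)), ?_⟩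
  rintro _ ⟨θ, rfl⟩
  linarith [(abs_le.1 (hu.abs_sub_le h hB hΛ hR hr 0 θ)).2]

lemma potentialGap_nonneg (hb : BddAbove (Set.range u)) (θ : Params M) : 0 ≤ potentialGap u θ :=
  sub_nonneg.2 (le_ciSup hb θ)

lemma IsPotential.potentialGap_le (hu : IsPotential G π u) (h : ScoreBounds π B V Λ)
    (hB : 0 ≤ B) (hΛ : 0 ≤ Λ) (hR : 0 ≤ R) (hr : BoundedRewards G R) (θ : Params M) :
    potentialGap u θ ≤ N * (2 * ((1 - G.γ)⁻¹ * R)) := by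
  rw [potentialGap, sub_le_iff_le_add]
  exact ciSup_le fun ϑ => by linarith [(abs_le.1 (hu.abs_sub_le h hB hΛ hR hr θ ϑ)).2]

end Potential

/-! ### The law of an episode as a function of the beliefs -/

section EpisodeKernel

variable {N : ℕ} {M : Fin N → ℕ} {S A : Type*} [MeasurableSpace S] [MeasurableSpace A]
  {ν : Measure A}

lemma PolicyFamily.measurable_dens_uncurry (π : PolicyFamily M S A ν) (n : Fin N) :
    Measurable fun p : Params M × S × A => π.dens n p.1 p.2.1 p.2.2 :=
  measurable_uncurry_of_continuous_of_measurable (u := fun θ (x : S × A) => π.dens n θ x.1 x.2)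
    (fun x => (π.differentiable_dens n x.1 x.2).continuous) (fun θ => π.measurable_dens n θ)

lemma PolicyFamily.measurable_jointDens_uncurry (π : PolicyFamily M S A ν) :
    Measurable (Function.uncurry fun (p : (Fin N → Params M) × S) (a : Fin N → A) =>
      π.jointDens p.1 p.2 a) := by
  unfold PolicyFamily.jointDens Function.uncurry
  refine ENNReal.measurable_ofReal.comp (Finset.measurable_prod _ fun n _ => ?_)
  have h := (π.measurable_dens_uncurry n).comp
    (f := fun q : ((Fin N → Params M) × S) × (Fin N → A) => (q.1.1 n, q.1.2, q.2 n)) (by fun_prop)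
  exact h

variable [SigmaFinite ν]

/-- The joint policy as a transition from beliefs and states to actions. -/
def jointActionKernel (π : PolicyFamily M S A ν) :
    Kernel ((Fin N → Params M) × S) (Fin N → A) :=
  Kernel.withDensity (Kernel.const _ (Measure.pi fun _ : Fin N => ν))
    fun p a => π.jointDens p.1 p.2 a

lemma jointActionKernel_apply (π : PolicyFamily M S A ν) (p : (Fin N → Params M) × S) :
    jointActionKernel π p = π.joint p.1 p.2 := by
  rw [jointActionKernel, PolicyFamily.joint, Kernel.withDensity_apply _ π.measurable_jointDens_uncurry,
    Kernel.withDensity_apply _ (π.measurable_jointDens p.1)]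
  rfl

instance (π : PolicyFamily M S A ν) : IsMarkovKernel (jointActionKernel π) :=
  ⟨fun p => by rw [jointActionKernel_apply]; infer_instance⟩

/-- `stepKernel` as a transition from beliefs and state-action pairs. -/
def jointStepKernel (G : MarkovGame N S A) (π : PolicyFamily M S A ν) :
    Kernel ((Fin N → Params M) × S × (Fin N → A)) (S × (Fin N → A)) :=
  (G.P.comap Prod.snd measurable_snd) ⊗ₖ
    (jointActionKernel π).comap (fun q => (q.1.1, q.2)) (by fun_prop)

lemma jointStepKernel_apply (G : MarkovGame N S A) (π : PolicyFamily M S A ν)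
    (p : (Fin N → Params M) × S × (Fin N → A)) :
    jointStepKernel G π p = stepKernel G π p.1 p.2 := by
  ext D hD
  rw [jointStepKernel, stepKernel, Kernel.compProd_apply hD, Kernel.compProd_apply hD]
  simp [jointActionKernel_apply]

lemma measurable_dirac_compProd_joint (π : PolicyFamily M S A ν) :
    Measurable fun p : (Fin N → Params M) × S => (Measure.dirac p.2) ⊗ₘ π.joint p.1 := by
  refine Measure.measurable_of_measurable_coe _ fun D hD => ?_
  have h : ∀ p : (Fin N → Params M) × S, ((Measure.dirac p.2) ⊗ₘ π.joint p.1) D =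
      jointActionKernel π p (Prod.mk p ⁻¹' ((fun q => (q.1.2, q.2)) ⁻¹' D)) := by
    intro p
    rw [Measure.compProd_apply hD, lintegral_dirac' _ (Kernel.measurable_kernel_prodMk_left hD),
      jointActionKernel_apply]
    rfl
  simp_rw [h]
  exact Kernel.measurable_kernel_prodMk_left ((show Measurable fun
    q : ((Fin N → Params M) × S) × (Fin N → A) => (q.1.2, q.2) by fun_prop) hD)

lemma measurable_historyKernel (G : MarkovGame N S A) (π : PolicyFamily M S A ν) {T : Type*}
    [MeasurableSpace T] {β : T → Fin N → Params M} (hβ : Measurable β) (k : ℕ) :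
    Measurable fun p : T × ((j : Finset.Iic k) → (fun _ : ℕ => S × (Fin N → A)) j) =>
      historyKernel G π (β p.1) k p.2 := by
  have h := (jointStepKernel G π).measurable.comp
    (f := fun p : T × ((j : Finset.Iic k) → (fun _ : ℕ => S × (Fin N → A)) j) =>
      (β p.1, p.2 ⟨k, Finset.mem_Iic.2 le_rfl⟩)) (by fun_prop)
  have e : ∀ p : T × ((j : Finset.Iic k) → (fun _ : ℕ => S × (Fin N → A)) j),
      historyKernel G π (β p.1) k p.2 =
        jointStepKernel G π (β p.1, p.2 ⟨k, Finset.mem_Iic.2 le_rfl⟩) := fun p => by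
    rw [jointStepKernel_apply, historyKernel, Kernel.comap_apply]
  simp_rw [e]
  exact h

/-- `pathKernel` as a transition from beliefs and initial states. -/
def jointPathKernel (G : MarkovGame N S A) (π : PolicyFamily M S A ν) :
    Kernel ((Fin N → Params M) × S) (Path N S A) where
  toFun p := pathKernel G π p.1 p.2
  measurable' := by
    simp_rw [pathKernel_eq_trajMeasure]
    exact measurable_trajMeasure _ (measurable_dirac_compProd_joint π)
      (fun p => historyKernel G π p.1) fun k => measurable_historyKernel G π measurable_fst k

lemma jointPathKernel_apply (G : MarkovGame N S A) (π : PolicyFamily M S A ν)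
    (p : (Fin N → Params M) × S) : jointPathKernel G π p = pathKernel G π p.1 p.2 := rfl

instance (G : MarkovGame N S A) (π : PolicyFamily M S A ν) : IsMarkovKernel (jointPathKernel G π) :=
  ⟨fun p => by rw [jointPathKernel_apply]; infer_instance⟩

/-- `pathLaw` as a transition from beliefs. -/
def pathLawKernel (G : MarkovGame N S A) (π : PolicyFamily M S A ν) :
    Kernel (Fin N → Params M) (Path N S A) where
  toFun b := pathLaw G π b
  measurable' := by
    refine Measure.measurable_of_measurable_coe _ fun D hD => ?_
    have h : ∀ b, pathLaw G π b D = ∫⁻ s, jointPathKernel G π (b, s) D ∂G.ρ := fun b => by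
      rw [pathLaw, Measure.bind_apply hD (Kernel.aemeasurable _)]
      rfl
    simp_rw [h]
    exact (Kernel.measurable_coe _ hD).lintegral_prod_right'

lemma pathLawKernel_apply (G : MarkovGame N S A) (π : PolicyFamily M S A ν)
    (b : Fin N → Params M) : pathLawKernel G π b = pathLaw G π b := rfl

instance (G : MarkovGame N S A) (π : PolicyFamily M S A ν) : IsMarkovKernel (pathLawKernel G π) :=
  ⟨fun b => by rw [pathLawKernel_apply]; infer_instance⟩

instance (G : MarkovGame N S A) : IsProbabilityMeasure (horizonLaw₁ G) := by
  unfold horizonLaw₁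
  infer_instance

lemma MarkovGame.sqrt_γ_lt_one (G : MarkovGame N S A) : Real.sqrt G.γ < 1 := by
  rw [Real.sqrt_lt' one_pos]
  simpa using G.γ_lt_one

instance (G : MarkovGame N S A) : IsProbabilityMeasure (horizonLaw₂ G) := by
  unfold horizonLaw₂
  infer_instance

lemma integral_horizonLaw₁ (G : MarkovGame N S A) (f : ℕ → ℝ) :
    ∫ n, f n ∂horizonLaw₁ G = ∑' n : ℕ, G.γ ^ n * (1 - G.γ) * f n := by
  rw [horizonLaw₁, integral_geometricMeasure]
  · simp
  · rw [← Subtype.coe_ne_coe]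
    simpa [sub_eq_zero] using G.γ_lt_one.ne'

lemma integral_horizonLaw₂ (G : MarkovGame N S A) (f : ℕ → ℝ) :
    ∫ n, f n ∂horizonLaw₂ G = ∑' n : ℕ, Real.sqrt G.γ ^ n * (1 - Real.sqrt G.γ) * f n := by
  rw [horizonLaw₂, integral_geometricMeasure]
  · simp
  · rw [← Subtype.coe_ne_coe]
    simpa [sub_eq_zero] using G.sqrt_γ_lt_one.ne'

lemma measurable_state_at_horizon : Measurable
    fun e : ℕ × ℕ × ℕ × Path N S A => (e.2.2.2 e.1).1 :=
  measurable_from_prod_countable_right fun k =>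
    measurable_fst.comp ((measurable_pi_apply k).comp (measurable_snd.comp measurable_snd))

/-- `episodeLaw` as a transition from beliefs. -/
def episodeKernel (G : MarkovGame N S A) (π : PolicyFamily M S A ν) :
    Kernel (Fin N → Params M) (Episode N S A) :=
  (Kernel.const _ (horizonLaw₁ G) ×ₖ (Kernel.const _ (horizonLaw₂ G) ×ₖ
    (Kernel.const _ (horizonLaw₂ G) ×ₖ pathLawKernel G π))) ⊗ₖ
  (jointPathKernel G π).comap (fun q => (q.1, (q.2.2.2.2 q.2.1).1))
    (measurable_fst.prodMk (measurable_state_at_horizon.comp measurable_snd))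

instance (G : MarkovGame N S A) (π : PolicyFamily M S A ν) : IsMarkovKernel (episodeKernel G π) := by
  unfold episodeKernel
  infer_instance

/-- The conditional law prescribed for an episode thereby becomes a kernel in the beliefs, the form
needed for computing conditional expectations. -/
lemma episodeKernel_apply (G : MarkovGame N S A) (π : PolicyFamily M S A ν)
    (b : Fin N → Params M) : episodeKernel G π b = episodeLaw G π b := by
  rw [episodeKernel, Kernel.compProd_apply_eq_compProd_sectR, episodeLaw, Kernel.prod_apply,
    Kernel.prod_apply, Kernel.prod_apply, Kernel.const_apply, Kernel.const_apply,
    pathLawKernel_apply, pathLaw]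
  rfl

end EpisodeKernel

/-! ### Expectations along an episode -/

/-- A geometric number of terms turns the discount factor `q` into another factor `q`. -/
lemma tsum_geometric_mul_sum_range {q c : ℝ} (h₀ : 0 ≤ q) (h₁ : q < 1) {a : ℕ → ℝ}
    (ha : ∀ m, |a m| ≤ c) :
    ∑' n : ℕ, q ^ n * (1 - q) * ∑ m ∈ Finset.range (n + 1), q ^ m * a m =
      ∑' m : ℕ, (q ^ 2) ^ m * a m := by
  have hq : Summable fun n : ℕ => ‖q ^ n‖ := by
    simpa using (summable_geometric_of_lt_one h₀ h₁).norm
  have ha2 : Summable fun m : ℕ => ‖(q ^ 2) ^ m * a m‖ := by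
    have := summable_discounted (sq_nonneg q) (by nlinarith) ha
    exact this.norm
  -- Cauchy product of `∑ (q²)^m a_m` with the geometric series: the coefficient of order `n` is `∑
  -- (q²)^m a_m q^(n-m) = q^n ∑ q^m a_m`, and the factor `1 - q` cancels the geometric sum.
  have h := tsum_mul_tsum_eq_tsum_sum_range_of_summable_norm ha2 hq
  rw [tsum_geometric_of_lt_one h₀ h₁] at h
  have hne : (1 - q) ≠ 0 := by linarith
  rw [← mul_inv_cancel_right₀ hne (∑' m : ℕ, (q ^ 2) ^ m * a m), mul_assoc, mul_comm (1 - q),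
    ← mul_assoc, h, ← tsum_mul_right]
  refine tsum_congr fun n => ?_
  rw [Finset.mul_sum, Finset.sum_mul]
  refine Finset.sum_congr rfl fun m hm => ?_
  have hmn : m ≤ n := Nat.lt_succ_iff.1 (Finset.mem_range.1 hm)
  have e : q ^ n = q ^ m * q ^ (n - m) := by rw [← pow_add, Nat.add_sub_cancel' hmn]
  rw [e]
  ring

section EpisodeExpectation

variable {N : ℕ} {M : Fin N → ℕ} {S A : Type*} [MeasurableSpace S] [MeasurableSpace A]
  {ν : Measure A} [SigmaFinite ν] {G : MarkovGame N S A} {π : PolicyFamily M S A ν}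
  {b : Fin N → Params M} {lam f : S × (Fin N → A) → ℝ} {c d : ℝ}

lemma lintegral_stateActionLaw_le (k : ℕ) {φ : S × (Fin N → A) → ℝ≥0∞} (hφ : Measurable φ)
    {c : ℝ≥0∞} (h : ∀ s, ∫⁻ a, φ (s, a) ∂π.joint b s ≤ c) :
    ∫⁻ z, φ z ∂stateActionLaw G π b k ≤ c := by
  rw [stateActionLaw, Measure.lintegral_compProd hφ]
  calc _ ≤ ∫⁻ _, c ∂stateLaw G π b k := lintegral_mono h
    _ = c := by simp

lemma lintegral_pathLaw_eval (k : ℕ) {φ : S × (Fin N → A) → ℝ≥0∞} (hφ : Measurable φ) :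
    ∫⁻ x, φ (x k) ∂pathLaw G π b = ∫⁻ z, φ z ∂stateActionLaw G π b k := by
  rw [← map_eval_pathLaw, lintegral_map hφ (by fun_prop)]

lemma measurable_eval_horizon : Measurable
    fun e : ℕ × ℕ × ℕ × Path N S A => e.2.2.2 e.1 :=
  measurable_from_prod_countable_right fun k =>
    (measurable_pi_apply k).comp (measurable_snd.comp measurable_snd)

lemma Episode.measurable_main_T₁ : Measurable fun e : Episode N S A => e.main e.T₁ :=
  measurable_eval_horizon.comp measurable_fst

/-- The bound is uniform in the state, so it survives averaging over states, horizons and the extra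
rollout, all of which have probability laws. -/
lemma lintegral_episodeLaw_le {φ : S × (Fin N → A) → ℝ≥0∞} (hφ : Measurable φ)
    {c : ℝ≥0∞} (h : ∀ s, ∫⁻ a, φ (s, a) ∂π.joint b s ≤ c) :
    ∫⁻ e, φ (e.main e.T₁) ∂episodeLaw G π b ≤ c := by
  have hm : Measurable fun e : ℕ × ℕ × ℕ × Path N S A => φ (e.2.2.2 e.1) :=
    hφ.comp measurable_eval_horizon
  have h1 : ∀ k, ∫⁻ p : ℕ × ℕ × Path N S A, φ (p.2.2 k)
      ∂((horizonLaw₂ G).prod ((horizonLaw₂ G).prod (pathLaw G π b))) ≤ c := by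
    intro k
    have hk2 : Measurable fun p : ℕ × ℕ × Path N S A => φ (p.2.2 k) := by fun_prop
    have hk1 : Measurable fun p : ℕ × Path N S A => φ (p.2 k) := by fun_prop
    rw [lintegral_prod _ hk2.aemeasurable]
    calc _ ≤ ∫⁻ _, c ∂horizonLaw₂ G := lintegral_mono fun n => ?_
      _ = c := by simp
    rw [lintegral_prod _ hk1.aemeasurable]
    calc _ ≤ ∫⁻ _, c ∂horizonLaw₂ G := lintegral_mono fun l => ?_
      _ = c := by simp
    exact (lintegral_pathLaw_eval k hφ).le.trans (lintegral_stateActionLaw_le k hφ h)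
  have hm2 : Measurable fun e : Episode N S A => φ (e.main e.T₁) := hm.comp measurable_fst
  rw [episodeLaw, Measure.lintegral_compProd hm2]
  simp only [Episode.main, Episode.T₁, lintegral_const, measure_univ, mul_one]
  rw [lintegral_prod _ hm.aemeasurable]
  calc _ ≤ ∫⁻ _, c ∂horizonLaw₁ G := lintegral_mono fun k => h1 k
    _ = c := by simp

/-- Functions of the state and the action whose conditional first absolute moments given the state
are at most `c`. -/
structure CondBdd (π : PolicyFamily M S A ν) (b : Fin N → Params M) (lam : S × (Fin N → A) → ℝ)
    (c : ℝ) : Prop where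
  meas : Measurable lam
  bound : ∀ s, ∫⁻ a, ‖lam (s, a)‖ₑ ∂π.joint b s ≤ ENNReal.ofReal c

namespace CondBdd

lemma integrable_stateActionLaw (hl : CondBdd π b lam c) (k : ℕ) :
    Integrable lam (stateActionLaw G π b k) :=
  ⟨hl.meas.aestronglyMeasurable, (lintegral_stateActionLaw_le k hl.meas.enorm hl.bound).trans_lt
    ENNReal.ofReal_lt_top⟩

lemma integrable_pathLaw (hl : CondBdd π b lam c) (k : ℕ) :
    Integrable (fun x => lam (x k)) (pathLaw G π b) := by
  have h := hl.integrable_stateActionLaw (G := G) k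
  rw [← map_eval_pathLaw] at h
  exact h.comp_measurable (measurable_pi_apply k)

lemma integrable_episodeLaw (hl : CondBdd π b lam c) :
    Integrable (fun e => lam (e.main e.T₁)) (episodeLaw G π b) :=
  ⟨(hl.meas.comp Episode.measurable_main_T₁).aestronglyMeasurable,
    (lintegral_episodeLaw_le hl.meas.enorm hl.bound).trans_lt ENNReal.ofReal_lt_top⟩

/-- The correlation of `lam (x k)` with `f (x (k + m))`. -/
lemma integral_pathLaw_mul (hl : CondBdd π b lam c) (hf : BddMeas f d) (k m : ℕ) :
    ∫ x, lam (x k) * f (x (k + m)) ∂pathLaw G π b =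
      ∫ z, lam z * ∫ y, f y ∂iterKernel (stepKernel G π b) m z ∂stateActionLaw G π b k := by
  have hm : Measurable fun p : (S × (Fin N → A)) × (S × (Fin N → A)) => lam p.1 * f p.2 :=
    (hl.meas.comp measurable_fst).mul (hf.meas.comp measurable_snd)
  have hi : Integrable (fun p : (S × (Fin N → A)) × (S × (Fin N → A)) => lam p.1 * f p.2)
      (stateActionLaw G π b k ⊗ₘ iterKernel (stepKernel G π b) m) := by
    refine Integrable.mul_bdd (c := d) ?_ (hf.meas.comp measurable_snd).aestronglyMeasurable
      (Eventually.of_forall fun p => hf.bound p.2)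
    have h := hl.integrable_stateActionLaw (G := G) k
    rw [← Measure.fst_compProd (stateActionLaw G π b k) (iterKernel (stepKernel G π b) m),
      Measure.fst] at h
    exact h.comp_measurable measurable_fst
  have h1 := integral_map (μ := pathLaw G π b) (φ := fun x => (x k, x (k + m)))
    (by fun_prop) (f := fun p : (S × (Fin N → A)) × (S × (Fin N → A)) => lam p.1 * f p.2)
    hm.aestronglyMeasurable
  rw [← h1, map_pair_pathLaw, Measure.integral_compProd hi]
  simp_rw [integral_const_mul]

lemma abs_integral_pathLaw_mul_le (hl : CondBdd π b lam c) (hc : 0 ≤ c) (hf : BddMeas f d)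
    (hd : 0 ≤ d) (k m : ℕ) :
    |∫ x, lam (x k) * f (x (k + m)) ∂pathLaw G π b| ≤ c * d := by
  refine abs_integral_le_of_lintegral_le hc hd (fun x => hf.bound _) ?_
  exact (lintegral_pathLaw_eval k hl.meas.enorm).le.trans
    (lintegral_stateActionLaw_le k hl.meas.enorm hl.bound)

/-- Conditionally on the pair at time `k`, the discounted future values of `f` sum to the
Q-function. The sum and the integral are exchanged with the dominating terms `γ ^ m * ‖lam z‖ * d`,
as `lam` is unbounded. -/
lemma tsum_integral_pathLaw_mul (hl : CondBdd π b lam c) (hf : BddMeas f d) (k : ℕ) :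
    ∑' m : ℕ, G.γ ^ m * ∫ x, lam (x k) * f (x (k + m)) ∂pathLaw G π b =
      ∫ z, lam z * qFn G π b f z ∂stateActionLaw G π b k := by
  have hk : ∀ m, BddMeas (fun z => ∫ x, f x ∂iterKernel (stepKernel G π b) m z) d := fun m =>
    hf.integral_kernel _
  have hi := hl.integrable_stateActionLaw (G := G) k
  have him : ∀ m, Integrable (fun z => G.γ ^ m * (lam z *
      ∫ x, f x ∂iterKernel (stepKernel G π b) m z)) (stateActionLaw G π b k) := fun m =>
    (hi.mul_bdd (c := d) (hk m).meas.aestronglyMeasurable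
      (Eventually.of_forall fun z => (hk m).bound z)).const_mul _
  have h := hasSum_integral_of_summable_integral_norm him (by
    refine Summable.of_nonneg_of_le (fun m => integral_nonneg fun x => norm_nonneg _) (fun m => ?_)
      ((summable_geometric_of_lt_one G.γ_pos.le G.γ_lt_one).mul_right
        (∫ z, ‖lam z‖ * d ∂stateActionLaw G π b k))
    rw [← integral_const_mul]
    refine integral_mono (him m).norm ((hi.norm.mul_const d).const_mul _) fun z => ?_
    simp only [norm_mul, Real.norm_of_nonneg (pow_nonneg G.γ_pos.le m)]
    gcongr
    · exact pow_nonneg G.γ_pos.le m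
    · exact (hk m).bound z)
  have e : ∀ z, ∑' m : ℕ, G.γ ^ m * (lam z * ∫ x, f x ∂iterKernel (stepKernel G π b) m z) =
      lam z * qFn G π b f z := fun z => by
    rw [qFn, ← tsum_mul_left]
    exact tsum_congr fun m => by ring
  simp_rw [e] at h
  rw [← h.tsum_eq]
  refine tsum_congr fun m => ?_
  rw [integral_const_mul, hl.integral_pathLaw_mul hf]

lemma integral_stateActionLaw_mul (hl : CondBdd π b lam c) (hf : BddMeas f d) (k : ℕ) :
    ∫ z, lam z * f z ∂stateActionLaw G π b k =
      ∫ s, ∫ a, lam (s, a) * f (s, a) ∂π.joint b s ∂stateLaw G π b k :=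
  Measure.integral_compProd ((hl.integrable_stateActionLaw (G := G) k).mul_bdd (c := d)
    hf.meas.aestronglyMeasurable (Eventually.of_forall fun z => hf.bound z))

end CondBdd

/-! ### The estimators of the gain -/

/-- The part of the estimate `R̂_i` that depends on the trajectory only. -/
def mainGain (G : MarkovGame N S A) (est : GainEstimator) (i : Fin N) (x : Path N S A)
    (k n : ℕ) : ℝ :=
  match est with
  | .qFunction => rolloutSum G i x k n
  | .advantage => rolloutSum G i x k n
  | .temporalDifference => G.r i (x k) + G.γ * rolloutSum G i x (k + 1) n

/-- The multiple of the value estimate that is subtracted. -/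
def baselineCoeff : GainEstimator → ℝ
  | .qFunction => 0
  | .advantage => 1
  | .temporalDifference => 1

lemma baselineCoeff_mem (est : GainEstimator) : 0 ≤ baselineCoeff est ∧ baselineCoeff est ≤ 1 := by
  cases est <;> simp [baselineCoeff]

lemma gain_eq (G : MarkovGame N S A) (est : GainEstimator) (i : Fin N) (e : Episode N S A) :
    gain G est i e = mainGain G est i e.main e.T₁ e.T₂ -
      baselineCoeff est * rolloutSum G i e.extra 0 e.T₃ := by
  cases est <;> simp [gain, mainGain, baselineCoeff]

variable {R : ℝ}

lemma measurable_rolloutSum (G : MarkovGame N S A) (i : Fin N) (m T : ℕ) :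
    Measurable fun x : Path N S A => rolloutSum G i x m T :=
  Finset.measurable_sum _ fun k _ =>
    ((G.measurable_r i).comp (measurable_pi_apply (m + k))).const_mul _

lemma measurable_mainGain (G : MarkovGame N S A) (est : GainEstimator) (i : Fin N) (k n : ℕ) :
    Measurable fun x : Path N S A => mainGain G est i x k n := by
  cases est
  · exact measurable_rolloutSum G i k n
  · exact measurable_rolloutSum G i k n
  · exact ((G.measurable_r i).comp (measurable_pi_apply k)).add
      ((measurable_rolloutSum G i (k + 1) n).const_mul _)

/-- The weights `√γ ^ k` are summable, so the bound does not depend on the random horizon. -/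
lemma abs_rolloutSum_le (hr : BoundedRewards G R) (i : Fin N) (x : Path N S A) (m T : ℕ) :
    |rolloutSum G i x m T| ≤ (1 - Real.sqrt G.γ)⁻¹ * R := by
  have hR : 0 ≤ R := (abs_nonneg _).trans (hr i (x 0))
  have hq := G.sqrt_γ_lt_one
  calc |rolloutSum G i x m T| ≤ ∑ k ∈ Finset.range (T + 1), Real.sqrt G.γ ^ k * R := by
        refine (Finset.abs_sum_le_sum_abs _ _).trans (Finset.sum_le_sum fun k _ => ?_)
        rw [abs_mul, abs_of_nonneg (pow_nonneg (Real.sqrt_nonneg _) k)]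
        exact mul_le_mul_of_nonneg_left (hr i _) (pow_nonneg (Real.sqrt_nonneg _) k)
    _ = (∑ k ∈ Finset.range (T + 1), Real.sqrt G.γ ^ k) * R := by rw [Finset.sum_mul]
    _ ≤ _ := by
        refine mul_le_mul_of_nonneg_right ?_ hR
        rw [← tsum_geometric_of_lt_one (Real.sqrt_nonneg _) hq]
        exact (summable_geometric_of_lt_one (Real.sqrt_nonneg _) hq).sum_le_tsum _
          fun k _ => pow_nonneg (Real.sqrt_nonneg _) k

lemma abs_mainGain_le (hr : BoundedRewards G R) (est : GainEstimator) (i : Fin N) (x : Path N S A)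
    (k n : ℕ) : |mainGain G est i x k n| ≤ 2 * ((1 - Real.sqrt G.γ)⁻¹ * R) := by
  have hR : 0 ≤ R := (abs_nonneg _).trans (hr i (x 0))
  have hq := G.sqrt_γ_lt_one
  have h1 : (1 : ℝ) ≤ (1 - Real.sqrt G.γ)⁻¹ := by
    rw [one_le_inv₀ (by linarith)]
    linarith [Real.sqrt_nonneg G.γ]
  have h2 : R ≤ (1 - Real.sqrt G.γ)⁻¹ * R := le_mul_of_one_le_left hR h1
  have h3 := abs_rolloutSum_le hr i x
  cases est
  · exact (h3 k n).trans (by linarith)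
  · exact (h3 k n).trans (by linarith)
  · refine (abs_add_le _ _).trans ?_
    have h4 : |G.γ * rolloutSum G i x (k + 1) n| ≤ (1 - Real.sqrt G.γ)⁻¹ * R := by
      rw [abs_mul, abs_of_pos G.γ_pos]
      exact (mul_le_of_le_one_left (abs_nonneg _) G.γ_lt_one.le).trans (h3 _ _)
    linarith [hr i (x k)]

lemma abs_gain_le (hr : BoundedRewards G R) (est : GainEstimator) (i : Fin N) (e : Episode N S A) :
    |gain G est i e| ≤ 3 * ((1 - Real.sqrt G.γ)⁻¹ * R) := by
  rw [gain_eq]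
  have h1 := abs_mainGain_le hr est i e.main e.T₁ e.T₂
  have h2 := abs_rolloutSum_le hr i e.extra 0 e.T₃
  have h3 : |baselineCoeff est * rolloutSum G i e.extra 0 e.T₃| ≤ (1 - Real.sqrt G.γ)⁻¹ * R := by
    rw [abs_mul, abs_of_nonneg (baselineCoeff_mem est).1]
    exact (mul_le_of_le_one_left (abs_nonneg _) (baselineCoeff_mem est).2).trans h2
  exact (abs_sub _ _).trans (by linarith)

lemma measurable_gain (G : MarkovGame N S A) (est : GainEstimator) (i : Fin N) :
    Measurable (gain G est i : Episode N S A → ℝ) := by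
  have h1 : Measurable fun p : ℕ × ℕ × Path N S A => mainGain G est i p.2.2 p.1 p.2.1 :=
    measurable_from_prod_countable_right fun k =>
      measurable_from_prod_countable_right fun n => measurable_mainGain G est i k n
  have h2 : Measurable fun p : ℕ × Path N S A => rolloutSum G i p.2 0 p.1 :=
    measurable_from_prod_countable_right fun n => measurable_rolloutSum G i 0 n
  have h3 := (h1.comp (f := fun e : Episode N S A => (e.1.1, e.1.2.1, e.1.2.2.2))
    (by fun_prop)).sub ((h2.comp (f := fun e : Episode N S A => (e.1.2.2.1, e.2))
      (by fun_prop)).const_mul (baselineCoeff est))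
  have e : (gain G est i : Episode N S A → ℝ) = fun e => mainGain G est i e.1.2.2.2 e.1.1 e.1.2.1 -
      baselineCoeff est * rolloutSum G i e.2 0 e.1.2.2.1 := funext fun e => gain_eq G est i e
  rw [e]
  exact h3

end EpisodeExpectation

/-! ### Expected stochastic gradients -/

section ExpectedGradient

variable {N : ℕ} {M : Fin N → ℕ} {S A : Type*} [MeasurableSpace S] [MeasurableSpace A]
  {ν : Measure A} [SigmaFinite ν] {G : MarkovGame N S A} {π : PolicyFamily M S A ν}
  {b : Fin N → Params M} {lam f : S × (Fin N → A) → ℝ} {c d R : ℝ}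

namespace CondBdd

lemma integral_pathLaw_rolloutSum (hl : CondBdd π b lam c) (hr : BoundedRewards G R) (i : Fin N)
    (k j n : ℕ) :
    ∫ x, lam (x k) * rolloutSum G i x (k + j) n ∂pathLaw G π b =
      ∑ m ∈ Finset.range (n + 1), Real.sqrt G.γ ^ m *
        ∫ x, lam (x k) * G.r i (x (k + (j + m))) ∂pathLaw G π b := by
  unfold rolloutSum
  simp_rw [Finset.mul_sum]
  rw [integral_finsetSum]
  · refine Finset.sum_congr rfl fun m _ => ?_
    rw [← integral_const_mul]
    refine integral_congr_ae (Eventually.of_forall fun x => ?_)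
    simp only [add_assoc]
    ring
  · intro m _
    refine (hl.integrable_pathLaw k).mul_bdd (c := Real.sqrt G.γ ^ m * R)
      (((G.measurable_r i).comp (measurable_pi_apply _)).const_mul _).aestronglyMeasurable
      (Eventually.of_forall fun x => ?_)
    rw [norm_mul, Real.norm_of_nonneg (pow_nonneg (Real.sqrt_nonneg _) m)]
    exact mul_le_mul_of_nonneg_left (hr i _) (pow_nonneg (Real.sqrt_nonneg _) m)

/-- The weight `√γ ^ m` and the probability `√γ ^ m` that the horizon is at least `m` combine to `γ
^ m`. The offset `j` is 0 for rollouts from `T₁` and 1 for the temporal difference. -/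
lemma integral_horizon_rolloutSum (hl : CondBdd π b lam c) (hc : 0 ≤ c) (hR : 0 ≤ R)
    (hr : BoundedRewards G R) (i : Fin N) (k j : ℕ) :
    ∫ n, ∫ x, lam (x k) * rolloutSum G i x (k + j) n ∂pathLaw G π b ∂horizonLaw₂ G =
      ∑' m : ℕ, G.γ ^ m * ∫ x, lam (x k) * G.r i (x (k + (j + m))) ∂pathLaw G π b := by
  have hrb : BddMeas (G.r i) R := ⟨G.measurable_r i, hr i⟩
  simp_rw [hl.integral_pathLaw_rolloutSum hr]
  rw [integral_horizonLaw₂, tsum_geometric_mul_sum_range (Real.sqrt_nonneg _) G.sqrt_γ_lt_one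
    (fun m => hl.abs_integral_pathLaw_mul_le hc hrb hR k (j + m)), Real.sq_sqrt G.γ_pos.le]

/-- Averaged over the second horizon, the main part of the gain has the same correlation with `lam`
as the `Q`-function. -/
lemma integral_horizon_mainGain (hl : CondBdd π b lam c) (hc : 0 ≤ c) (hR : 0 ≤ R)
    (hr : BoundedRewards G R) (est : GainEstimator) (i : Fin N) (k : ℕ) :
    ∫ n, ∫ x, lam (x k) * mainGain G est i x k n ∂pathLaw G π b ∂horizonLaw₂ G =
      ∫ z, lam z * qFn G π b (G.r i) z ∂stateActionLaw G π b k := by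
  have hrb : BddMeas (G.r i) R := ⟨G.measurable_r i, hr i⟩
  have h0 := hl.integral_horizon_rolloutSum hc hR hr i k 0
  simp only [zero_add, add_zero] at h0
  rw [hl.tsum_integral_pathLaw_mul hrb] at h0
  cases est
  · exact h0
  · exact h0
  · have hb := fun m => hl.abs_integral_pathLaw_mul_le (G := G) hc hrb hR k m
    have h1 := hl.integral_horizon_rolloutSum hc hR hr i k 1
    have hs := summable_discounted G.γ_pos.le G.γ_lt_one hb
    -- For the temporal difference the reward at `T₁` is the term of order zero, and `γ` times the
    -- rollout from `T₁ + 1` supplies the shifted remainder of the series.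
    rw [← hl.tsum_integral_pathLaw_mul hrb, hs.tsum_eq_zero_add]
    have h2 : ∀ n, ∫ x, lam (x k) * mainGain G .temporalDifference i x k n ∂pathLaw G π b =
        ∫ x, lam (x k) * G.r i (x (k + 0)) ∂pathLaw G π b +
          G.γ * ∫ x, lam (x k) * rolloutSum G i x (k + 1) n ∂pathLaw G π b := by
      intro n
      rw [← integral_const_mul, ← integral_add]
      · refine integral_congr_ae (Eventually.of_forall fun x => ?_)
        simp only [mainGain, add_zero]
        ring
      · exact (hl.integrable_pathLaw k).mul_bdd (c := R)
          ((G.measurable_r i).comp (measurable_pi_apply _)).aestronglyMeasurable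
          (Eventually.of_forall fun x => hr i _)
      · exact ((hl.integrable_pathLaw k).mul_bdd (c := (1 - Real.sqrt G.γ)⁻¹ * R)
          (measurable_rolloutSum G i _ _).aestronglyMeasurable
          (Eventually.of_forall fun x => abs_rolloutSum_le hr i x _ _)).const_mul _
    simp_rw [h2]
    have h3 : Integrable (fun n => ∫ x, lam (x k) * rolloutSum G i x (k + 1) n ∂pathLaw G π b)
        (horizonLaw₂ G) := by
      refine Integrable.of_bound (C := c * ((1 - Real.sqrt G.γ)⁻¹ * R))
        (measurable_of_countable _).aestronglyMeasurable (Eventually.of_forall fun n => ?_)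
      have hq : 0 ≤ (1 - Real.sqrt G.γ)⁻¹ := inv_nonneg.2 (by linarith [G.sqrt_γ_lt_one])
      refine abs_integral_le_of_lintegral_le hc (by positivity)
        (fun x => abs_rolloutSum_le hr i x _ _) ?_
      exact (lintegral_pathLaw_eval k hl.meas.enorm).le.trans
        (lintegral_stateActionLaw_le k hl.meas.enorm hl.bound)
    rw [integral_add (integrable_const _) (h3.const_mul _), integral_const_mul, h1,
      integral_const, ← tsum_mul_left]
    simp only [probReal_univ, one_smul, pow_zero, one_mul]
    congr 1
    refine tsum_congr fun m => ?_
    rw [add_comm 1 m]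
    ring

lemma integrable_episodeLaw_mul_gain (hl : CondBdd π b lam c) (hr : BoundedRewards G R)
    (est : GainEstimator) (i : Fin N) :
    Integrable (fun e => lam (e.main e.T₁) * gain G est i e) (episodeLaw G π b) :=
  hl.integrable_episodeLaw.mul_bdd (c := 3 * ((1 - Real.sqrt G.γ)⁻¹ * R))
    (measurable_gain G est i).aestronglyMeasurable
    (Eventually.of_forall fun e => abs_gain_le hr est i e)

/-- The expected value of a rollout of length `l` as a function of the initial state. -/
lemma bddMeas_rollout (hr : BoundedRewards G R) (i : Fin N) (l : ℕ) :
    BddMeas (fun s => ∫ y, rolloutSum G i y 0 l ∂pathKernel G π b s)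
      ((1 - Real.sqrt G.γ)⁻¹ * R) :=
  BddMeas.integral_kernel ⟨measurable_rolloutSum G i 0 l, fun y => abs_rolloutSum_le hr i y 0 l⟩ _

/-- The conditional expectation of the integrand given the horizons and the trajectory. -/
lemma integral_episodeLaw_mul_gain (hl : CondBdd π b lam c) (hc : 0 ≤ c) (hR : 0 ≤ R)
    (hr : BoundedRewards G R) (est : GainEstimator) (i : Fin N) :
    ∫ e, lam (e.main e.T₁) * gain G est i e ∂episodeLaw G π b =
      ∫ k, (∫ z, lam z * qFn G π b (G.r i) z ∂stateActionLaw G π b k -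
        baselineCoeff est * ∫ l, ∫ z, lam z * (∫ y, rolloutSum G i y 0 l ∂pathKernel G π b z.1)
          ∂stateActionLaw G π b k ∂horizonLaw₂ G) ∂horizonLaw₁ G := by
  have hq : 0 ≤ (1 - Real.sqrt G.γ)⁻¹ := inv_nonneg.2 (by linarith [G.sqrt_γ_lt_one])
  set ρ := (1 - Real.sqrt G.γ)⁻¹ * R with hρ
  have hρ0 : 0 ≤ ρ := by positivity
  set ψ : ℕ → S → ℝ := fun l s => ∫ y, rolloutSum G i y 0 l ∂pathKernel G π b s with hψ
  have hψb : ∀ l, BddMeas (ψ l) ρ := fun l => bddMeas_rollout hr i l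
  -- `H` is the integrand after the extra rollout has been integrated out: given the trajectory it
  -- enters only through its mean `ψ l` at the state reached at `T₁`.
  set H : ℕ → ℕ → ℕ → Path N S A → ℝ := fun k n l x =>
    lam (x k) * (mainGain G est i x k n - baselineCoeff est * ψ l (x k).1) with hH
  have hcoef : ∀ l x k, |baselineCoeff est * ψ l ((x : Path N S A) k).1| ≤ ρ := fun l x k => by
    rw [abs_mul, abs_of_nonneg (baselineCoeff_mem est).1]
    exact (mul_le_of_le_one_left (abs_nonneg _) (baselineCoeff_mem est).2).trans
      ((hψb l).bound _)
  have hHb : ∀ k n l x, ‖H k n l x‖ ≤ ‖lam (x k)‖ * (3 * ρ) := fun k n l x => by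
    rw [hH, norm_mul]
    refine mul_le_mul_of_nonneg_left ((abs_sub _ _).trans ?_) (norm_nonneg _)
    linarith [abs_mainGain_le hr est i x k n, hcoef l x k]
  have hHm : ∀ k n l, Measurable (H k n l) := fun k n l =>
    (hl.meas.comp (measurable_pi_apply k)).mul ((measurable_mainGain G est i k n).sub
      (((hψb l).meas.comp (measurable_fst.comp (measurable_pi_apply k))).const_mul _))
  have hHm1 : ∀ k n, Measurable fun p : ℕ × Path N S A => H k n p.1 p.2 := fun k n =>
    measurable_from_prod_countable_right fun l => hHm k n l
  have hHm2 : ∀ k, Measurable fun p : ℕ × ℕ × Path N S A => H k p.1 p.2.1 p.2.2 := fun k =>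
    measurable_from_prod_countable_right fun n => hHm1 k n
  have hI0 : ∀ k, Integrable (fun x => ‖lam (x k)‖ * (3 * ρ)) (pathLaw G π b) := fun k =>
    (hl.integrable_pathLaw k).norm.mul_const _
  have hI1 : ∀ k n, Integrable (fun p : ℕ × Path N S A => H k n p.1 p.2)
      ((horizonLaw₂ G).prod (pathLaw G π b)) := fun k n =>
    ((hI0 k).comp_snd (horizonLaw₂ G)).mono' (hHm1 k n).aestronglyMeasurable
      (Eventually.of_forall fun p => hHb k n p.1 p.2)
  have hI2 : ∀ k, Integrable (fun p : ℕ × ℕ × Path N S A => H k p.1 p.2.1 p.2.2)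
      ((horizonLaw₂ G).prod ((horizonLaw₂ G).prod (pathLaw G π b))) := fun k =>
    (((hI0 k).comp_snd (horizonLaw₂ G)).comp_snd (horizonLaw₂ G)).mono' (hHm2 k).aestronglyMeasurable
      (Eventually.of_forall fun p => hHb k p.1 p.2.1 p.2.2)
  have hmain := hl.integrable_episodeLaw_mul_gain hr est i
  have hstep : ∀ e : ℕ × ℕ × ℕ × Path N S A,
      ∫ y, lam (Episode.main (e, y) (Episode.T₁ (e, y))) * gain G est i (e, y)
        ∂((pathKernel G π b).comap (fun e : ℕ × ℕ × ℕ × Path N S A => (e.2.2.2 e.1).1)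
          measurable_state_at_horizon) e = H e.1 e.2.1 e.2.2.1 e.2.2.2 := by
    intro e
    simp only [gain_eq, Episode.main, Episode.T₁, Episode.T₂, Episode.T₃, Episode.extra,
      Kernel.comap_apply]
    rw [integral_const_mul, integral_sub (integrable_const _), integral_const, integral_const_mul]
    · simp [hH, hψ]
    · exact (BddMeas.integrable ⟨measurable_rolloutSum G i 0 _, fun y =>
        abs_rolloutSum_le hr i y 0 _⟩ _).const_mul _
  have hmain2 := hmain
  rw [episodeLaw] at hmain2 ⊢
  have h1 := Measure.integral_compProd hmain2
  rw [Measure.compProd] at hmain2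
  have hI3 := hmain2.integral_compProd
  simp only [Kernel.prodMkLeft_apply, Kernel.const_apply] at hI3
  simp only [hstep] at h1 hI3
  rw [h1, integral_prod _ hI3]
  refine integral_congr_ae (Eventually.of_forall fun k => ?_)
  have h2 := integral_prod _ (hI2 k)
  have e2 : ∀ n, ∫ p : ℕ × Path N S A, H k n p.1 p.2 ∂((horizonLaw₂ G).prod (pathLaw G π b)) =
      ∫ l, (∫ x, lam (x k) * mainGain G est i x k n ∂pathLaw G π b -
        baselineCoeff est * ∫ z, lam z * ψ l z.1 ∂stateActionLaw G π b k) ∂horizonLaw₂ G := by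
    intro n
    rw [integral_prod _ (hI1 k n)]
    refine integral_congr_ae (Eventually.of_forall fun l => ?_)
    have e3 : ∫ z, lam z * ψ l z.1 ∂stateActionLaw G π b k =
        ∫ x, lam (x k) * ψ l (x k).1 ∂pathLaw G π b := by
      have hm : Measurable fun z : S × (Fin N → A) => lam z * ψ l z.1 :=
        hl.meas.mul ((hψb l).meas.comp measurable_fst)
      rw [← map_eval_pathLaw, integral_map (measurable_pi_apply k).aemeasurable
        hm.aestronglyMeasurable]
    simp only
    rw [e3, ← integral_const_mul, ← integral_sub]
    · refine integral_congr_ae (Eventually.of_forall fun x => ?_)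
      simp only [hH]
      ring
    · exact (hl.integrable_pathLaw k).mul_bdd (c := 2 * ρ)
        (measurable_mainGain G est i k n).aestronglyMeasurable
        (Eventually.of_forall fun x => abs_mainGain_le hr est i x k n)
    · exact ((hl.integrable_pathLaw k).mul_bdd (c := ρ)
        ((hψb l).meas.comp (measurable_fst.comp (measurable_pi_apply k))).aestronglyMeasurable
        (Eventually.of_forall fun x => (hψb l).bound _)).const_mul _
  have hlam : ∫⁻ z, ‖lam z‖ₑ ∂stateActionLaw G π b k ≤ ENNReal.ofReal c :=
    lintegral_stateActionLaw_le k hl.meas.enorm hl.bound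
  have hint1 : Integrable (fun l => ∫ z, lam z * ψ l z.1 ∂stateActionLaw G π b k)
      (horizonLaw₂ G) := by
    refine Integrable.of_bound (C := c * ρ) (measurable_of_countable _).aestronglyMeasurable
      (Eventually.of_forall fun l => ?_)
    exact abs_integral_le_of_lintegral_le hc hρ0 (fun z => (hψb l).bound _) hlam
  have hint2 : Integrable (fun n => ∫ x, lam (x k) * mainGain G est i x k n ∂pathLaw G π b)
      (horizonLaw₂ G) := by
    refine Integrable.of_bound (C := c * (2 * ρ)) (measurable_of_countable _).aestronglyMeasurable
      (Eventually.of_forall fun n => ?_)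
    refine abs_integral_le_of_lintegral_le hc (by positivity)
      (fun x => abs_mainGain_le hr est i x k n) ?_
    exact (lintegral_pathLaw_eval k hl.meas.enorm).le.trans hlam
  refine h2.trans ?_
  simp only [e2]
  simp_rw [integral_sub (integrable_const _) (hint1.const_mul _), integral_const_mul]
  rw [integral_sub (by simpa using hint2) (integrable_const _)]
  simp only [integral_const, probReal_univ, one_smul]
  rw [hl.integral_horizon_mainGain hc hR hr]

end CondBdd

variable {B V Λ : ℝ}

lemma ScoreBounds.condBdd_dirScore (h : ScoreBounds π B V Λ) (hB : 0 ≤ B) (hΛ : 0 ≤ Λ)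
    (b : Fin N → Params M) (θ v : Params M) :
    CondBdd π b (fun z => π.dirScore (fun _ => θ) (fun _ => v) z.1 z.2)
      (‖v‖ * (N ^ 2 * B + N * Λ * beliefDist b (fun _ => θ))) :=
  ⟨π.measurable_dirScore _ _, fun s => h.lintegral_dirScore_le hB hΛ b θ v s⟩

/-- The main part of the gain reproduces the occupancy integral exactly, with normalization `1 - γ`
from the law of `T₁`. The entire error is the baseline, which would vanish if scores and actions
used the same parameters. -/
lemma ScoreBounds.abs_integral_gain_sub_occ_le (h : ScoreBounds π B V Λ) (hB : 0 ≤ B) (hΛ : 0 ≤ Λ)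
    (hR : 0 ≤ R) (hr : BoundedRewards G R) (est : GainEstimator) (i : Fin N)
    (b : Fin N → Params M) (θ θ' v : Params M) :
    |∫ e : Episode N S A, π.dirScore (fun _ => θ') (fun _ => v) (e.main e.T₁).1 (e.main e.T₁).2 *
        gain G est i e ∂episodeLaw G π b -
      (1 - G.γ) * occ G π b (scoreAvg π b θ' v (qFn G π b (G.r i)))| ≤
      (N ^ 2 * Λ * ‖θ' - θ‖ + policyLip N B V Λ * beliefDist b (fun _ => θ)) * ‖v‖ *
        ((1 - Real.sqrt G.γ)⁻¹ * R) := by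
  have hq : 0 ≤ (1 - Real.sqrt G.γ)⁻¹ := inv_nonneg.2 (by linarith [G.sqrt_γ_lt_one])
  have hg : 0 ≤ (1 - G.γ)⁻¹ := inv_nonneg.2 (by linarith [G.γ_lt_one])
  have he := beliefDist_nonneg b (fun _ => θ')
  have hrb : BddMeas (G.r i) R := ⟨G.measurable_r i, hr i⟩
  have hl := h.condBdd_dirScore hB hΛ b θ' v
  set lam : S × (Fin N → A) → ℝ := fun z => π.dirScore (fun _ => θ') (fun _ => v) z.1 z.2 with hlam
  have hqb := hrb.qFn (G := G) (π := π) (b := b)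
  have hsa := h.bddMeas_scoreAvg hB hΛ b θ' v hqb (by positivity)
  set β : ℕ → ℝ := fun k => ∫ l, ∫ z, lam z * (∫ y, rolloutSum G i y 0 l ∂pathKernel G π b z.1)
    ∂stateActionLaw G π b k ∂horizonLaw₂ G with hβ
  set c' := (N ^ 2 * Λ * ‖θ' - θ‖ + policyLip N B V Λ * beliefDist b (fun _ => θ)) * ‖v‖ *
    ((1 - Real.sqrt G.γ)⁻¹ * R) with hc'
  have hβb : ∀ k, |β k| ≤ c' := by
    intro k
    refine BddMeas.abs_integral_le ⟨measurable_of_countable _, fun l => ?_⟩ _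
    have hψ := CondBdd.bddMeas_rollout (π := π) (b := b) hr i l
    have hψ2 : BddMeas (fun z : S × (Fin N → A) => ∫ y, rolloutSum G i y 0 l
      ∂pathKernel G π b z.1) ((1 - Real.sqrt G.γ)⁻¹ * R) := hψ.comp measurable_fst
    rw [hl.integral_stateActionLaw_mul hψ2]
    exact BddMeas.abs_integral_le ⟨measurable_scoreAvg π b θ' v hψ2.meas, fun s =>
      h.abs_scoreAvg_baseline_le hB hΛ b θ θ' v hψ (by positivity) s⟩ _
  have h1 := hl.integral_episodeLaw_mul_gain (by positivity) hR hr est i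
  have h2 : ∀ k, ∫ z, lam z * qFn G π b (G.r i) z ∂stateActionLaw G π b k =
      ∫ s, scoreAvg π b θ' v (qFn G π b (G.r i)) s ∂stateLaw G π b k := fun k =>
    hl.integral_stateActionLaw_mul hqb k
  have h3 : (1 - G.γ) * occ G π b (scoreAvg π b θ' v (qFn G π b (G.r i))) =
      ∫ k, ∫ s, scoreAvg π b θ' v (qFn G π b (G.r i)) s ∂stateLaw G π b k ∂horizonLaw₁ G := by
    rw [integral_horizonLaw₁, occ, ← tsum_mul_left]
    exact tsum_congr fun k => by ring
  have i1 : Integrable (fun k => ∫ s, scoreAvg π b θ' v (qFn G π b (G.r i)) s ∂stateLaw G π b k)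
      (horizonLaw₁ G) :=
    Integrable.of_bound (measurable_of_countable _).aestronglyMeasurable _
      (Eventually.of_forall fun k => hsa.abs_integral_le _)
  have i2 : Integrable β (horizonLaw₁ G) :=
    Integrable.of_bound (measurable_of_countable _).aestronglyMeasurable _
      (Eventually.of_forall hβb)
  rw [h3, h1]
  simp_rw [h2]
  rw [integral_sub i1 (i2.const_mul _), sub_sub_cancel_left, abs_neg, integral_const_mul, abs_mul,
    abs_of_nonneg (baselineCoeff_mem est).1]
  exact (mul_le_of_le_one_left (abs_nonneg _) (baselineCoeff_mem est).2).trans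
    (BddMeas.abs_integral_le ⟨measurable_of_countable _, hβb⟩ _)

end ExpectedGradient

/-! ### Stochastic gradients -/

section StochGrad

variable {N : ℕ} {M : Fin N → ℕ} {S A : Type*} [MeasurableSpace S] [MeasurableSpace A]
  {ν : Measure A} {G : MarkovGame N S A} {π : PolicyFamily M S A ν}
  {R B V Λ : ℝ}

lemma ScoreBounds.measurable_score_uncurry [SigmaFinite ν] (h : ScoreBounds π B V Λ) (hΛ : 0 ≤ Λ)
    (i n : Fin N) : Measurable fun p : Params M × S × A => π.score i n p.1 p.2.1 p.2.2 := by
  refine measurable_uncurry_of_continuous_of_measurable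
    (u := fun θ (x : S × A) => π.score i n θ x.1 x.2) (fun x => ?_)
    (fun θ => π.measurable_score i n θ)
  refine LipschitzWith.continuous (K := ⟨Λ, hΛ⟩) (LipschitzWith.of_dist_le_mul fun θ₁ θ₂ => ?_)
  rw [dist_eq_norm, dist_eq_norm]
  exact h.lipschitz i n θ₁ θ₂ x.1 x.2

lemma ScoreBounds.measurable_fullScore_uncurry [SigmaFinite ν] (h : ScoreBounds π B V Λ)
    (hΛ : 0 ≤ Λ) (n : Fin N) :
    Measurable fun p : Params M × S × A => π.fullScore n p.1 p.2.1 p.2.2 := by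
  unfold PolicyFamily.fullScore
  exact (WithLp.measurable_toLp 2 _).comp (f := fun (p : Params M × S × A) i =>
    π.score i n p.1 p.2.1 p.2.2) (measurable_pi_lambda _ fun i => h.measurable_score_uncurry hΛ i n)

lemma ScoreBounds.measurable_scoreSum_uncurry [SigmaFinite ν] (h : ScoreBounds π B V Λ)
    (hΛ : 0 ≤ Λ) :
    Measurable fun p : (Fin N → Params M) × S × (Fin N → A) => π.scoreSum p.1 p.2.1 p.2.2 := by
  unfold PolicyFamily.scoreSum
  refine Finset.measurable_sum _ fun n _ => ?_
  have h2 := (h.measurable_fullScore_uncurry hΛ n).norm.comp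
    (f := fun p : (Fin N → Params M) × S × (Fin N → A) => (p.1 n, p.2.1, p.2.2 n)) (by fun_prop)
  exact h2

lemma ScoreBounds.measurable_stochGrad [SigmaFinite ν] (h : ScoreBounds π B V Λ) (hΛ : 0 ≤ Λ)
    (G : MarkovGame N S A) (est : GainEstimator) (i : Fin N) :
    Measurable fun p : Params M × Episode N S A => stochGrad G π est i p.1 p.2 := by
  unfold stochGrad
  refine Measurable.smul (((measurable_gain G est i).comp measurable_snd).const_mul _)
    (Finset.measurable_sum _ fun n _ => ?_)
  have hx : Measurable fun e : Episode N S A => e.main e.T₁ := Episode.measurable_main_T₁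
  have h2 := (h.measurable_score_uncurry hΛ i n).comp
    (f := fun p : Params M × Episode N S A =>
      (p.1, (p.2.main p.2.T₁).1, (p.2.main p.2.T₁).2 n))
    (measurable_fst.prodMk (((measurable_fst_eval n).comp hx).comp measurable_snd))
  exact h2

/-- The factor in front of the scores is at most this constant. -/
def gainConst (γ R : ℝ) : ℝ := (1 - γ)⁻¹ * (3 * ((1 - Real.sqrt γ)⁻¹ * R))

lemma gainConst_nonneg {γ : ℝ} (hγ : γ < 1) (hγ' : Real.sqrt γ < 1) (hR : 0 ≤ R) :
    0 ≤ gainConst γ R := by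
  have h1 : 0 ≤ (1 - γ)⁻¹ := inv_nonneg.2 (by linarith)
  have h2 : 0 ≤ (1 - Real.sqrt γ)⁻¹ := inv_nonneg.2 (by linarith)
  unfold gainConst
  positivity

/-- Testing against a fixed vector turns the gradient into a directional score times the gain, so
scalar correlation formulas suffice. -/
lemma inner_stochGrad (est : GainEstimator) (i : Fin N) (θ : Params M) (e : Episode N S A)
    (y : EuclideanSpace ℝ (Fin (M i))) :
    inner ℝ (stochGrad G π est i θ e) y = (1 - G.γ)⁻¹ *
      (π.dirScore (fun _ => θ) (fun _ => Params.single i y) (e.main e.T₁).1 (e.main e.T₁).2 *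
        gain G est i e) := by
  rw [stochGrad, real_inner_smul_left, sum_inner, PolicyFamily.dirScore]
  simp_rw [Params.inner_single, π.fullScore_apply]
  ring

/-- The scores are evaluated at `θ`, while `b` generates the actions. Moving the score sum to `b`
brings its second moment under control at the price of a mismatch term; this is the splitting X + Y
of the descent estimate. -/
lemma ScoreBounds.norm_stochGrad_le (h : ScoreBounds π B V Λ) (hr : BoundedRewards G R)
    (hR : 0 ≤ R) (est : GainEstimator) (i : Fin N) (b : Fin N → Params M) (θ : Params M)
    (e : Episode N S A) :
    ‖stochGrad G π est i θ e‖ ≤ gainConst G.γ R *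
      (π.scoreSum b (e.main e.T₁).1 (e.main e.T₁).2 + N * Λ * beliefDist (fun _ => θ) b) := by
  have hg : 0 ≤ (1 - G.γ)⁻¹ := inv_nonneg.2 (by linarith [G.γ_lt_one])
  have h1 : ‖∑ n, π.score i n θ (e.main e.T₁).1 ((e.main e.T₁).2 n)‖ ≤
      π.scoreSum (fun _ => θ) (e.main e.T₁).1 (e.main e.T₁).2 := by
    rw [PolicyFamily.scoreSum]
    refine (norm_sum_le _ _).trans (Finset.sum_le_sum fun n _ => ?_)
    rw [← π.fullScore_apply]
    exact Params.norm_apply_le _ i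
  have h2 := h.scoreSum_le_add (fun _ => θ) b (e.main e.T₁).1 (e.main e.T₁).2
  rw [stochGrad, norm_smul, norm_mul, Real.norm_of_nonneg hg, Real.norm_eq_abs, gainConst]
  have h3 := abs_gain_le hr est i e
  have h4 : 0 ≤ (1 - Real.sqrt G.γ)⁻¹ := inv_nonneg.2 (by linarith [G.sqrt_γ_lt_one])
  exact mul_le_mul (mul_le_mul_of_nonneg_left h3 hg) (h1.trans h2) (norm_nonneg _) (by positivity)

variable [SigmaFinite ν]

instance (G : MarkovGame N S A) (π : PolicyFamily M S A ν) (b : Fin N → Params M) :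
    IsProbabilityMeasure (episodeLaw G π b) := by
  rw [← episodeKernel_apply]; infer_instance

lemma ScoreBounds.lintegral_episodeLaw_quadratic_le (h : ScoreBounds π B V Λ) (hB : 0 ≤ B)
    (b : Fin N → Params M) {f : Episode N S A → ℝ} {c₀ c₁ c₂ : ℝ} (h₀ : 0 ≤ c₀) (h₁ : 0 ≤ c₁)
    (h₂ : 0 ≤ c₂)
    (hf : ∀ e, |f e| ≤ c₀ + c₁ * π.scoreSum b (e.main e.T₁).1 (e.main e.T₁).2 +
      c₂ * π.scoreSum b (e.main e.T₁).1 (e.main e.T₁).2 ^ 2) :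
    ∫⁻ e, ‖f e‖ₑ ∂episodeLaw G π b ≤
      ENNReal.ofReal (c₀ + c₁ * (N ^ 2 * B) + c₂ * (N ^ 3 * V ^ 2)) := by
  have hm := π.measurable_scoreSum b
  exact lintegral_le_of_abs_le_quadratic
    (G := fun e : Episode N S A => π.scoreSum b (e.main e.T₁).1 (e.main e.T₁).2)
    (hm.comp Episode.measurable_main_T₁) (fun e => π.scoreSum_nonneg b _ _)
    (lintegral_episodeLaw_le (φ := fun z => ENNReal.ofReal (π.scoreSum b z.1 z.2))
      hm.ennreal_ofReal (h.lintegral_scoreSum_le b))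
    (lintegral_episodeLaw_le (φ := fun z => ENNReal.ofReal (π.scoreSum b z.1 z.2 ^ 2))
      (hm.pow_const 2).ennreal_ofReal (h.lintegral_scoreSum_sq_le b))
    (by positivity) (by positivity) h₀ h₁ h₂ hf

/-- The expected norm of a stochastic gradient. -/
lemma ScoreBounds.lintegral_norm_stochGrad_le (h : ScoreBounds π B V Λ) (hB : 0 ≤ B) (hΛ : 0 ≤ Λ)
    (hr : BoundedRewards G R) (hR : 0 ≤ R) (est : GainEstimator) (i : Fin N)
    (b : Fin N → Params M) (θ : Params M) :
    ∫⁻ e, ‖stochGrad G π est i θ e‖ₑ ∂episodeLaw G π b ≤ ENNReal.ofReal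
      (gainConst G.γ R * (N ^ 2 * B + N * Λ * beliefDist (fun _ => θ) b)) := by
  have hg := gainConst_nonneg G.γ_lt_one G.sqrt_γ_lt_one hR
  have he := beliefDist_nonneg (fun _ => θ) b
  have h1 := h.lintegral_episodeLaw_quadratic_le (G := G) hB b
    (f := fun e => ‖stochGrad G π est i θ e‖)
    (c₀ := gainConst G.γ R * (N * Λ * beliefDist (fun _ => θ) b)) (c₁ := gainConst G.γ R)
    (c₂ := 0) (by positivity) hg le_rfl (fun e => by
      rw [abs_norm]
      exact (h.norm_stochGrad_le hr hR est i b θ e).trans (le_of_eq (by ring)))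
  simp only [enorm_norm] at h1
  exact h1.trans (ENNReal.ofReal_le_ofReal (le_of_eq (by ring)))

/-- The constant for the bias of the stochastic gradients. -/
def biasConst (N : ℕ) (γ R B V Λ : ℝ) : ℝ :=
  gradLip N γ R B V Λ +
    (1 - γ)⁻¹ * ((N ^ 2 * Λ + policyLip N B V Λ) * ((1 - Real.sqrt γ)⁻¹ * R))

lemma biasConst_nonneg {γ : ℝ} (hγ : γ < 1) (hγ' : Real.sqrt γ < 1) (hR : 0 ≤ R) (hB : 0 ≤ B)
    (hΛ : 0 ≤ Λ) : 0 ≤ biasConst N γ R B V Λ := by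
  have h1 : 0 ≤ (1 - γ)⁻¹ := inv_nonneg.2 (by linarith)
  have h2 : 0 ≤ (1 - Real.sqrt γ)⁻¹ := inv_nonneg.2 (by linarith)
  have h3 := gradLip_nonneg (N := N) (V := V) hγ hR hB hΛ
  have h4 := policyLip_nonneg (N := N) (V := V) hB hΛ
  unfold biasConst
  positivity

lemma ScoreBounds.integrable_inner_stochGrad (h : ScoreBounds π B V Λ) (hB : 0 ≤ B) (hΛ : 0 ≤ Λ)
    (hr : BoundedRewards G R) (est : GainEstimator) (i : Fin N)
    (b : Fin N → Params M) (θ : Params M) (y : EuclideanSpace ℝ (Fin (M i))) :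
    Integrable (fun e => inner ℝ (stochGrad G π est i θ e) y) (episodeLaw G π b) := by
  simp_rw [inner_stochGrad]
  exact ((h.condBdd_dirScore hB hΛ b θ (Params.single i y)).integrable_episodeLaw_mul_gain
    hr est i).const_mul _

/-- The bias of the stochastic gradient of agent `i` with scores evaluated at `θ'` and actions drawn
with the parameters `b`. -/
lemma ScoreBounds.abs_integral_inner_stochGrad_sub_le (h : ScoreBounds π B V Λ) (hB : 0 ≤ B)
    (hΛ : 0 ≤ Λ) (hR : 0 ≤ R) (hr : BoundedRewards G R) (est : GainEstimator) (i : Fin N)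
    (b : Fin N → Params M) (θ θ' : Params M) (y : EuclideanSpace ℝ (Fin (M i))) :
    |∫ e, inner ℝ (stochGrad G π est i θ' e) y ∂episodeLaw G π b -
      inner ℝ (blockGrad i (utility G π i) θ) y| ≤
      biasConst N G.γ R B V Λ * (‖θ' - θ‖ + beliefDist b (fun _ => θ)) * ‖y‖ := by
  have hg : 0 < 1 - G.γ := by linarith [G.γ_lt_one]
  have hgi : 0 ≤ (1 - G.γ)⁻¹ := inv_nonneg.2 hg.le
  have hq : 0 ≤ (1 - Real.sqrt G.γ)⁻¹ := inv_nonneg.2 (by linarith [G.sqrt_γ_lt_one])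
  have hL := policyLip_nonneg (N := N) (V := V) hB hΛ
  have he := beliefDist_nonneg b (fun _ => θ)
  have hrb : BddMeas (G.r i) R := ⟨G.measurable_r i, hr i⟩
  have h1 := h.abs_integral_gain_sub_occ_le hB hΛ hR hr est i b θ θ' (Params.single i y)
  have h2 := h.abs_occ_scoreAvg_sub_valueDeriv_le (G := G) hB hΛ hrb hR b θ θ'
    (Params.single i y)
  rw [Params.norm_single] at h1 h2
  simp_rw [inner_stochGrad]
  rw [integral_const_mul, h.inner_blockGrad_utility hB hΛ hR hr]
  set I := ∫ e : Episode N S A, π.dirScore (fun _ => θ') (fun _ => Params.single i y)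
    (e.main e.T₁).1 (e.main e.T₁).2 * gain G est i e ∂episodeLaw G π b
  set o := occ G π b (scoreAvg π b θ' (Params.single i y) (qFn G π b (G.r i)))
  -- The occupancy integral `o` serves as intermediate quantity: the first difference is the bias of
  -- the baseline, the second the mismatch of parameters.
  have e1 : (1 - G.γ)⁻¹ * I - valueDeriv G π (G.r i) θ (Params.single i y) =
      (1 - G.γ)⁻¹ * (I - (1 - G.γ) * o) + (o - valueDeriv G π (G.r i) θ (Params.single i y)) := by
    rw [mul_sub, inv_mul_cancel_left₀ hg.ne']
    ring
  rw [e1]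
  refine (abs_add_le _ _).trans ?_
  rw [abs_mul, abs_of_nonneg hgi]
  have h3 := mul_le_mul_of_nonneg_left h1 hgi
  refine (add_le_add h3 h2).trans ?_
  rw [← sub_nonneg]
  have p1 : 0 ≤ (1 - G.γ)⁻¹ * ((1 - Real.sqrt G.γ)⁻¹ * R) * ‖y‖ * (N ^ 2 * Λ) *
    beliefDist b (fun _ => θ) := by positivity
  have p2 : 0 ≤ (1 - G.γ)⁻¹ * ((1 - Real.sqrt G.γ)⁻¹ * R) * ‖y‖ * policyLip N B V Λ *
    ‖θ' - θ‖ := by positivity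
  refine (add_nonneg p1 p2).trans (le_of_eq ?_)
  rw [biasConst]
  ring

/-- The expected contribution of agent `i` to the decrease of the potential. -/
lemma ScoreBounds.integral_step_le (h : ScoreBounds π B V Λ) (hB : 0 ≤ B)
    (hΛ : 0 ≤ Λ) (hR : 0 ≤ R) (hr : BoundedRewards G R) (est : GainEstimator) (i : Fin N)
    (b : Fin N → Params M) (θ θ' : Params M) {a c : ℝ} (ha : 0 ≤ a) (hc : 0 ≤ c) :
    ∫ e, (-(a * inner ℝ (stochGrad G π est i θ' e) (blockGrad i (utility G π i) θ)) +
        c * π.scoreSum b (e.main e.T₁).1 (e.main e.T₁).2 ^ 2) ∂episodeLaw G π b ≤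
      -(a * ‖blockGrad i (utility G π i) θ‖ ^ 2) +
        a * (biasConst N G.γ R B V Λ * gradBound N G.γ R B) *
          (‖θ' - θ‖ + beliefDist b (fun _ => θ)) + c * (N ^ 3 * V ^ 2) := by
  set y := blockGrad i (utility G π i) θ with hy
  have he := beliefDist_nonneg b (fun _ => θ)
  have hbias := biasConst_nonneg (N := N) (V := V) G.γ_lt_one G.sqrt_γ_lt_one hR hB hΛ
  have i1 := h.integrable_inner_stochGrad hB hΛ hr est i b θ' y
  have hsq := h.lintegral_episodeLaw_quadratic_le (G := G) hB b
    (f := fun e => π.scoreSum b (e.main e.T₁).1 (e.main e.T₁).2 ^ 2) (c₀ := 0) (c₁ := 0) (c₂ := 1)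
    le_rfl le_rfl zero_le_one (fun e => by rw [abs_of_nonneg (sq_nonneg _)]; simp)
  simp only [zero_mul, zero_add, one_mul] at hsq
  have hms : Measurable fun e : Episode N S A =>
      π.scoreSum b (e.main e.T₁).1 (e.main e.T₁).2 ^ 2 :=
    ((π.measurable_scoreSum b).comp Episode.measurable_main_T₁).pow_const 2
  have i2 : Integrable (fun e : Episode N S A =>
      π.scoreSum b (e.main e.T₁).1 (e.main e.T₁).2 ^ 2) (episodeLaw G π b) :=
    ⟨hms.aestronglyMeasurable, hsq.trans_lt ENNReal.ofReal_lt_top⟩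
  have h2 : ∫ e : Episode N S A, π.scoreSum b (e.main e.T₁).1 (e.main e.T₁).2 ^ 2
      ∂episodeLaw G π b ≤ N ^ 3 * V ^ 2 := by
    have := abs_integral_le_of_lintegral_le (g := fun _ => 1) (by positivity) zero_le_one
      (by simp) hsq
    simp only [mul_one] at this
    exact (le_abs_self _).trans this
  have i3 : Integrable (fun e => -(a * inner ℝ (stochGrad G π est i θ' e) y))
      (episodeLaw G π b) := (i1.const_mul a).neg
  rw [integral_add i3 (i2.const_mul c), integral_neg, integral_const_mul,
    integral_const_mul]
  -- The bias is tested against the true gradient `y` itself. Since `‖y‖` is bounded by `gradBound`,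
  -- the resulting error is linear in the belief errors.
  have h1 := h.abs_integral_inner_stochGrad_sub_le hB hΛ hR hr est i b θ θ' y
  rw [← hy, real_inner_self_eq_norm_sq] at h1
  have h3 := (abs_le.1 h1).1
  have h4 : ‖y‖ ≤ gradBound N G.γ R B := h.norm_blockGrad_utility_le hB hΛ hR hr i θ
  have h5 : biasConst N G.γ R B V Λ * (‖θ' - θ‖ + beliefDist b (fun _ => θ)) * ‖y‖ ≤
      biasConst N G.γ R B V Λ * (‖θ' - θ‖ + beliefDist b (fun _ => θ)) * gradBound N G.γ R B :=
    mul_le_mul_of_nonneg_left h4 (by positivity)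
  have h6 : ‖y‖ ^ 2 - biasConst N G.γ R B V Λ * (‖θ' - θ‖ + beliefDist b (fun _ => θ)) *
      gradBound N G.γ R B ≤ ∫ e, inner ℝ (stochGrad G π est i θ' e) y ∂episodeLaw G π b := by
    linarith
  have h7 := mul_le_mul_of_nonneg_left h6 ha
  have h8 := mul_le_mul_of_nonneg_left h2 hc
  linarith

end StochGrad

/-! ### Summability of perturbed contractions -/

/-- Summing the recursion bounds the shifted partial sum by `1 - c` times the partial sum plus a
constant, while the two differ by at most the first `K` terms. Solving gives a bound for all partial
sums. -/
lemma summable_of_shift_contraction {p q : ℕ → ℝ} {K : ℕ} {c : ℝ} (hc : 0 < c)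
    (hp : ∀ t, 0 ≤ p t) (hq : ∀ t, 0 ≤ q t) (hqs : Summable q)
    (h : ∀ t, p (t + K) ≤ (1 - c) * p t + q t) : Summable p := by
  refine summable_of_sum_range_le (c := (∑ t ∈ Finset.range K, p t + ∑' t, q t) / c) hp fun n => ?_
  have h1 : ∑ t ∈ Finset.range n, p (t + K) ≤
      (1 - c) * ∑ t ∈ Finset.range n, p t + ∑' t, q t := by
    calc _ ≤ ∑ t ∈ Finset.range n, ((1 - c) * p t + q t) := Finset.sum_le_sum fun t _ => h t
      _ = (1 - c) * ∑ t ∈ Finset.range n, p t + ∑ t ∈ Finset.range n, q t := by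
          rw [Finset.sum_add_distrib, Finset.mul_sum]
      _ ≤ _ := by linarith [hqs.sum_le_tsum (Finset.range n) fun t _ => hq t]
  have h2 : ∑ t ∈ Finset.range n, p t ≤
      ∑ t ∈ Finset.range K, p t + ∑ t ∈ Finset.range n, p (t + K) := by
    have e : ∑ t ∈ Finset.range (K + n), p t =
        ∑ t ∈ Finset.range K, p t + ∑ t ∈ Finset.range n, p (t + K) := by
      rw [Finset.sum_range_add]
      simp_rw [add_comm K]
    rw [← e]
    exact Finset.sum_le_sum_of_subset_of_nonneg
      (Finset.range_subset_range.2 (by omega)) fun t _ _ => hp t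
  rw [le_div_iff₀ hc]
  linarith

/-- A sequence that contracts every `K` steps, up to perturbations of relative size `a t`. -/
lemma summable_mul_of_contraction {y d a : ℕ → ℝ} {K : ℕ} {c C : ℝ} (hc : 0 < c)
    (hC : 0 ≤ C) (hy : ∀ t, 0 ≤ y t) (ha : ∀ t, 0 ≤ a t) (hanti : Antitone a)
    (has : Summable fun t => a t ^ 2) (hd : ∀ t, d t ≤ C * a t * (1 + y t))
    (hstep : ∀ t, y (t + 1) ≤ y t + d t)
    (hK : ∀ t, y (t + K) ≤ (1 - c) * y t + ∑ r ∈ Finset.range K, d (t + r)) :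
    Summable fun t => a t * y t := by
  set Γ := (1 + C * a 0) ^ K with hΓ
  have hbase : 1 ≤ 1 + C * a 0 := by linarith [mul_nonneg hC (ha 0)]
  -- Within a window of `K` steps `1 + y` grows by at most the fixed factor `Γ`, so all
  -- perturbations of the window are comparable to `a t * (1 + y t)`.
  have hgrow : ∀ t r, 1 + y (t + r) ≤ (1 + C * a 0) ^ r * (1 + y t) := by
    intro t r
    induction r with
    | zero => simp
    | succ r ih =>
      have h1 : C * a (t + r) ≤ C * a 0 := mul_le_mul_of_nonneg_left (hanti (Nat.zero_le _)) hC
      have h2 := mul_le_mul_of_nonneg_right h1 (by linarith [hy (t + r)] : 0 ≤ 1 + y (t + r))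
      have h3 := mul_le_mul_of_nonneg_left ih (by linarith : 0 ≤ 1 + C * a 0)
      have h4 := hstep (t + r)
      have h5 := hd (t + r)
      rw [← add_assoc, pow_succ]
      nlinarith
  have hdK : ∀ t, ∑ r ∈ Finset.range K, d (t + r) ≤ K * (C * Γ) * a t * (1 + y t) := by
    intro t
    calc _ ≤ ∑ _r ∈ Finset.range K, C * Γ * a t * (1 + y t) := by
          refine Finset.sum_le_sum fun r hr => (hd _).trans ?_
          have h1 : 1 + y (t + r) ≤ Γ * (1 + y t) := (hgrow t r).trans
            (mul_le_mul_of_nonneg_right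
              (pow_le_pow_right₀ hbase (Finset.mem_range.1 hr).le) (by linarith [hy t]))
          have h2 : C * a (t + r) ≤ C * a t := mul_le_mul_of_nonneg_left (hanti (by omega)) hC
          calc C * a (t + r) * (1 + y (t + r)) ≤ C * a t * (Γ * (1 + y t)) :=
                mul_le_mul h2 h1 (by linarith [hy (t + r)]) (mul_nonneg hC (ha t))
            _ = _ := by ring
      _ = _ := by
          rw [Finset.sum_const, Finset.card_range, nsmul_eq_mul]
          ring
  set C₂ := K * (C * Γ) with hC₂
  have hC₂0 : 0 ≤ C₂ := by positivity
  have ha0 : Tendsto (fun t => C₂ * a t) atTop (𝓝 0) := by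
    have h1 : Tendsto (fun t => Real.sqrt (a t ^ 2)) atTop (𝓝 0) := by
      have := has.tendsto_atTop_zero.sqrt
      simpa using this
    simp_rw [Real.sqrt_sq (ha _)] at h1
    simpa using h1.const_mul C₂
  -- Since `a t → 0`, from `t₁` on the part of the perturbation proportional to `y` uses up at most
  -- half of the contraction. The rest, multiplied by `a`, is `C₂ * a²`.
  obtain ⟨t₁, ht₁⟩ := eventually_atTop.1 (ha0.eventually_le_const (half_pos hc))
  rw [← summable_nat_add_iff t₁]
  refine summable_of_shift_contraction (K := K) (q := fun t => C₂ * a (t + t₁) ^ 2) (half_pos hc)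
    (fun t => mul_nonneg (ha _) (hy _)) (fun t => by positivity)
    (((summable_nat_add_iff t₁).2 has).mul_left C₂) fun t => ?_
  have h1 := hK (t + t₁)
  have h2 := hdK (t + t₁)
  have h3 := mul_le_mul_of_nonneg_right (ht₁ (t + t₁) (by omega)) (hy (t + t₁))
  have h4 : y (t + t₁ + K) ≤ (1 - c / 2) * y (t + t₁) + C₂ * a (t + t₁) := by nlinarith
  have h5 : a (t + K + t₁) ≤ a (t + t₁) := hanti (by omega)
  have e : t + K + t₁ = t + t₁ + K := by omega
  have h6 : 0 ≤ (1 - c / 2) * y (t + t₁) + C₂ * a (t + t₁) := (hy _).trans h4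
  calc a (t + K + t₁) * y (t + K + t₁)
      ≤ a (t + t₁) * ((1 - c / 2) * y (t + t₁) + C₂ * a (t + t₁)) := by
        rw [e] at h5 ⊢
        exact mul_le_mul h5 h4 (hy _) (ha _)
    _ = _ := by ring

/-! ### Consensus -/

lemma weighted_sum_le {N : ℕ} {W y : Fin N → ℝ} (hW : ∀ l, 0 ≤ W l) (hs : ∑ l, W l = 1)
    {a e h : ℝ} (hy : ∀ l, y l ≤ a) {l₀ : Fin N} (hl : y l₀ ≤ a - e) (he : 0 ≤ e)
    (hh : h ≤ W l₀) : ∑ l, W l * y l ≤ a - h * e := by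
  calc ∑ l, W l * y l ≤ ∑ l, W l * (a - if l = l₀ then e else 0) := by
        refine Finset.sum_le_sum fun l _ => mul_le_mul_of_nonneg_left ?_ (hW l)
        split_ifs with h1
        · rw [h1]; exact hl
        · simpa using hy l
    _ = a - W l₀ * e := by
        simp_rw [mul_sub]
        rw [Finset.sum_sub_distrib, ← Finset.sum_mul, hs, one_mul]
        simp
    _ ≤ a - h * e := by linarith [mul_le_mul_of_nonneg_right hh he]

section Consensus

variable {N : ℕ} {E : ℕ → Fin N → Fin N → Prop} {w : ℕ → Fin N → Fin N → Fin N → ℝ} {h : ℝ}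
  {x : ℕ → Fin N → ℝ} {d : ℕ → ℝ} {j : Fin N}

/-- Averages with stochastic weights cannot exceed the current maximum, so only the perturbations
accumulate. -/
lemma BeliefWeights.le_add_sum (hw : BeliefWeights E w h)
    (hx : ∀ t i, x (t + 1) i ≤ ∑ l, w (t + 1) i j l * x t l + d t) {t₀ : ℕ} {m : ℝ}
    (hm : ∀ l, x t₀ l ≤ m) (s : ℕ) (i : Fin N) :
    x (t₀ + s) i ≤ m + ∑ r ∈ Finset.range s, d (t₀ + r) := by
  induction s generalizing i with
  | zero => simpa using hm i
  | succ s ih =>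
    rw [Finset.sum_range_succ, ← add_assoc, ← add_assoc]
    refine (hx (t₀ + s) i).trans (add_le_add ?_ le_rfl)
    have := weighted_sum_le (fun l => hw.nonneg (t₀ + s + 1) (by omega) i j l)
      (hw.sum_eq_one (t₀ + s + 1) (by omega) i j) (e := 0) (l₀ := i) (fun l => ih l)
      (by simpa using ih i) le_rfl le_rfl
    simpa using this

/-- Information about the source `j` reaches every agent, after a uniformly bounded time. -/
lemma BeliefWeights.exists_contraction_time (hw : BeliefWeights E w h) (hE : ConnectedNetwork E)
    (hh : 0 ≤ h) (hh1 : h ≤ 1) (hd : ∀ t, 0 ≤ d t) (hxj : ∀ t, x t j = 0)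
    (hx : ∀ t i, x (t + 1) i ≤ ∑ l, w (t + 1) i j l * x t l + d t) (i : Fin N) :
    ∃ k, ∀ t₀ m, 0 ≤ m → (∀ l, x t₀ l ≤ m) → ∀ s, k ≤ s →
      x (t₀ + s) i ≤ (1 - h ^ s) * m + ∑ r ∈ Finset.range s, d (t₀ + r) := by
  obtain ⟨hconn, T, hT, hwin⟩ := hE
  have hj : ∀ t₀ m, 0 ≤ m → ∀ s, x (t₀ + s) j ≤
      (1 - h ^ s) * m + ∑ r ∈ Finset.range s, d (t₀ + r) := by
    intro t₀ m hm s
    rw [hxj]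
    have := pow_le_one₀ (n := s) hh hh1
    exact add_nonneg (mul_nonneg (by linarith) hm) (Finset.sum_nonneg fun r _ => hd _)
  -- Induction along a path of persistent edges from `i` to `j`, starting at the source, whose own
  -- error is zero. If `l` is good from time `k` on, agent `i` becomes good at the first use of the
  -- edge `(i, l)` in the following window of length `T`.
  refine Relation.ReflTransGen.head_induction_on (hconn i j) ⟨0, fun t₀ m hm _ s _ => hj t₀ m hm s⟩ ?_
  intro i l hil _ ⟨k, hk⟩
  rcases eq_or_ne i j with rfl | hij
  · exact ⟨0, fun t₀ m hm _ s _ => hj t₀ m hm s⟩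
  refine ⟨k + T, fun t₀ m hm hxm => ?_⟩
  obtain ⟨τ, hτ, hEτ⟩ := hwin i l hil (t₀ + k + 1) (by omega)
  -- Listening with weight at least `h` to an agent whose bound is lowered by `h ^ s * m` lowers the
  -- own bound by `h ^ (s + 1) * m`. The choice `l' = i` shows that goodness persists afterwards.
  have hstep : ∀ s l', (E (t₀ + s + 1) i l' ∨ l' = i) →
      x (t₀ + s) l' ≤ (1 - h ^ s) * m + ∑ r ∈ Finset.range s, d (t₀ + r) →
      x (t₀ + (s + 1)) i ≤ (1 - h ^ (s + 1)) * m + ∑ r ∈ Finset.range (s + 1), d (t₀ + r) := by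
    intro s l' hl' hxl
    have h1 := weighted_sum_le (fun l => hw.nonneg (t₀ + s + 1) (by omega) i j l)
      (hw.sum_eq_one (t₀ + s + 1) (by omega) i j) (y := x (t₀ + s))
      (a := m + ∑ r ∈ Finset.range s, d (t₀ + r)) (e := h ^ s * m) (l₀ := l') (h := h)
      (fun l => hw.le_add_sum hx hxm s l) (by linarith) (by positivity)
      (hw.lower_bound (t₀ + s + 1) (by omega) i j hij l' hl')
    have h2 := hx (t₀ + s) i
    rw [Finset.sum_range_succ, ← add_assoc, pow_succ]
    linarith
  have hfirst : x (t₀ + (k + τ + 1)) i ≤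
      (1 - h ^ (k + τ + 1)) * m + ∑ r ∈ Finset.range (k + τ + 1), d (t₀ + r) := by
    refine hstep (k + τ) l (Or.inl ?_) (hk t₀ m hm hxm (k + τ) (by omega))
    have e : t₀ + (k + τ) + 1 = t₀ + k + 1 + τ := by omega
    rwa [e]
  intro s hs
  have hs' : k + τ + 1 ≤ s := by omega
  induction s, hs' using Nat.le_induction with
  | base => exact hfirst
  | succ s hs1 ih =>
    by_cases hs2 : k + T ≤ s
    · exact hstep s i (Or.inr rfl) (ih hs2)
    · have hs3 : ∀ s, k + τ + 1 ≤ s → x (t₀ + s) i ≤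
          (1 - h ^ s) * m + ∑ r ∈ Finset.range s, d (t₀ + r) := by
        intro s hs
        induction s, hs using Nat.le_induction with
        | base => exact hfirst
        | succ s _ ih => exact hstep s i (Or.inr rfl) ih
      exact hs3 (s + 1) (by omega)

end Consensus

/-- The errors of all the beliefs about all the agents contract. -/
lemma BeliefWeights.summable_errors {N : ℕ} (hN : 0 < N) {E : ℕ → Fin N → Fin N → Prop}
    {w : ℕ → Fin N → Fin N → Fin N → ℝ} {h C : ℝ} (hw : BeliefWeights E w h)
    (hE : ConnectedNetwork E) (hh : 0 < h) (hh1 : h ≤ 1) {x : ℕ → Fin N → Fin N → ℝ}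
    {a : ℕ → ℝ} (hC : 0 ≤ C) (ha : ∀ t, 0 ≤ a t) (hanti : Antitone a)
    (has : Summable fun t => a t ^ 2) (hx0 : ∀ t i j, 0 ≤ x t i j) (hxj : ∀ t j, x t j j = 0)
    (hx : ∀ t i j, x (t + 1) i j ≤ ∑ l, w (t + 1) i j l * x t l j +
      C * a t * (1 + ∑ i, ∑ j, x t i j)) :
    Summable fun t => a t * ∑ i, ∑ j, x t i j := by
  have : Nonempty (Fin N × Fin N) := ⟨(⟨0, hN⟩, ⟨0, hN⟩)⟩
  -- The largest error over all pairs. It is comparable to the total error up to the factor `N²` and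
  -- allows the separate sources to be treated together although the perturbation couples them.
  set y : ℕ → ℝ := fun t => ⨆ p : Fin N × Fin N, x t p.1 p.2 with hy
  have hle : ∀ t i j, x t i j ≤ y t := fun t i j =>
    le_ciSup (f := fun p : Fin N × Fin N => x t p.1 p.2) (Set.finite_range _).bddAbove (i, j)
  have hy0 : ∀ t, 0 ≤ y t := fun t => (hx0 t ⟨0, hN⟩ ⟨0, hN⟩).trans (hle t _ _)
  have hsum : ∀ t, ∑ i, ∑ j, x t i j ≤ N ^ 2 * y t := fun t => by
    calc _ ≤ ∑ _i : Fin N, ∑ _j : Fin N, y t :=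
          Finset.sum_le_sum fun i _ => Finset.sum_le_sum fun j _ => hle t i j
      _ = _ := by simp [sq, mul_assoc]
  have hsum0 : ∀ t, 0 ≤ ∑ i, ∑ j, x t i j := fun t =>
    Finset.sum_nonneg fun i _ => Finset.sum_nonneg fun j _ => hx0 t i j
  set d : ℕ → ℝ := fun t => C * a t * (1 + ∑ i, ∑ j, x t i j) with hd
  have hd0 : ∀ t, 0 ≤ d t := fun t =>
    mul_nonneg (mul_nonneg hC (ha t)) (by linarith [hsum0 t])
  have hN1 : (1 : ℝ) ≤ (N : ℝ) ^ 2 := one_le_pow₀ (by exact_mod_cast hN)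
  have hdle : ∀ t, d t ≤ (C * N ^ 2) * a t * (1 + y t) := fun t => by
    have h1 : 1 + ∑ i, ∑ j, x t i j ≤ N ^ 2 * (1 + y t) := by linarith [hsum t]
    have := mul_le_mul_of_nonneg_left h1 (mul_nonneg hC (ha t))
    rw [hd]
    exact this.trans (le_of_eq (by ring))
  choose k hk using fun p : Fin N × Fin N =>
    hw.exists_contraction_time (x := fun t i => x t i p.2) (d := d) (j := p.2) hE hh.le hh1 hd0
      (fun t => hxj t p.2) (fun t i => hx t i p.2) p.1
  -- The contraction holds at every time from `k p` on, so the sum of all these times is a common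
  -- window for all pairs.
  set K := ∑ p, k p with hK
  have hkK : ∀ p, k p ≤ K := fun p =>
    Finset.single_le_sum (f := k) (fun _ _ => Nat.zero_le _) (Finset.mem_univ p)
  have hmain : Summable fun t => a t * y t := by
    refine summable_mul_of_contraction (K := K) (c := h ^ K) (C := C * N ^ 2) (d := d)
      (pow_pos hh K) (by positivity) hy0 ha hanti has hdle ?_ ?_
    · intro t
      refine ciSup_le fun p => ?_
      have := hw.le_add_sum (x := fun t i => x t i p.2) (d := d) (j := p.2)
        (fun t i => hx t i p.2) (t₀ := t) (m := y t) (fun l => hle t l p.2) 1 p.1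
      simpa using this
    · intro t
      exact ciSup_le fun p => hk p t (y t) (hy0 t) (fun l => hle t l p.2) K (hkK p)
  refine Summable.of_nonneg_of_le (fun t => mul_nonneg (ha t) (hsum0 t)) (fun t => ?_)
    (hmain.mul_left ((N : ℝ) ^ 2))
  exact (mul_le_mul_of_nonneg_left (hsum t) (ha t)).trans (le_of_eq (by ring))

/-- Step sizes of order `t ^ (-β)` are dominated by an antitone square-summable sequence. -/
lemma exists_antitone_dominating {α : ℕ → ℝ} {β : ℝ} (hβ : 1 / 2 < β)
    (hα : α =O[atTop] fun t : ℕ => (t : ℝ) ^ (-β)) :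
    ∃ a : ℕ → ℝ, (∀ t, 0 ≤ a t) ∧ (∀ t, |α t| ≤ a t) ∧ Antitone a ∧
      Summable fun t => a t ^ 2 := by
  -- The shift to `t + 1` avoids the value 0 of `0 ^ (-β)`, which would spoil domination and
  -- monotonicity at `t = 0`. The constant `2 ^ β` comes from `t + 1 ≤ 2 * t`.
  have hα' : α =O[atTop] fun t : ℕ => ((t + 1 : ℕ) : ℝ) ^ (-β) := by
    refine hα.trans (Asymptotics.IsBigO.of_bound (2 ^ β) ?_)
    filter_upwards [eventually_ge_atTop 1] with t ht
    have ht0 : (0 : ℝ) < t := by exact_mod_cast ht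
    rw [Real.norm_of_nonneg (Real.rpow_nonneg ht0.le _),
      Real.norm_of_nonneg (Real.rpow_nonneg (Nat.cast_nonneg _) _), Real.rpow_neg ht0.le,
      Real.rpow_neg (Nat.cast_nonneg _), ← div_eq_mul_inv, inv_eq_one_div,
      div_le_div_iff₀ (Real.rpow_pos_of_pos ht0 _) (Real.rpow_pos_of_pos (by positivity) _), one_mul,
      ← Real.mul_rpow (by norm_num) ht0.le]
    refine Real.rpow_le_rpow (by positivity) ?_ (by linarith)
    have : (1 : ℝ) ≤ t := by exact_mod_cast ht
    push_cast
    linarith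
  obtain ⟨c, hc0, hc⟩ := Asymptotics.bound_of_isBigO_nat_atTop hα'
  refine ⟨fun t => c * ((t + 1 : ℕ) : ℝ) ^ (-β),
    fun t => mul_nonneg hc0.le (Real.rpow_nonneg (Nat.cast_nonneg _) _), fun t => ?_, ?_, ?_⟩
  · have h1 : (0 : ℝ) < ((t + 1 : ℕ) : ℝ) := by positivity
    have := hc (x := t) (Real.rpow_pos_of_pos h1 _).ne'
    rwa [Real.norm_of_nonneg (Real.rpow_nonneg h1.le _)] at this
  · intro s t hst
    refine mul_le_mul_of_nonneg_left ?_ hc0.le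
    refine Real.rpow_le_rpow_of_nonpos (by positivity) (by exact_mod_cast Nat.succ_le_succ hst)
      (by linarith)
  · have h1 : Summable fun t : ℕ => (t : ℝ) ^ (-β * 2) :=
      Real.summable_nat_rpow.2 (by linarith)
    have h2 := ((summable_nat_add_iff 1).2 h1).mul_left (c ^ 2)
    refine h2.congr fun t => ?_
    rw [mul_pow, Real.rpow_mul (Nat.cast_nonneg _)]
    norm_cast

/-! ### Networked policy gradient play -/

section Believers

variable {N : ℕ} {M : Fin N → ℕ}

/-- In either mode the error of each agent's beliefs is counted `N` times: once by every agent in a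
common episode, or `N` times by its owner in individual episodes. From here on both modes obey the
same estimates. -/
lemma sum_beliefDist_believer (mode : EpisodeMode) (ϑ : Fin N → Params M) (θ : Params M) :
    ∑ i, beliefDist (fun n => ϑ (mode.believer i n)) (fun _ => θ) = N * ∑ i, ‖ϑ i - θ‖ := by
  cases mode <;> simp [beliefDist, EpisodeMode.believer, Finset.mul_sum]

lemma beliefDist_believer_le (mode : EpisodeMode) (ϑ : Fin N → Params M) (θ : Params M)
    (i : Fin N) :
    beliefDist (fun n => ϑ (mode.believer i n)) (fun _ => θ) ≤ N * ∑ i, ‖ϑ i - θ‖ := by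
  rw [← sum_beliefDist_believer mode]
  exact Finset.single_le_sum
    (f := fun i => beliefDist (fun n => ϑ (mode.believer i n)) (fun _ => θ))
    (fun _ _ => beliefDist_nonneg _ _) (Finset.mem_univ i)

lemma beliefDist_const_le (b : Fin N → Params M) (θ θ' : Params M) :
    beliefDist (fun _ => θ') b ≤ N * ‖θ' - θ‖ + beliefDist b (fun _ => θ) := by
  calc ∑ n, ‖θ' - b n‖ ≤ ∑ n, (‖θ' - θ‖ + ‖b n - θ‖) := by
        refine Finset.sum_le_sum fun n _ => ?_
        rw [norm_sub_rev (b n)]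
        exact norm_sub_le_norm_sub_add_norm_sub _ _ _
    _ = _ := by simp [Finset.sum_add_distrib, beliefDist]

lemma beliefDist_const_believer_le (mode : EpisodeMode) (ϑ : Fin N → Params M) (θ : Params M)
    (i : Fin N) :
    beliefDist (fun _ => ϑ i) (fun n => ϑ (mode.believer i n)) ≤ 2 * N * ∑ i, ‖ϑ i - θ‖ := by
  have h1 := beliefDist_const_le (fun n => ϑ (mode.believer i n)) θ (ϑ i)
  have h2 := beliefDist_believer_le mode ϑ θ i
  have h3 : ‖ϑ i - θ‖ ≤ ∑ i, ‖ϑ i - θ‖ :=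
    Finset.single_le_sum (f := fun i => ‖ϑ i - θ‖) (fun _ _ => norm_nonneg _) (Finset.mem_univ i)
  have h4 := mul_le_mul_of_nonneg_left h3 (Nat.cast_nonneg (α := ℝ) N)
  linarith

lemma sum_beliefDist_const_believer_le (mode : EpisodeMode) (ϑ : Fin N → Params M)
    (θ : Params M) :
    ∑ i, beliefDist (fun _ => ϑ i) (fun n => ϑ (mode.believer i n)) ≤
      2 * N * ∑ i, ‖ϑ i - θ‖ := by
  calc _ ≤ ∑ i, (N * ‖ϑ i - θ‖ + beliefDist (fun n => ϑ (mode.believer i n)) (fun _ => θ)) :=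
        Finset.sum_le_sum fun i _ => beliefDist_const_le _ θ (ϑ i)
    _ = _ := by
        rw [Finset.sum_add_distrib, sum_beliefDist_believer, ← Finset.mul_sum]
        ring

end Believers

lemma BeliefWeights.self_eq_zero {N : ℕ} {E : ℕ → Fin N → Fin N → Prop}
    {w : ℕ → Fin N → Fin N → Fin N → ℝ} {h : ℝ} (hw : BeliefWeights E w h) {t : ℕ} (ht : 1 ≤ t)
    (j l : Fin N) (hl : l ≠ j) : w t j j l = 0 := by
  have h1 := hw.sum_eq_one t ht j j
  rw [← Finset.add_sum_erase _ _ (Finset.mem_univ j), hw.self t ht j, add_eq_left] at h1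
  exact (Finset.sum_eq_zero_iff_of_nonneg fun l _ => hw.nonneg t ht j j l).1 h1 l
    (Finset.mem_erase.2 ⟨hl, Finset.mem_univ l⟩)

/-! ### The play process: information, belief errors and their moments -/

section Networked

variable {N : ℕ} {M : Fin N → ℕ} {S A : Type*} [MeasurableSpace S] [MeasurableSpace A]
  {ν : Measure A} [SigmaFinite ν] {G : MarkovGame N S A} {π : PolicyFamily M S A ν}
  {R B V Λ : ℝ} {est : GainEstimator} {mode : EpisodeMode} {α : ℕ → ℝ}
  {E : ℕ → Fin N → Fin N → Prop} {w : ℕ → Fin N → Fin N → Fin N → ℝ} {h : ℝ}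
  {Ω : Type*} {θ : ℕ → Ω → Params M} {θhat : ℕ → Fin N → Ω → Params M}
  {ξ : ℕ → Fin N → Ω → Episode N S A}

/-- The law of the episode used by agent `i`, as a transition from parameters and beliefs. -/
def agentKernel (G : MarkovGame N S A) (π : PolicyFamily M S A ν) (mode : EpisodeMode)
    (i : Fin N) : Kernel (Params M × (Fin N → Params M)) (Episode N S A) :=
  (episodeKernel G π).comap (fun Z n => Z.2 (mode.believer i n)) (by fun_prop)

instance (i : Fin N) : IsMarkovKernel (agentKernel G π mode i) := by
  unfold agentKernel
  infer_instance

lemma agentKernel_apply (i : Fin N) (Z : Params M × (Fin N → Params M)) :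
    agentKernel G π mode i Z = episodeLaw G π (fun n => Z.2 (mode.believer i n)) := by
  rw [agentKernel, Kernel.comap_apply, episodeKernel_apply]

lemma Episode.measurable_stopped : Measurable
    fun e : Episode N S A => (e.T₁, e.T₂, e.stopped) := by
  have h1 : Measurable fun e : Episode N S A => e.T₁ := by unfold Episode.T₁; fun_prop
  have h2 : Measurable fun e : Episode N S A => e.T₂ := by unfold Episode.T₂; fun_prop
  refine h1.prodMk (h2.prodMk (measurable_pi_lambda _ fun k => ?_))
  have h3 : Measurable fun p : (ℕ × ℕ) × Path N S A => p.2 (min k (p.1.1 + p.1.2 + 1)) :=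
    measurable_from_prod_countable_right fun q => measurable_pi_apply (min k (q.1 + q.2 + 1))
  exact h3.comp (f := fun e : Episode N S A => ((e.1.1, e.1.2.1), e.1.2.2.2)) (by fun_prop)

/-- The parameters and the beliefs at time `t`. -/
def playState (θ : ℕ → Ω → Params M) (θhat : ℕ → Fin N → Ω → Params M) (t : ℕ) (ω : Ω) :
    Params M × (Fin N → Params M) :=
  (θ t ω, fun n => θhat t n ω)

lemma measurable_params_pastSigma (θ : ℕ → Ω → Params M) (θhat : ℕ → Fin N → Ω → Params M)
    (ξ : ℕ → Fin N → Ω → Episode N S A) (t : ℕ) : Measurable[pastSigma θ θhat ξ t] (θ t) :=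
  measurable_iff_comap_le.2 (le_sup_of_le_left (le_sup_of_le_left
    (le_iSup₂_of_le (f := fun τ (_ : τ ∈ Set.Iic t) => MeasurableSpace.comap (θ τ) inferInstance)
      t (Set.mem_Iic.2 le_rfl) le_rfl)))

lemma measurable_beliefs_pastSigma (θ : ℕ → Ω → Params M) (θhat : ℕ → Fin N → Ω → Params M)
    (ξ : ℕ → Fin N → Ω → Episode N S A) (t : ℕ) (i : Fin N) :
    Measurable[pastSigma θ θhat ξ t] (θhat t i) :=
  measurable_iff_comap_le.2 (le_sup_of_le_left (le_sup_of_le_right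
    (le_iSup₂_of_le (f := fun τ (_ : τ ∈ Set.Iic t) =>
        ⨆ i, MeasurableSpace.comap (θhat τ i) inferInstance)
      t (Set.mem_Iic.2 le_rfl) (le_iSup (fun i => MeasurableSpace.comap (θhat t i) inferInstance)
        i))))

lemma measurable_playState_pastSigma (θ : ℕ → Ω → Params M) (θhat : ℕ → Fin N → Ω → Params M)
    (ξ : ℕ → Fin N → Ω → Episode N S A) (t : ℕ) :
    Measurable[pastSigma θ θhat ξ t] (playState θ θhat t) :=
  (measurable_params_pastSigma θ θhat ξ t).prodMk
    (@measurable_pi_lambda _ _ _ (pastSigma θ θhat ξ t) _ _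
      fun i => measurable_beliefs_pastSigma θ θhat ξ t i)

/-- The sum of the errors of all the beliefs. -/
def totalError (θ : ℕ → Ω → Params M) (θhat : ℕ → Fin N → Ω → Params M) (t : ℕ) (ω : Ω) : ℝ :=
  ∑ i, ∑ j, ‖θhat t i ω j - θ t ω j‖

lemma sum_norm_sub_le_totalError (θ : ℕ → Ω → Params M) (θhat : ℕ → Fin N → Ω → Params M)
    (t : ℕ) (ω : Ω) : ∑ i, ‖θhat t i ω - θ t ω‖ ≤ totalError θ θhat t ω :=
  Finset.sum_le_sum fun i _ => Params.norm_le_sum (θhat t i ω - θ t ω)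

variable [mΩ : MeasurableSpace Ω] {μ : Measure Ω}

namespace IsNetworkedPlay

lemma pastSigma_le (play : IsNetworkedPlay μ G π est mode α w θ θhat ξ) (t : ℕ) :
    pastSigma θ θhat ξ t ≤ mΩ := by
  refine sup_le (sup_le ?_ ?_) ?_
  · exact iSup₂_le fun τ _ => (play.measurable_params τ).comap_le
  · exact iSup₂_le fun τ _ => iSup_le fun i => (play.measurable_beliefs τ i).comap_le
  · exact iSup₂_le fun τ _ => iSup_le fun i =>
      (Episode.measurable_stopped.comp (play.measurable_episodes τ i)).comap_le

lemma measurable_playState (play : IsNetworkedPlay μ G π est mode α w θ θhat ξ) (t : ℕ) :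
    Measurable (playState θ θhat t) :=
  (measurable_playState_pastSigma θ θhat ξ t).mono (play.pastSigma_le t) le_rfl

/-- Every agent knows its own parameters. -/
lemma belief_self (play : IsNetworkedPlay μ G π est mode α w θ θhat ξ) (hw : BeliefWeights E w h)
    (t : ℕ) (i : Fin N) (ω : Ω) : θhat t i ω i = θ t ω i := by
  cases t with
  | zero => exact play.init_own i ω
  | succ t =>
    rw [play.beliefs_step, Finset.sum_eq_single i]
    · simp [hw.self (t + 1) (by omega) i]
    · intro l _ hl
      rw [hw.self_eq_zero (by omega) i l hl, zero_smul]
    · simp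

/-- The new belief is a convex combination, so its error is the average of the errors. The source
contributes none, being already updated; every other entry lags behind by at most the step of agent
`j`. -/
lemma norm_belief_sub_succ_le (play : IsNetworkedPlay μ G π est mode α w θ θhat ξ)
    (hw : BeliefWeights E w h) (t : ℕ) (i j : Fin N) (ω : Ω) :
    ‖θhat (t + 1) i ω j - θ (t + 1) ω j‖ ≤
      ∑ l, w (t + 1) i j l * ‖θhat t l ω j - θ t ω j‖ +
        |α t| * ‖stochGrad G π est j (θhat t j ω) (ξ t j ω)‖ := by
  have hs := hw.sum_eq_one (t + 1) (by omega) i j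
  have hstep : ‖θ (t + 1) ω j - θ t ω j‖ =
      |α t| * ‖stochGrad G π est j (θhat t j ω) (ξ t j ω)‖ := by
    rw [play.params_step, add_sub_cancel_left, norm_smul, Real.norm_eq_abs]
  have e : θhat (t + 1) i ω j - θ (t + 1) ω j =
      ∑ l, w (t + 1) i j l • ((if l = j then θ (t + 1) ω j else θhat t l ω j) - θ (t + 1) ω j) := by
    simp_rw [smul_sub]
    rw [Finset.sum_sub_distrib, ← Finset.sum_smul, hs, one_smul, play.beliefs_step]
  rw [e, ← hstep]
  calc _ ≤ ∑ l, w (t + 1) i j l *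
        (‖θhat t l ω j - θ t ω j‖ + ‖θ (t + 1) ω j - θ t ω j‖) := by
        refine (norm_sum_le _ _).trans (Finset.sum_le_sum fun l _ => ?_)
        have hw0 := hw.nonneg (t + 1) (by omega) i j l
        rw [norm_smul, Real.norm_of_nonneg hw0]
        refine mul_le_mul_of_nonneg_left ?_ hw0
        split_ifs with hl
        · rw [sub_self, norm_zero]
          positivity
        · rw [norm_sub_rev (θ (t + 1) ω j)]
          exact norm_sub_le_norm_sub_add_norm_sub _ _ _
    _ = _ := by
        simp_rw [mul_add]
        rw [Finset.sum_add_distrib, ← Finset.sum_mul, hs, one_mul]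

lemma law_agentKernel (play : IsNetworkedPlay μ G π est mode α w θ θhat ξ) (t : ℕ) (i : Fin N)
    (D : Set (Episode N S A)) (hD : MeasurableSet D) :
    (μ[(ξ t i ⁻¹' D).indicator (fun _ => (1 : ℝ)) | pastSigma θ θhat ξ t]) =ᵐ[μ]
      fun ω => (agentKernel G π mode i (playState θ θhat t ω)).real D := by
  simp_rw [agentKernel_apply]
  exact play.episode_law t i D hD

lemma measurable_belief_error (play : IsNetworkedPlay μ G π est mode α w θ θhat ξ) (t : ℕ)
    (i j : Fin N) : Measurable fun ω => θhat t i ω j - θ t ω j := by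
  have h1 : Measurable fun p : Params M => p j :=
    (measurable_pi_apply j).comp (WithLp.measurable_ofLp 2 _)
  exact (h1.comp (play.measurable_beliefs t i)).sub (h1.comp (play.measurable_params t))

lemma measurable_stochGrad_play (play : IsNetworkedPlay μ G π est mode α w θ θhat ξ)
    (hs : ScoreBounds π B V Λ) (hΛ : 0 ≤ Λ) (t : ℕ) (i : Fin N) :
    Measurable fun ω => stochGrad G π est i (θhat t i ω) (ξ t i ω) := by
  have h1 := (hs.measurable_stochGrad hΛ G est i).comp (f := fun ω => (θhat t i ω, ξ t i ω))
    ((play.measurable_beliefs t i).prodMk (play.measurable_episodes t i))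
  exact h1

variable [IsProbabilityMeasure μ]

/-- The conditional law of the episode, used with the whole space as conditioning event, for
nonnegative integrands and hence without integrability assumptions. -/
lemma lintegral_episode (play : IsNetworkedPlay μ G π est mode α w θ θhat ξ) (t : ℕ) (i : Fin N)
    {f : (Params M × (Fin N → Params M)) × Episode N S A → ℝ≥0∞} (hf : Measurable f) :
    ∫⁻ ω, f (playState θ θhat t ω, ξ t i ω) ∂μ =
      ∫⁻ ω, ∫⁻ e, f (playState θ θhat t ω, e)
        ∂episodeLaw G π (fun n => θhat t (mode.believer i n) ω) ∂μ := by
  have h1 := map_prodMk_restrict_eq_compProd (play.pastSigma_le t)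
    (measurable_playState_pastSigma θ θhat ξ t) (play.measurable_episodes t i)
    (agentKernel G π mode i) (play.law_agentKernel t i) (A := Set.univ) MeasurableSet.univ
  rw [Measure.restrict_univ] at h1
  rw [← lintegral_map hf ((play.measurable_playState t).prodMk (play.measurable_episodes t i)), h1,
    Measure.lintegral_compProd hf,
    lintegral_map hf.lintegral_kernel_prod_right' (play.measurable_playState t)]
  simp_rw [agentKernel_apply]
  rfl

lemma lintegral_stochGrad_le (play : IsNetworkedPlay μ G π est mode α w θ θhat ξ)
    (hs : ScoreBounds π B V Λ) (hB : 0 ≤ B) (hΛ : 0 ≤ Λ) (hr : BoundedRewards G R) (hR : 0 ≤ R)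
    (t : ℕ) (i : Fin N) :
    ∫⁻ ω, ‖stochGrad G π est i (θhat t i ω) (ξ t i ω)‖ₑ ∂μ ≤
      ∫⁻ ω, ENNReal.ofReal (gainConst G.γ R *
        (N ^ 2 * B + N * Λ * (2 * N * ∑ i, ‖θhat t i ω - θ t ω‖))) ∂μ := by
  have hm : Measurable fun p : (Params M × (Fin N → Params M)) × Episode N S A =>
      ‖stochGrad G π est i (p.1.2 i) p.2‖ₑ := by
    have h1 := (hs.measurable_stochGrad hΛ G est i).enorm.comp
      (f := fun p : (Params M × (Fin N → Params M)) × Episode N S A => (p.1.2 i, p.2)) (by fun_prop)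
    exact h1
  have h2 := play.lintegral_episode t i hm
  refine h2.le.trans (lintegral_mono fun ω => ?_)
  refine (hs.lintegral_norm_stochGrad_le hB hΛ hr hR est i _ (θhat t i ω)).trans
    (ENNReal.ofReal_le_ofReal ?_)
  have hg := gainConst_nonneg G.γ_lt_one G.sqrt_γ_lt_one hR
  have h3 := beliefDist_const_believer_le mode (fun n => θhat t n ω) (θ t ω) i
  gcongr

/-- Integrable belief errors yield integrable stochastic gradients. -/
lemma integrable_stochGrad (play : IsNetworkedPlay μ G π est mode α w θ θhat ξ)
    (hs : ScoreBounds π B V Λ) (hB : 0 ≤ B) (hΛ : 0 ≤ Λ) (hr : BoundedRewards G R) (hR : 0 ≤ R)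
    (t : ℕ) (hx : Integrable (totalError θ θhat t) μ) (i : Fin N) :
    Integrable (fun ω => ‖stochGrad G π est i (θhat t i ω) (ξ t i ω)‖) μ ∧
      ∫ ω, ‖stochGrad G π est i (θhat t i ω) (ξ t i ω)‖ ∂μ ≤
        gainConst G.γ R * (N ^ 2 * B + N * Λ * (2 * N)) * (1 + ∫ ω, totalError θ θhat t ω ∂μ) := by
  have hg := gainConst_nonneg G.γ_lt_one G.sqrt_γ_lt_one hR
  have hm := (play.measurable_stochGrad_play hs hΛ t i).norm
  have hT0 : ∀ ω, 0 ≤ totalError θ θhat t ω := fun ω =>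
    Finset.sum_nonneg fun i _ => Finset.sum_nonneg fun j _ => norm_nonneg _
  set c := gainConst G.γ R * (N ^ 2 * B + N * Λ * (2 * N)) with hc
  have hc0 : 0 ≤ c := by positivity
  have hi : Integrable (fun ω => c * (1 + totalError θ θhat t ω)) μ :=
    ((integrable_const 1).add hx).const_mul c
  have hle : ∫⁻ ω, ‖stochGrad G π est i (θhat t i ω) (ξ t i ω)‖ₑ ∂μ ≤
      ENNReal.ofReal (∫ ω, c * (1 + totalError θ θhat t ω) ∂μ) := by
    rw [ofReal_integral_eq_lintegral_ofReal hi
      (Eventually.of_forall fun ω => mul_nonneg hc0 (by linarith [hT0 ω]))]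
    refine (play.lintegral_stochGrad_le hs hB hΛ hr hR t i).trans (lintegral_mono fun ω => ?_)
    refine ENNReal.ofReal_le_ofReal ?_
    have h1 := sum_norm_sub_le_totalError θ θhat t ω
    have h2 := hT0 ω
    calc _ ≤ gainConst G.γ R * (N ^ 2 * B + N * Λ * (2 * N * totalError θ θhat t ω)) := by gcongr
      _ ≤ c * (1 + totalError θ θhat t ω) := by
          rw [← sub_nonneg]
          have : 0 ≤ gainConst G.γ R * (N * Λ * (2 * N) + N ^ 2 * B * totalError θ θhat t ω) := by
            positivity
          refine this.trans (le_of_eq ?_)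
          rw [hc]
          ring
  have hint : Integrable (fun ω => ‖stochGrad G π est i (θhat t i ω) (ξ t i ω)‖) μ := by
    refine ⟨hm.aestronglyMeasurable, ?_⟩
    rw [HasFiniteIntegral]
    simp only [enorm_norm]
    exact hle.trans_lt ENNReal.ofReal_lt_top
  refine ⟨hint, ?_⟩
  have e : ∫ ω, c * (1 + totalError θ θhat t ω) ∂μ = c * (1 + ∫ ω, totalError θ θhat t ω ∂μ) := by
    rw [integral_const_mul, integral_add (integrable_const 1) hx]
    simp
  rw [← e, integral_eq_lintegral_of_nonneg_ae (Eventually.of_forall fun ω => norm_nonneg _)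
    hm.aestronglyMeasurable]
  refine ENNReal.toReal_le_of_le_ofReal
    (integral_nonneg fun ω => mul_nonneg hc0 (by linarith [hT0 ω])) ?_
  simpa only [ofReal_norm] using hle

/-- Induction on time: integrable errors make the stochastic gradients integrable, and these control
the next errors. The start rests on coordinatewise first moments. -/
lemma integrable_belief_error (play : IsNetworkedPlay μ G π est mode α w θ θhat ξ)
    (hw : BeliefWeights E w h) {κ : ℝ} (hinit : InitialBeliefErrors μ θ θhat κ)
    (hs : ScoreBounds π B V Λ) (hB : 0 ≤ B) (hΛ : 0 ≤ Λ) (hr : BoundedRewards G R) (hR : 0 ≤ R)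
    (t : ℕ) (i j : Fin N) : Integrable (fun ω => ‖θhat t i ω j - θ t ω j‖) μ := by
  induction t generalizing i j with
  | zero =>
    rcases eq_or_ne i j with rfl | hij
    · simp [play.belief_self hw]
    · refine (Integrable.of_eval_piLp (f := fun ω => θhat 0 i ω j - θ 0 ω j) fun m => ?_).norm
      have h1 := play.measurable_belief_error 0 i j
      have h2 : Measurable fun ω => (θhat 0 i ω j - θ 0 ω j) m :=
        (measurable_pi_apply m).comp ((WithLp.measurable_ofLp 2 _).comp h1)
      exact ⟨h2.aestronglyMeasurable, (hinit i j hij m).trans_lt ENNReal.ofReal_lt_top⟩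
  | succ t ih =>
    have hx : Integrable (totalError θ θhat t) μ :=
      integrable_finsetSum _ fun i _ => integrable_finsetSum _ fun j _ => ih i j
    have hg := (play.integrable_stochGrad hs hB hΛ hr hR t hx j).1
    have hdom : Integrable (fun ω => ∑ l, w (t + 1) i j l * ‖θhat t l ω j - θ t ω j‖ +
        |α t| * ‖stochGrad G π est j (θhat t j ω) (ξ t j ω)‖) μ :=
      (integrable_finsetSum _ fun l _ => (ih l j).const_mul _).add (hg.const_mul _)
    refine hdom.mono' (play.measurable_belief_error (t + 1) i j).norm.aestronglyMeasurable
      (Eventually.of_forall fun ω => ?_)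
    rw [norm_norm]
    exact play.norm_belief_sub_succ_le hw t i j ω

lemma integrable_totalError (play : IsNetworkedPlay μ G π est mode α w θ θhat ξ)
    (hw : BeliefWeights E w h) {κ : ℝ} (hinit : InitialBeliefErrors μ θ θhat κ)
    (hs : ScoreBounds π B V Λ) (hB : 0 ≤ B) (hΛ : 0 ≤ Λ) (hr : BoundedRewards G R) (hR : 0 ≤ R)
    (t : ℕ) : Integrable (totalError θ θhat t) μ :=
  integrable_finsetSum _ fun i _ => integrable_finsetSum _ fun j _ =>
    play.integrable_belief_error hw hinit hs hB hΛ hr hR t i j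

/-- The expected belief errors, weighted by the step sizes, are summable. -/
lemma summable_integral_totalError (play : IsNetworkedPlay μ G π est mode α w θ θhat ξ)
    (hN : 0 < N) (hE : ConnectedNetwork E) (hh : 0 < h) (hh1 : h ≤ 1)
    (hw : BeliefWeights E w h) {κ : ℝ} (hinit : InitialBeliefErrors μ θ θhat κ)
    (hs : ScoreBounds π B V Λ) (hB : 0 ≤ B) (hΛ : 0 ≤ Λ) (hr : BoundedRewards G R) (hR : 0 ≤ R)
    {a : ℕ → ℝ} (ha : ∀ t, 0 ≤ a t) (haα : ∀ t, |α t| ≤ a t) (hanti : Antitone a)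
    (has : Summable fun t => a t ^ 2) :
    Summable fun t => a t * ∫ ω, totalError θ θhat t ω ∂μ := by
  have hg := gainConst_nonneg G.γ_lt_one G.sqrt_γ_lt_one hR
  have hi := fun t i j => play.integrable_belief_error hw hinit hs hB hΛ hr hR t i j
  have hI : ∀ t, ∫ ω, totalError θ θhat t ω ∂μ = ∑ i, ∑ j, ∫ ω, ‖θhat t i ω j - θ t ω j‖ ∂μ := by
    intro t
    unfold totalError
    rw [integral_finsetSum _ fun i _ => integrable_finsetSum _ fun j _ => hi t i j]
    exact Finset.sum_congr rfl fun i _ => integral_finsetSum _ fun j _ => hi t i j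
  simp_rw [hI]
  refine hw.summable_errors hN hE hh hh1
    (x := fun t i j => ∫ ω, ‖θhat t i ω j - θ t ω j‖ ∂μ)
    (C := gainConst G.γ R * (N ^ 2 * B + N * Λ * (2 * N))) (by positivity) ha hanti has
    (fun t i j => integral_nonneg fun ω => norm_nonneg _)
    (fun t j => by simp [play.belief_self hw]) fun t i j => ?_
  have hT := play.integrable_totalError hw hinit hs hB hΛ hr hR t
  obtain ⟨hG, hGle⟩ := play.integrable_stochGrad hs hB hΛ hr hR t hT j
  rw [hI] at hGle
  have hS : ∀ l ∈ Finset.univ, Integrable (fun ω => w (t + 1) i j l *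
      ‖θhat t l ω j - θ t ω j‖) μ := fun l _ => (hi t l j).const_mul _
  calc ∫ ω, ‖θhat (t + 1) i ω j - θ (t + 1) ω j‖ ∂μ
      ≤ ∫ ω, (∑ l, w (t + 1) i j l * ‖θhat t l ω j - θ t ω j‖ +
        |α t| * ‖stochGrad G π est j (θhat t j ω) (ξ t j ω)‖) ∂μ :=
        integral_mono (hi (t + 1) i j)
          ((integrable_finsetSum _ hS).add (hG.const_mul _))
          fun ω => play.norm_belief_sub_succ_le hw t i j ω
    _ = ∑ l, w (t + 1) i j l * ∫ ω, ‖θhat t l ω j - θ t ω j‖ ∂μ +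
        |α t| * ∫ ω, ‖stochGrad G π est j (θhat t j ω) (ξ t j ω)‖ ∂μ := by
        rw [integral_add (integrable_finsetSum _ hS) (hG.const_mul _),
          integral_finsetSum _ hS, integral_const_mul]
        simp_rw [integral_const_mul]
    _ ≤ _ := by
        refine add_le_add le_rfl ?_
        have h1 := mul_le_mul (haα t) hGle (integral_nonneg fun ω => norm_nonneg _) (ha t)
        exact h1.trans (le_of_eq (by ring))

end IsNetworkedPlay

end Networked

/-! ### Expected decrease of the potential gap -/

section Descent

variable {N : ℕ} {M : Fin N → ℕ} {S A : Type*} [MeasurableSpace S] [MeasurableSpace A]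
  {ν : Measure A} {G : MarkovGame N S A} {π : PolicyFamily M S A ν} {u : Params M → ℝ}
  {R B V Λ : ℝ} {est : GainEstimator} {mode : EpisodeMode} {α : ℕ → ℝ}
  {E : ℕ → Fin N → Fin N → Prop} {w : ℕ → Fin N → Fin N → Fin N → ℝ} {h : ℝ}
  {Ω : Type*} {θ : ℕ → Ω → Params M} {θhat : ℕ → Fin N → Ω → Params M}
  {ξ : ℕ → Fin N → Ω → Episode N S A}

/-- The contribution of agent `i` to the decrease of the potential, as a function of the parameters,
the beliefs and the episode. -/
def agentStep (G : MarkovGame N S A) (π : PolicyFamily M S A ν) (est : GainEstimator)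
    (mode : EpisodeMode) (u : Params M → ℝ) (a c : ℝ) (i : Fin N)
    (p : (Params M × (Fin N → Params M)) × Episode N S A) : ℝ :=
  -(a * inner ℝ (stochGrad G π est i (p.1.2 i) p.2) (blockGrad i u p.1.1)) +
    c * π.scoreSum (fun n => p.1.2 (mode.believer i n)) (p.2.main p.2.T₁).1 (p.2.main p.2.T₁).2 ^ 2

variable [SigmaFinite ν]

lemma ScoreBounds.measurable_agentStep (hs : ScoreBounds π B V Λ) (hΛ : 0 ≤ Λ) {D K : ℝ}
    (hu : BlockSmooth u D K) (a c : ℝ) (i : Fin N) :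
    Measurable (agentStep G π est mode u a c i) := by
  have h1 : Measurable fun p : (Params M × (Fin N → Params M)) × Episode N S A =>
      stochGrad G π est i (p.1.2 i) p.2 := by
    have h := (hs.measurable_stochGrad hΛ G est i).comp
      (f := fun p : (Params M × (Fin N → Params M)) × Episode N S A => (p.1.2 i, p.2)) (by fun_prop)
    exact h
  have h2 : Measurable fun p : (Params M × (Fin N → Params M)) × Episode N S A =>
      blockGrad i u p.1.1 :=
    (hu.continuous_blockGrad i).measurable.comp (measurable_fst.comp measurable_fst)
  have h3 : Measurable fun p : (Params M × (Fin N → Params M)) × Episode N S A =>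
      π.scoreSum (fun n => p.1.2 (mode.believer i n)) (p.2.main p.2.T₁).1 (p.2.main p.2.T₁).2 := by
    have h := (hs.measurable_scoreSum_uncurry hΛ).comp
      (f := fun p : (Params M × (Fin N → Params M)) × Episode N S A =>
        ((fun n => p.1.2 (mode.believer i n)), p.2.main p.2.T₁))
      (Measurable.prodMk (by fun_prop) (Episode.measurable_main_T₁.comp measurable_snd))
    exact h
  unfold agentStep
  exact ((h1.inner h2).const_mul a).neg.add ((h3.pow_const 2).const_mul c)

/-- The pathwise descent estimate. The belief mismatch is known before the episode and is kept
apart; everything depending on the episode is collected in `agentStep`, one summand per agent, since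
agents may use different episodes. -/
lemma IsNetworkedPlay.potentialGap_succ_le [MeasurableSpace Ω] {μ : Measure Ω}
    (play : IsNetworkedPlay μ G π est mode α w θ θhat ξ) (hs : ScoreBounds π B V Λ)
    (hΛ : 0 ≤ Λ) (hr : BoundedRewards G R) (hR : 0 ≤ R) {D K : ℝ} (hD : 0 ≤ D)
    (hK : 0 ≤ K) (hu : BlockSmooth u D K) {t : ℕ} (hα : 0 ≤ α t) (ω : Ω) :
    potentialGap u (θ (t + 1) ω) ≤ potentialGap u (θ t ω) +
      4 * D * (α t * gainConst G.γ R * (N * Λ)) *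
        ∑ i, beliefDist (fun _ => θhat t i ω) (fun n => θhat t (mode.believer i n) ω) +
      ∑ i, agentStep G π est mode u (α t) (4 * K * N * (α t * gainConst G.γ R) ^ 2) i
        (playState θ θhat t ω, ξ t i ω) := by
  have hg := gainConst_nonneg G.γ_lt_one G.sqrt_γ_lt_one hR
  set b : Fin N → Fin N → Params M := fun i n => θhat t (mode.believer i n) ω with hb
  set sc : Fin N → ℝ := fun i =>
    π.scoreSum (b i) ((ξ t i ω).main (ξ t i ω).T₁).1 ((ξ t i ω).main (ξ t i ω).T₁).2 with hsc
  have hδ : ∀ i, (θ (t + 1) ω - θ t ω) i = α t • stochGrad G π est i (θhat t i ω) (ξ t i ω) := by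
    intro i
    rw [PiLp.sub_apply, play.params_step, add_sub_cancel_left]
  have h1 := hu.sub_le_neg_inner_add hD hK (θ t ω) (θ (t + 1) ω - θ t ω)
    (X := fun i => α t * gainConst G.γ R * sc i)
    (Y := fun i => α t * gainConst G.γ R * (N * Λ) * beliefDist (fun _ => θhat t i ω) (b i))
    (fun i => mul_nonneg (by positivity) (π.scoreSum_nonneg _ _ _))
    (fun i => mul_nonneg (by positivity) (beliefDist_nonneg _ _)) fun i => by
      rw [hδ, norm_smul, Real.norm_of_nonneg hα]
      have := mul_le_mul_of_nonneg_left
        (hs.norm_stochGrad_le hr hR est i (b i) (θhat t i ω) (ξ t i ω)) hα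
      exact this.trans (le_of_eq (by ring))
  rw [add_sub_cancel, Params.inner_eq_sum] at h1
  have h2 : ∑ i, agentStep G π est mode u (α t) (4 * K * N * (α t * gainConst G.γ R) ^ 2) i
      (playState θ θhat t ω, ξ t i ω) =
      -∑ i, inner ℝ ((fullGrad u (θ t ω)) i) ((θ (t + 1) ω - θ t ω) i) +
        4 * K * N * ∑ i, (α t * gainConst G.γ R * sc i) ^ 2 := by
    rw [← Finset.sum_neg_distrib, Finset.mul_sum, ← Finset.sum_add_distrib]
    refine Finset.sum_congr rfl fun i _ => ?_
    rw [hδ, inner_smul_right, real_inner_comm]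
    simp only [agentStep, playState, fullGrad, hsc, hb]
    ring
  rw [h2, Finset.mul_sum (s := Finset.univ) (a := 4 * D * (α t * gainConst G.γ R * (N * Λ)))]
  rw [Finset.mul_sum (s := Finset.univ) (a := 4 * D)] at h1
  unfold potentialGap
  have h3 : ∑ i, 4 * D * (α t * gainConst G.γ R * (N * Λ)) *
      beliefDist (fun _ => θhat t i ω) (b i) =
      ∑ i, 4 * D * (α t * gainConst G.γ R * (N * Λ) *
        beliefDist (fun _ => θhat t i ω) (b i)) :=
    Finset.sum_congr rfl fun i _ => by ring
  rw [h3]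
  linarith

variable [mΩ : MeasurableSpace Ω] {μ : Measure Ω} [IsProbabilityMeasure μ]

/-- Given the past, the step is quadratic in the scores at the acting parameters and linear in the
belief mismatch, because the gradient of the potential is bounded. First moments of the belief
errors therefore suffice. -/
lemma IsNetworkedPlay.integrable_agentStep (play : IsNetworkedPlay μ G π est mode α w θ θhat ξ)
    (hs : ScoreBounds π B V Λ) (hB : 0 ≤ B) (hΛ : 0 ≤ Λ) (hr : BoundedRewards G R) (hR : 0 ≤ R)
    {D K : ℝ} (hD : 0 ≤ D) (hu : BlockSmooth u D K) (t : ℕ)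
    (hx : Integrable (totalError θ θhat t) μ) {a c : ℝ} (ha : 0 ≤ a) (hc : 0 ≤ c) (i : Fin N) :
    Integrable (fun ω => agentStep G π est mode u a c i (playState θ θhat t ω, ξ t i ω)) μ := by
  have hg := gainConst_nonneg G.γ_lt_one G.sqrt_γ_lt_one hR
  have hm := hs.measurable_agentStep (G := G) (est := est) (mode := mode) hΛ hu a c i
  have hmω : Measurable fun ω => agentStep G π est mode u a c i (playState θ θhat t ω, ξ t i ω) :=
    hm.comp ((play.measurable_playState t).prodMk (play.measurable_episodes t i))
  refine ⟨hmω.aestronglyMeasurable, ?_⟩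
  rw [HasFiniteIntegral, play.lintegral_episode t i hm.enorm]
  set C := a * D * gainConst G.γ R with hC
  have hC0 : 0 ≤ C := by positivity
  have hi : Integrable (fun ω => C * (N * Λ * (2 * N * totalError θ θhat t ω)) +
      C * (N ^ 2 * B) + c * (N ^ 3 * V ^ 2)) μ :=
    (((((hx.const_mul _).const_mul _).const_mul _).add (integrable_const _)).add
      (integrable_const _))
  have hT0 : ∀ ω, 0 ≤ totalError θ θhat t ω := fun ω =>
    Finset.sum_nonneg fun i _ => Finset.sum_nonneg fun j _ => norm_nonneg _
  refine lt_of_le_of_lt (lintegral_mono fun ω => ?_) hi.lintegral_lt_top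
  have h1 := beliefDist_const_believer_le mode (fun n => θhat t n ω) (θ t ω) i
  have h2 := sum_norm_sub_le_totalError θ θhat t ω
  have h3 : beliefDist (fun _ => θhat t i ω) (fun n => θhat t (mode.believer i n) ω) ≤
      2 * N * totalError θ θhat t ω := h1.trans (by gcongr)
  have h0 := beliefDist_nonneg (fun _ => θhat t i ω) (fun n => θhat t (mode.believer i n) ω)
  refine (hs.lintegral_episodeLaw_quadratic_le hB (fun n => θhat t (mode.believer i n) ω)
    (c₀ := C * (N * Λ * beliefDist (fun _ => θhat t i ω)
      (fun n => θhat t (mode.believer i n) ω))) (c₁ := C) (c₂ := c) (by positivity) hC0 hc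
    fun e => ?_).trans (ENNReal.ofReal_le_ofReal ?_)
  · have hn := hs.norm_stochGrad_le hr hR est i (fun n => θhat t (mode.believer i n) ω)
      (θhat t i ω) e
    have hb := hu.bound i (θ t ω)
    have hinner : |inner ℝ (stochGrad G π est i (θhat t i ω) e) (blockGrad i u (θ t ω))| ≤
        gainConst G.γ R * (π.scoreSum (fun n => θhat t (mode.believer i n) ω) (e.main e.T₁).1
          (e.main e.T₁).2 + N * Λ * beliefDist (fun _ => θhat t i ω)
            (fun n => θhat t (mode.believer i n) ω)) * D :=
      (abs_real_inner_le_norm _ _).trans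
        (mul_le_mul hn hb (norm_nonneg _) ((norm_nonneg _).trans hn))
    unfold agentStep playState
    refine (abs_add_le _ _).trans ?_
    rw [abs_neg, abs_mul, abs_mul, abs_of_nonneg ha, abs_of_nonneg hc, abs_sq]
    have := mul_le_mul_of_nonneg_left hinner ha
    refine (add_le_add this le_rfl).trans (le_of_eq ?_)
    rw [hC]
    ring
  · gcongr

/-- The coefficient of the belief errors in the expected decrease. -/
def errorConst (N : ℕ) (γ R B V Λ : ℝ) : ℝ :=
  biasConst N γ R B V Λ * gradBound N γ R B * (1 + N) +
    8 * gradBound N γ R B * gainConst γ R * N ^ 2 * Λ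

lemma errorConst_nonneg {γ : ℝ} (hγ : γ < 1) (hγ' : Real.sqrt γ < 1) (hR : 0 ≤ R) (hB : 0 ≤ B)
    (hΛ : 0 ≤ Λ) : 0 ≤ errorConst N γ R B V Λ := by
  have h1 := gainConst_nonneg hγ hγ' hR
  have h2 := gradBound_nonneg (N := N) hγ hR hB
  have h3 := biasConst_nonneg (N := N) (V := V) hγ hγ' hR hB hΛ
  unfold errorConst
  positivity

/-- Summed over the agents, the bias gives the factor `1 + N`, one for the evaluation of scores and
`N` for the acting parameters. The linear term of the descent estimate gives `4 * 2 * N * N`.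
Together they form `errorConst`. -/
lemma IsPotential.sum_integral_agentStep_le (hu : IsPotential G π u) (hs : ScoreBounds π B V Λ)
    (hB : 0 ≤ B) (hΛ : 0 ≤ Λ) (hR : 0 ≤ R) (hr : BoundedRewards G R) (est : GainEstimator)
    (mode : EpisodeMode) {a c : ℝ} (ha : 0 ≤ a) (hc : 0 ≤ c) (Z : Params M × (Fin N → Params M)) :
    4 * gradBound N G.γ R B * (a * gainConst G.γ R * (N * Λ)) *
        ∑ i, beliefDist (fun _ => Z.2 i) (fun n => Z.2 (mode.believer i n)) +
      ∑ i, ∫ e, agentStep G π est mode u a c i (Z, e)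
        ∂episodeLaw G π (fun n => Z.2 (mode.believer i n)) ≤
      -a * ‖fullGrad u Z.1‖ ^ 2 + a * errorConst N G.γ R B V Λ * ∑ i, ‖Z.2 i - Z.1‖ +
        N * (c * (N ^ 3 * V ^ 2)) := by
  have hg := gainConst_nonneg G.γ_lt_one G.sqrt_γ_lt_one hR
  have hD := gradBound_nonneg (N := N) G.γ_lt_one hR hB
  have h1 : ∀ i, ∫ e, agentStep G π est mode u a c i (Z, e)
      ∂episodeLaw G π (fun n => Z.2 (mode.believer i n)) ≤
      -(a * ‖blockGrad i u Z.1‖ ^ 2) + a * (biasConst N G.γ R B V Λ * gradBound N G.γ R B) *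
        (‖Z.2 i - Z.1‖ + beliefDist (fun n => Z.2 (mode.believer i n)) (fun _ => Z.1)) +
        c * (N ^ 3 * V ^ 2) := by
    intro i
    have := hs.integral_step_le hB hΛ hR hr est i (fun n => Z.2 (mode.believer i n)) Z.1 (Z.2 i)
      ha hc
    rw [(hu i Z.1).2] at this
    exact this
  have h2 := Finset.sum_le_sum fun i (_ : i ∈ Finset.univ) => h1 i
  rw [Finset.sum_add_distrib, Finset.sum_add_distrib, ← Finset.mul_sum, Finset.sum_add_distrib,
    sum_beliefDist_believer, Finset.sum_neg_distrib, ← Finset.mul_sum,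
    ← BlockSmooth.norm_fullGrad_sq, Finset.sum_const, Finset.card_univ, Fintype.card_fin,
    nsmul_eq_mul] at h2
  have h3 := sum_beliefDist_const_believer_le mode Z.2 Z.1
  have h4 := mul_le_mul_of_nonneg_left h3
    (by positivity : 0 ≤ 4 * gradBound N G.γ R B * (a * gainConst G.γ R * (N * Λ)))
  refine (add_le_add h4 h2).trans (le_of_eq ?_)
  rw [errorConst]
  ring

/-- The expected decrease of the potential gap at one iteration. -/
lemma IsNetworkedPlay.condExp_potentialGap_le
    (play : IsNetworkedPlay μ G π est mode α w θ θhat ξ) (hu : IsPotential G π u)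
    (hs : ScoreBounds π B V Λ) (hB : 0 ≤ B) (hΛ : 0 ≤ Λ) (hR : 0 ≤ R) (hr : BoundedRewards G R)
    (t : ℕ) (hα : 0 ≤ α t) (hx : Integrable (totalError θ θhat t) μ)
    (hgap : ∀ t, Integrable (fun ω => potentialGap u (θ t ω)) μ) :
    ∀ᵐ ω ∂μ, (μ[fun ω' => potentialGap u (θ (t + 1) ω') | pastSigma θ θhat ξ t]) ω -
        potentialGap u (θ t ω) ≤
      -α t * ‖fullGrad u (θ t ω)‖ ^ 2 +
        α t * errorConst N G.γ R B V Λ * ∑ i, ‖θhat t i ω - θ t ω‖ +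
        4 * (gradLip N G.γ R B V Λ * (1 + N)) * N ^ 5 * gainConst G.γ R ^ 2 * V ^ 2 * α t ^ 2 := by
  have hg := gainConst_nonneg G.γ_lt_one G.sqrt_γ_lt_one hR
  have hD := gradBound_nonneg (N := N) G.γ_lt_one hR hB
  have hK0 := gradLip_nonneg (N := N) (V := V) G.γ_lt_one hR hB hΛ
  have hsm := hu.blockSmooth hs hB hΛ hR hr
  set D := gradBound N G.γ R B with hDdef
  set K := gradLip N G.γ R B V Λ * (1 + N) with hKdef
  have hK : 0 ≤ K := by positivity
  set c := 4 * K * N * (α t * gainConst G.γ R) ^ 2 with hc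
  have hc0 : 0 ≤ c := by positivity
  have hFle := play.pastSigma_le t
  have hZ := measurable_playState_pastSigma θ θhat ξ t
  -- `Y` collects what the past determines and passes through the conditional expectation; each `H
  -- i` depends on one fresh episode and is integrated against its conditional law.
  set Y : Ω → ℝ := fun ω => potentialGap u (θ t ω) + 4 * D * (α t * gainConst G.γ R * (N * Λ)) *
    ∑ i, beliefDist (fun _ => θhat t i ω) (fun n => θhat t (mode.believer i n) ω) with hY
  set H : Fin N → Ω → ℝ := fun i ω =>
    agentStep G π est mode u (α t) c i (playState θ θhat t ω, ξ t i ω) with hH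
  have hcont : Continuous fun Z : Params M × (Fin N → Params M) => potentialGap u Z.1 +
      4 * D * (α t * gainConst G.γ R * (N * Λ)) *
        ∑ i, beliefDist (fun _ => Z.2 i) (fun n => Z.2 (mode.believer i n)) := by
    have hc1 := hsm.continuous
    unfold potentialGap beliefDist
    fun_prop
  have hYm : StronglyMeasurable[pastSigma θ θhat ξ t] Y := by
    have := hcont.measurable.comp hZ
    exact this.stronglyMeasurable
  have hYi : Integrable Y μ := by
    refine (hgap t).add (Integrable.const_mul (integrable_finsetSum _ fun i _ => ?_) _)
    refine Integrable.mono' (hx.const_mul (2 * N)) ?_ (Eventually.of_forall fun ω => ?_)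
    · have hc2 : Continuous fun Z : Params M × (Fin N → Params M) =>
          beliefDist (fun _ => Z.2 i) (fun n => Z.2 (mode.believer i n)) := by
        unfold beliefDist
        fun_prop
      exact (hc2.measurable.comp (play.measurable_playState t)).aestronglyMeasurable
    · rw [Real.norm_of_nonneg (beliefDist_nonneg _ _)]
      exact (beliefDist_const_believer_le mode (fun n => θhat t n ω) (θ t ω) i).trans
        (mul_le_mul_of_nonneg_left (sum_norm_sub_le_totalError θ θhat t ω) (by positivity))
  have hHi : ∀ i, Integrable (H i) μ := fun i =>
    play.integrable_agentStep hs hB hΛ hr hR hD hsm t hx hα hc0 i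
  have hsumi : Integrable (∑ i, H i) μ := integrable_finsetSum' _ fun i _ => hHi i
  have h1 : (fun ω => potentialGap u (θ (t + 1) ω)) ≤ᵐ[μ] Y + ∑ i, H i := by
    refine Eventually.of_forall fun ω => ?_
    rw [Pi.add_apply, Finset.sum_apply]
    exact play.potentialGap_succ_le hs hΛ hr hR hD hK hsm hα ω
  have h2 := condExp_mono (m := pastSigma θ θhat ξ t) (hgap (t + 1)) (hYi.add hsumi) h1
  have h3 := condExp_add hYi hsumi (pastSigma θ θhat ξ t)
  have h4 := condExp_finsetSum (s := Finset.univ) (f := H) (fun i _ => hHi i)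
    (pastSigma θ θhat ξ t)
  rw [condExp_of_stronglyMeasurable hFle hYm hYi] at h3
  have h5 : ∀ᵐ ω ∂μ, ∀ i, (μ[H i | pastSigma θ θhat ξ t]) ω = ∫ e, agentStep G π est mode u (α t) c i
      (playState θ θhat t ω, e) ∂episodeLaw G π (fun n => θhat t (mode.believer i n) ω) := by
    refine ae_all_iff.2 fun i => ?_
    have := condExp_eq_integral_kernel hFle hZ (play.measurable_episodes t i)
      (agentKernel G π mode i) (play.law_agentKernel t i)
      (hs.measurable_agentStep (G := G) (est := est) (mode := mode) hΛ hsm (α t) c i) (hHi i)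
    filter_upwards [this] with ω hω
    rw [hω, agentKernel_apply]
    rfl
  filter_upwards [h2, h3, h4, h5] with ω h2 h3 h4 h5
  have h6 := hu.sum_integral_agentStep_le hs hB hΛ hR hr est mode hα hc0 (playState θ θhat t ω)
  rw [h3, Pi.add_apply, h4, Finset.sum_apply, Finset.sum_congr rfl fun i _ => h5 i] at h2
  have e : N * (c * (N ^ 3 * V ^ 2)) =
      4 * K * N ^ 5 * gainConst G.γ R ^ 2 * V ^ 2 * α t ^ 2 := by
    rw [hc]
    ring
  rw [e] at h6
  simp only [playState] at h6 h2
  rw [hY] at h2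
  linarith

end Descent

/-! ### Almost sure summability -/

/-- Tonelli: the sum of the nonnegative terms has finite expectation, hence is finite almost
everywhere. -/
lemma ae_summable_of_summable_integral {Ω : Type*} [MeasurableSpace Ω] {μ : Measure Ω}
    {f : ℕ → Ω → ℝ} (h0 : ∀ t ω, 0 ≤ f t ω) (hi : ∀ t, Integrable (f t) μ)
    (hs : Summable fun t => ∫ ω, f t ω ∂μ) : ∀ᵐ ω ∂μ, Summable fun t => f t ω := by
  have hm : ∀ t, AEMeasurable (fun ω => ENNReal.ofReal (f t ω)) μ := fun t =>
    (hi t).aestronglyMeasurable.aemeasurable.ennreal_ofReal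
  have h1 : ∫⁻ ω, ∑' t, ENNReal.ofReal (f t ω) ∂μ ≠ ⊤ := by
    rw [lintegral_tsum hm]
    simp_rw [← fun t => ofReal_integral_eq_lintegral_ofReal (hi t) (Eventually.of_forall (h0 t))]
    exact hs.tsum_ofReal_ne_top
  filter_upwards [ae_lt_top' (AEMeasurable.tsum hm) h1] with ω hω
  refine (ENNReal.summable_toReal hω.ne).congr fun t => ?_
  rw [ENNReal.toReal_ofReal (h0 t ω)]

section Convergence

variable {N : ℕ} {M : Fin N → ℕ} {S A : Type*} [MeasurableSpace S] [MeasurableSpace A]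
  {ν : Measure A} [SigmaFinite ν] {G : MarkovGame N S A} {π : PolicyFamily M S A ν}
  {u : Params M → ℝ} {R B V Λ : ℝ} {est : GainEstimator} {mode : EpisodeMode} {α : ℕ → ℝ}
  {E : ℕ → Fin N → Fin N → Prop} {w : ℕ → Fin N → Fin N → Fin N → ℝ} {h : ℝ}
  {Ω : Type*} [MeasurableSpace Ω] {μ : Measure Ω} {θ : ℕ → Ω → Params M}
  {θhat : ℕ → Fin N → Ω → Params M} {ξ : ℕ → Fin N → Ω → Episode N S A}

lemma IsNetworkedPlay.integrable_potentialGap [IsProbabilityMeasure μ]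
    (play : IsNetworkedPlay μ G π est mode α w θ θhat ξ)
    (hu : IsPotential G π u) (hs : ScoreBounds π B V Λ) (hB : 0 ≤ B) (hΛ : 0 ≤ Λ) (hR : 0 ≤ R)
    (hr : BoundedRewards G R) (t : ℕ) : Integrable (fun ω => potentialGap u (θ t ω)) μ := by
  have hc : Continuous (potentialGap u) :=
    continuous_const.sub (hu.blockSmooth hs hB hΛ hR hr).continuous
  refine Integrable.of_bound (hc.measurable.comp (play.measurable_params t)).aestronglyMeasurable
    (N * (2 * ((1 - G.γ)⁻¹ * R))) (Eventually.of_forall fun ω => ?_)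
  rw [
    Real.norm_of_nonneg (potentialGap_nonneg (hu.bddAbove hs hB hΛ hR hr) _)]
  exact hu.potentialGap_le hs hB hΛ hR hr _

/-- Each agent knows its own block exactly, so the diagonal terms drop out. -/
lemma IsNetworkedPlay.sum_norm_belief_sub_le
    (play : IsNetworkedPlay μ G π est mode α w θ θhat ξ) (hw : BeliefWeights E w h) (t : ℕ)
    (ω : Ω) :
    ∑ i, ‖θhat t i ω - θ t ω‖ ≤
      ∑ i, ∑ j ∈ Finset.univ.erase i, ‖θ t ω j - θhat t i ω j‖ := by
  refine Finset.sum_le_sum fun i _ => (Params.norm_le_sum _).trans (le_of_eq ?_)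
  rw [← Finset.add_sum_erase _ _ (Finset.mem_univ i), PiLp.sub_apply, play.belief_self hw,
    sub_self, norm_zero, zero_add]
  exact Finset.sum_congr rfl fun j _ => norm_sub_rev _ _

/-- Taking expectations in the descent inequality removes the conditioning. The expected gaps
telescope and stay nonnegative, and the two error terms are summable, so no martingale convergence
theorem is needed. -/
lemma IsNetworkedPlay.summable_integral_norm_fullGrad [IsProbabilityMeasure μ]
    (play : IsNetworkedPlay μ G π est mode α w θ θhat ξ) (hN : 0 < N) (hu : IsPotential G π u)
    (hs : ScoreBounds π B V Λ) (hB : 0 ≤ B) (hΛ : 0 ≤ Λ) (hR : 0 ≤ R) (hr : BoundedRewards G R)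
    (hE : ConnectedNetwork E) (hh : 0 < h) (hh1 : h ≤ 1) (hw : BeliefWeights E w h) {κ : ℝ}
    (hinit : InitialBeliefErrors μ θ θhat κ) (hα : ∀ t, 0 < α t) {β : ℝ} (hβ : 1 / 2 < β)
    (hαβ : α =O[atTop] fun t : ℕ => (t : ℝ) ^ (-β)) :
    ∀ᵐ ω ∂μ, Summable fun t => α t * ‖fullGrad u (θ t ω)‖ ^ 2 := by
  obtain ⟨a, ha0, haα, hanti, has⟩ := exists_antitone_dominating hβ hαβ
  have hgap := play.integrable_potentialGap hu hs hB hΛ hR hr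
  have hT := play.integrable_totalError hw hinit hs hB hΛ hr hR
  have hsumT := play.summable_integral_totalError hN hE hh hh1 hw hinit hs hB hΛ hr hR ha0 haα
    hanti has
  have hsm := hu.blockSmooth hs hB hΛ hR hr
  have hEc := errorConst_nonneg (N := N) (V := V) G.γ_lt_one G.sqrt_γ_lt_one hR hB hΛ
  have hK := gradLip_nonneg (N := N) (V := V) G.γ_lt_one hR hB hΛ
  set Ec := errorConst N G.γ R B V Λ
  set c := 4 * (gradLip N G.γ R B V Λ * (1 + N)) * N ^ 5 * gainConst G.γ R ^ 2 * V ^ 2 with hc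
  have hc0 : 0 ≤ c := by positivity
  have hgi : ∀ t, Integrable (fun ω => ‖fullGrad u (θ t ω)‖ ^ 2) μ := fun t => by
    refine Integrable.of_bound ((hsm.continuous_fullGrad.norm.pow 2).measurable.comp
      (play.measurable_params t)).aestronglyMeasurable (N * gradBound N G.γ R B ^ 2)
      (Eventually.of_forall fun ω => ?_)
    rw [Real.norm_of_nonneg (sq_nonneg _)]
    exact hsm.norm_fullGrad_sq_le _
  have hT0 : ∀ t ω, 0 ≤ totalError θ θhat t ω := fun t ω =>
    Finset.sum_nonneg fun i _ => Finset.sum_nonneg fun j _ => norm_nonneg _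
  have hstep : ∀ t, ∫ ω, α t * ‖fullGrad u (θ t ω)‖ ^ 2 ∂μ ≤
      (∫ ω, potentialGap u (θ t ω) ∂μ - ∫ ω, potentialGap u (θ (t + 1) ω) ∂μ) +
        (Ec * (a t * ∫ ω, totalError θ θhat t ω ∂μ) + c * a t ^ 2) := by
    intro t
    have hd := play.condExp_potentialGap_le hu hs hB hΛ hR hr t (hα t).le (hT t) hgap
    have i1 := (integrable_condExp (μ := μ) (m := pastSigma θ θhat ξ t)
      (f := fun ω => potentialGap u (θ (t + 1) ω)))
    have i2 : Integrable (fun ω => α t * Ec * totalError θ θhat t ω) μ := (hT t).const_mul _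
    have i3 : Integrable (fun ω => potentialGap u (θ t ω) -
        (μ[fun ω' => potentialGap u (θ (t + 1) ω') | pastSigma θ θhat ξ t]) ω) μ := (hgap t).sub i1
    have i4 : Integrable (fun ω => potentialGap u (θ t ω) -
        (μ[fun ω' => potentialGap u (θ (t + 1) ω') | pastSigma θ θhat ξ t]) ω +
          α t * Ec * totalError θ θhat t ω) μ := i3.add i2
    -- The inequality is rearranged with the gradient term on the left; all other terms are
    -- integrable, so it can be integrated termwise.
    have hle := integral_mono_ae ((hgi t).const_mul (α t)) (i4.add (integrable_const (c * α t ^ 2)))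
      (hd.mono fun ω hω => by
        have h1 := mul_le_mul_of_nonneg_left (sum_norm_sub_le_totalError θ θhat t ω)
          (mul_nonneg (hα t).le hEc)
        simp only [Pi.add_apply]
        linarith)
    refine hle.trans ?_
    simp only [Pi.add_apply]
    rw [integral_add i4 (integrable_const _), integral_add i3 i2, integral_sub (hgap t) i1,
      integral_condExp (play.pastSigma_le t), integral_const_mul, integral_const]
    have hαa : α t ≤ a t := (le_abs_self _).trans (haα t)
    have h2 : α t * Ec * ∫ ω, totalError θ θhat t ω ∂μ ≤
        Ec * (a t * ∫ ω, totalError θ θhat t ω ∂μ) := by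
      rw [mul_comm (α t) Ec, mul_assoc]
      exact mul_le_mul_of_nonneg_left
        (mul_le_mul_of_nonneg_right hαa (integral_nonneg fun ω => hT0 t ω)) hEc
    have h3 : c * α t ^ 2 ≤ c * a t ^ 2 :=
      mul_le_mul_of_nonneg_left (pow_le_pow_left₀ (hα t).le hαa 2) hc0
    simp only [probReal_univ, one_smul]
    linarith
  refine ae_summable_of_summable_integral (fun t ω => mul_nonneg (hα t).le (sq_nonneg _))
    (fun t => (hgi t).const_mul _) ?_
  have hq : Summable fun t => Ec * (a t * ∫ ω, totalError θ θhat t ω ∂μ) + c * a t ^ 2 :=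
    (hsumT.mul_left Ec).add (has.mul_left c)
  have hq0 : ∀ t, 0 ≤ Ec * (a t * ∫ ω, totalError θ θhat t ω ∂μ) + c * a t ^ 2 := fun t =>
    add_nonneg (mul_nonneg hEc (mul_nonneg (ha0 t) (integral_nonneg fun ω => hT0 t ω)))
      (mul_nonneg hc0 (sq_nonneg _))
  -- Partial sums are bounded by the initial expected gap plus the total error, as the final
  -- expected gap is nonnegative.
  refine summable_of_sum_range_le
    (c := ∫ ω, potentialGap u (θ 0 ω) ∂μ +
      ∑' t, (Ec * (a t * ∫ ω, totalError θ θhat t ω ∂μ) + c * a t ^ 2))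
    (fun t => integral_nonneg fun ω => mul_nonneg (hα t).le (sq_nonneg _)) fun n => ?_
  refine (Finset.sum_le_sum fun t _ => hstep t).trans ?_
  rw [Finset.sum_add_distrib, Finset.sum_range_sub']
  have h1 : 0 ≤ ∫ ω, potentialGap u (θ n ω) ∂μ :=
    integral_nonneg fun ω => potentialGap_nonneg (hu.bddAbove hs hB hΛ hR hr) _
  have h2 := hq.sum_le_tsum (Finset.range n) fun t _ => hq0 t
  linarith

end Convergence

end MarkovPG

end

theorem lemma5 (N : ℕ) (hN : 0 < N) (γ R B V Λ : ℝ) (hγ₀ : 0 < γ) (hγ₁ : γ < 1)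
    (hR : 0 < R) (hB : 0 ≤ B) (hV : 0 ≤ V) (hΛ : 0 ≤ Λ) :
    ∃ L : ℝ, 0 < L ∧
      ∀ (M : Fin N → ℕ) (S A : Type*) [MeasurableSpace S] [MeasurableSpace A]
        (ν : MeasureTheory.Measure A) [MeasureTheory.SigmaFinite ν]
        (G : MarkovPG.MarkovGame N S A) (π : MarkovPG.PolicyFamily M S A ν)
        (u : MarkovPG.Params M → ℝ),
        G.γ = γ → MarkovPG.BoundedRewards G R → MarkovPG.ScoreBounds π B V Λ →
        MarkovPG.IsPotential G π u →
        -- the potential is bounded above, and the policy gradients are `L`-Lipschitz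
        BddAbove (Set.range u) ∧
        (∀ (i : Fin N) (θ₁ θ₂ : MarkovPG.Params M),
          ‖MarkovPG.blockGrad i (MarkovPG.utility G π i) θ₁
            - MarkovPG.blockGrad i (MarkovPG.utility G π i) θ₂‖ ≤ L * ‖θ₁ - θ₂‖) ∧
        ∀ (E : ℕ → Fin N → Fin N → Prop) (w : ℕ → Fin N → Fin N → Fin N → ℝ) (h κ β : ℝ)
          (α : ℕ → ℝ) (est : MarkovPG.GainEstimator) (mode : MarkovPG.EpisodeMode)
          (Ω : Type*) [MeasurableSpace Ω] (μ : MeasureTheory.Measure Ω)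
          [MeasureTheory.IsProbabilityMeasure μ]
          (θ : ℕ → Ω → MarkovPG.Params M) (θhat : ℕ → Fin N → Ω → MarkovPG.Params M)
          (ξ : ℕ → Fin N → Ω → MarkovPG.Episode N S A),
          MarkovPG.ConnectedNetwork E →
          h ∈ Set.Ioo (0 : ℝ) 1 → MarkovPG.BeliefWeights E w h →
          0 ≤ κ → MarkovPG.InitialBeliefErrors μ θ θhat κ →
          β ∈ Set.Ioo (1 / 2 : ℝ) 1 → (∀ t, 0 < α t) →
          α =O[Filter.atTop] (fun t : ℕ => (t : ℝ) ^ (-β)) →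
          MarkovPG.IsNetworkedPlay μ G π est mode α w θ θhat ξ →
          (∀ t, MeasureTheory.Integrable (fun ω => MarkovPG.potentialGap u (θ t ω)) μ) ∧
          (∀ t, ∀ᵐ ω ∂μ,
            (μ[fun ω' => MarkovPG.potentialGap u (θ (t + 1) ω') |
                MarkovPG.pastSigma θ θhat ξ t]) ω
              - MarkovPG.potentialGap u (θ t ω)
              ≤ - α t * ‖MarkovPG.fullGrad u (θ t ω)‖ ^ 2
                + α t * L * ∑ i, ∑ j ∈ Finset.univ.erase i, ‖θ t ω j - θhat t i ω j‖
                + 1 / (2 * (1 - Real.sqrt γ)) * L * (N : ℝ) ^ 3 * R * V ^ 2 * α t ^ 2) ∧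
          (∀ᵐ ω ∂μ, Summable (fun t => α t * ‖MarkovPG.fullGrad u (θ t ω)‖ ^ 2)) := by
  have hq1 : Real.sqrt γ < 1 := by
    rw [Real.sqrt_lt' one_pos]
    simpa using hγ₁
  have hEc := MarkovPG.errorConst_nonneg (N := N) (V := V) hγ₁ hq1 hR.le hB hΛ
  have hK := MarkovPG.gradLip_nonneg (N := N) (V := V) hγ₁ hR.le hB hΛ
  have hq2 : 0 < 1 - Real.sqrt γ := by linarith
  set K := MarkovPG.gradLip N γ R B V Λ * (1 + N) with hKdef
  have hK0 : 0 ≤ K := by positivity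
  set Ec := MarkovPG.errorConst N γ R B V Λ with hEcdef
  set C := MarkovPG.gainConst γ R with hCdef
  have hn0 : 0 ≤ 8 * K * N ^ 2 * C ^ 2 * (1 - Real.sqrt γ) / R := by positivity
  -- `K` serves the Lipschitz bound of the gradients, `Ec` the coefficient of the belief errors, and
  -- `1` makes `L` positive. The last summand is chosen so that its product with `N³ R / (2 (1 -
  -- √γ))` is `4 K N⁵ C²`, the noise constant obtained above.
  refine ⟨1 + K + Ec + 8 * K * N ^ 2 * C ^ 2 * (1 - Real.sqrt γ) / R, by positivity, ?_⟩
  set L := 1 + K + Ec + 8 * K * N ^ 2 * C ^ 2 * (1 - Real.sqrt γ) / R with hL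
  intro M S A _ _ ν _ G π u hGγ hr hs hu
  subst hGγ
  refine ⟨hu.bddAbove hs hB hΛ hR.le hr, fun i θ₁ θ₂ => ?_, ?_⟩
  · refine (hs.norm_blockGrad_utility_sub_le hB hΛ hR.le hr i θ₁ θ₂).trans ?_
    exact mul_le_mul_of_nonneg_right (by linarith) (norm_nonneg _)
  intro E w h κ β α est mode Ω _ μ _ θ θhat ξ hE hh hw _ hinit hβ hα hαβ play
  have hgap := play.integrable_potentialGap hu hs hB hΛ hR.le hr
  refine ⟨hgap, fun t => ?_, ?_⟩
  · have hT := play.integrable_totalError hw hinit hs hB hΛ hr hR.le t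
    filter_upwards [play.condExp_potentialGap_le hu hs hB hΛ hR.le hr t (hα t).le hT hgap]
      with ω hω
    refine hω.trans (add_le_add (add_le_add le_rfl ?_) ?_)
    · have h1 : 0 ≤ ∑ i, ‖θhat t i ω - θ t ω‖ := Finset.sum_nonneg fun _ _ => norm_nonneg _
      exact mul_le_mul (mul_le_mul_of_nonneg_left (by linarith) (hα t).le)
        (play.sum_norm_belief_sub_le hw t ω) h1 (mul_nonneg (hα t).le (by linarith))
    · have h2 : 8 * K * N ^ 2 * C ^ 2 * (1 - Real.sqrt G.γ) / R ≤ L := by linarith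
      calc 4 * K * N ^ 5 * C ^ 2 * V ^ 2 * α t ^ 2
          = 1 / (2 * (1 - Real.sqrt G.γ)) * (8 * K * N ^ 2 * C ^ 2 * (1 - Real.sqrt G.γ) / R) *
              (N : ℝ) ^ 3 * R * V ^ 2 * α t ^ 2 := by
            field_simp
            ring
        _ ≤ _ := by gcongr
  · exact play.summable_integral_norm_fullGrad hN hu hs hB hΛ hR.le hr hE hh.1 hh.2.le hw hinit hα
      hβ.1 hαβ
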